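/- **Setting.** Let $N\ge 1$, let $\Omega\subset\mathbb R^N$ be a bounded domain with Lipschitz boundary, and let $\Gamma_D,\Gamma_N\subset\partial\Omega$ be disjoint relatively open sets with $\mathcal H^{N-1}(\partial\Omega\setminus(\Gamma_D\cup\Gamma_N))=0$. Let $T>0$ and set $$V=\{u\in H^1(\Omega):\operatorname{Tr}u=0\ \mathcal H^{N-1}\text{-a.e. on }\Gamma_D\},\qquad X=\{u\in H^2(\Omega):\partial_\nu u=\nu\cdot\operatorname{Tr}(\nabla u)=0\ \mathcal H^{N-1}\text{-a.e. on }\Gamma_N\},$$ with the norms of $H^1(\Omega)$ and $H^2(\Omega)$. Let $B:V\to V^*$ be given by $\langle Bu,v\rangle_V=\int_\Omega(\nabla u\cdot\nabla v+uv)\,dx$, and assume the elliptic regularity $B^{-1}w\in H^2(\Omega)\cap V$ for all $w\in L^2(\Omega)$. For $g,h\in V^*$, $g\le h$ in $V^*$ means $\langle g,v\rangle_V\le\langle h,v\rangle_V$ for all $v\in V$ with $v\ge0$ a.e. in $\Omega$. **Data.** Let $\lambda\ge0$, $z_0\in X\cap V$, $f\in L^2(0,T;L^2(\Omega))\cap W^{1,2}(0,T;V^*)$,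 $\sigma\in L^\infty(\Omega\times(0,T))\cap W^{1,2}(0,T;L^p(\Omega))$, where $p=\max\{1,N/2\}$ if $N\ne2$ and $p>1$ if $N=2$, and let $\gamma:\mathbb R\to\mathbb R$ be continuous. Here $f$ and $\sigma$ denote the representatives that are continuous on $[0,T]$ with values in $V^*$ and $L^p(\Omega)$. Suppose that: 1. there is $L>0$ with $(\gamma(t)-\gamma(s))(t-s)+L|t-s|^2\ge0$ for all $t,s\in\mathbb R$ and $\lambda-L\|\sigma\|_{L^\infty(\Omega\times(0,T))}>0$; 2. there is $C_1>0$ with $|\gamma(s)|\le C_1(|s|+1)$ for all $s\in\mathbb R$; 3. $-\Delta z_0+\lambda z_0+\sigma(\cdot,0)\gamma(z_0)\le f(\cdot,0)$ in $V^*$; 4. there is $\tilde f\in L^2(\Omega)$ with $f(x,t)\ge\tilde f(x)$ for a.e. $(x,t)\in\Omega\times(0,T)$; 5. $\sigma\ge0$ a.e. in $\Omega\times(0,T)$. **Strong solutions.** A strong solution on $[0,T]$ is a function $z\in C([0,T];L^2(\Omega))\cap W^{1,2}(0,T;L^2(\Omega))\cap L^2(0,T;X\cap V)$ such that $z(0)=z_0$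 and, a.e. in $\Omega\times(0,T)$, $$\partial_tz\le0,\qquad -\Delta z+\lambda z+\sigma\gamma(z)\le f,\qquad \partial_tz\,(-\Delta z+\lambda z+\sigma\gamma(z)-f)=0 .$$ **Energy.** Let $\hat\gamma$ be a primitive of $\gamma$ and, for $u\in V$ and $t\in[0,T]$, let $$\mathcal E(u,t)=\tfrac12\|\nabla u\|_{L^2(\Omega)}^2+\tfrac\lambda2\|u\|_{L^2(\Omega)}^2+\int_\Omega\sigma(t)\hat\gamma(u)\,dx-\langle f(t),u\rangle_V .$$ **Theorem.** The integral in the definition of $\mathcal E(u,t)$ exists for all $u\in V$ and $t\in[0,T]$. Let $z$ be any strong solution on $[0,T]$. Then $z(t)\in V$ for every $t\in[0,T]$, and: (i) (Complete irreversibility) $\partial_tz\le0$ a.e. in $\Omega\times(0,T)$. (ii) (Unilateral equilibrium) For every $t\in[0,T]$ and every $v\in V$ with $v\le z(t)$ a.e. in $\Omega$, $\mathcal E(z(t),t)\le\mathcal E(v,t)$. (iii) (Energy balance) The function $t\mapsto\mathcal E(z(t),t)$ is absolutely continuous on $[0,T]$, the integrals below exist, and for all $t,s\in[0,T]$ $$\mathcal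 E(z(t),t)-\mathcal E(z(s),s)=\int_s^t\int_\Omega\partial_t\sigma(r)\,\hat\gamma(z(r))\,dx\,dr-\int_s^t\langle\partial_tf(r),z(r)\rangle_V\,dr .$$ In particular, if $\partial_tf\equiv0$ and $\partial_t\sigma\equiv0$, then $z(t)=z_0$ for all $t\in[0,T]$. -/

import Mathlib

open MeasureTheory Set Filter Topology
open scoped ENNReal ContDiff

namespace UnidirectionalEvolution

/-- Euclidean space `ℝ^N`. -/
abbrev Euc (N : ℕ) : Type := EuclideanSpace ℝ (Fin N)

/-- The `i`-th standard unit vector of `ℝ^N`. -/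
noncomputable def stdVec {N : ℕ} (i : Fin N) : Euc N := EuclideanSpace.single i (1 : ℝ)

/-! ### Geometry of the domain -/

/-- Lipschitz boundary: near each boundary point `x` the set `Ω` is, in the direction of some
unit vector `e`, the open epigraph of a Lipschitz function `ψ` of the component of `y`
orthogonal to `e`. -/
def HasLipschitzBoundary {N : ℕ} (Ω : Set (Euc N)) : Prop :=
  ∀ x ∈ frontier Ω, ∃ (e : Euc N) (r : ℝ) (K : NNReal) (ψ : Euc N → ℝ),
    ‖e‖ = 1 ∧ 0 < r ∧ LipschitzWith K ψ ∧
    ∀ y ∈ Metric.ball x r, y ∈ Ω ↔ ψ (y - (inner ℝ e y : ℝ) • e) < (inner ℝ e y : ℝ)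

/-- The `(N-1)`-dimensional Hausdorff measure on `ℝ^N`. -/
noncomputable def surfaceMeasure (N : ℕ) : Measure (Euc N) :=
  Measure.hausdorffMeasure ((N : ℝ) - 1)

/-- `ν` is an outer unit normal of `Ω` at `x`: near `x`, the set `Ω` contains every open cone
strictly inside the half-space `{⟪y - x, ν⟫ < 0}` and misses every open cone strictly inside
`{⟪y - x, ν⟫ > 0}`. For a Lipschitz domain such a `ν` is unique where it exists, and it exists
at almost every boundary point. -/
def IsOuterNormal {N : ℕ} (Ω : Set (Euc N)) (x ν : Euc N) : Prop :=
  ‖ν‖ = 1 ∧ ∀ ε > 0, ∃ r > 0, ∀ y ∈ Metric.ball x r,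
    ((inner ℝ (y - x) ν : ℝ) < -(ε * ‖y - x‖) → y ∈ Ω) ∧
    (ε * ‖y - x‖ < (inner ℝ (y - x) ν : ℝ) → y ∉ Ω)

/-- A bounded Lipschitz domain `Ω` with disjoint relatively open pieces `ΓD`, `ΓN` of its
boundary which cover it up to an `H^{N-1}`-null set. -/
structure IsMixedDomain {N : ℕ} (Ω ΓD ΓN : Set (Euc N)) : Prop where
  isOpen : IsOpen Ω
  isConnected : IsConnected Ω
  isBounded : Bornology.IsBounded Ω
  lipschitz : HasLipschitzBoundary Ω
  relOpen_D : ∃ O : Set (Euc N), IsOpen O ∧ ΓD = O ∩ frontier Ω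
  relOpen_N : ∃ O : Set (Euc N), IsOpen O ∧ ΓN = O ∩ frontier Ω
  disjoint : Disjoint ΓD ΓN
  null : surfaceMeasure N (frontier Ω \ (ΓD ∪ ΓN)) = 0

/-! ### Sobolev spaces -/

/-- Lebesgue measure on `Ω`. -/
noncomputable abbrev vol {N : ℕ} (Ω : Set (Euc N)) : Measure (Euc N) :=
  (volume : Measure (Euc N)).restrict Ω

/-- `L²(Ω)`. -/
abbrev L2 {N : ℕ} (Ω : Set (Euc N)) : Type := Lp ℝ 2 (vol Ω)

/-- `g` is the weak partial derivative `∂_i u` in `Ω`. -/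
def HasWeakPartial {N : ℕ} (Ω : Set (Euc N)) (i : Fin N) (u g : L2 Ω) : Prop :=
  ∀ φ : Euc N → ℝ, ContDiff ℝ ∞ φ → HasCompactSupport φ → tsupport φ ⊆ Ω →
    ∫ x in Ω, u x * fderiv ℝ φ x (stdVec i) = -∫ x in Ω, g x * φ x

section weak

variable {N : ℕ} {Ω : Set (Euc N)} {i : Fin N}

lemma integrable_mul_of_test (u : L2 Ω) {φ : Euc N → ℝ} (hφ : Continuous φ)
    (hc : HasCompactSupport φ) : Integrable (fun x => u x * φ x) (vol Ω) :=
  MemLp.integrable_mul (p := 2) (q := 2) (Lp.memLp u) (hφ.memLp_of_hasCompactSupport hc)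

lemma continuous_partial {φ : Euc N → ℝ} (hφ : ContDiff ℝ ∞ φ) :
    Continuous fun x => fderiv ℝ φ x (stdVec i) :=
  (hφ.continuous_fderiv (by simp)).clm_apply continuous_const

lemma hasCompactSupport_partial {φ : Euc N → ℝ} (hc : HasCompactSupport φ) :
    HasCompactSupport fun x => fderiv ℝ φ x (stdVec i) :=
  hc.fderiv_apply (𝕜 := ℝ) _

lemma HasWeakPartial.add {u v g h : L2 Ω} (hu : HasWeakPartial Ω i u g)
    (hv : HasWeakPartial Ω i v h) : HasWeakPartial Ω i (u + v) (g + h) := by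
  intro φ hφ hc hs
  have key : ∀ (a b : L2 Ω) (θ : Euc N → ℝ), Continuous θ → HasCompactSupport θ →
      ∫ x in Ω, (a + b : L2 Ω) x * θ x = (∫ x in Ω, a x * θ x) + ∫ x in Ω, b x * θ x := by
    intro a b θ hθ hcθ
    rw [← integral_add (integrable_mul_of_test a hθ hcθ) (integrable_mul_of_test b hθ hcθ)]
    refine integral_congr_ae ?_
    filter_upwards [Lp.coeFn_add a b] with x hx
    rw [hx, Pi.add_apply, add_mul]
  rw [key _ _ _ (continuous_partial hφ) (hasCompactSupport_partial hc),
    key _ _ _ hφ.continuous hc, hu φ hφ hc hs, hv φ hφ hc hs]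
  ring

lemma HasWeakPartial.smul (c : ℝ) {u g : L2 Ω} (hu : HasWeakPartial Ω i u g) :
    HasWeakPartial Ω i (c • u) (c • g) := by
  intro φ hφ hc hs
  have key : ∀ (a : L2 Ω) (θ : Euc N → ℝ),
      ∫ x in Ω, (c • a : L2 Ω) x * θ x = c * ∫ x in Ω, a x * θ x := by
    intro a θ
    rw [← integral_const_mul]
    refine integral_congr_ae ?_
    filter_upwards [Lp.coeFn_smul c a] with x hx
    rw [hx, Pi.smul_apply, smul_eq_mul, mul_assoc]
  rw [key, key, hu φ hφ hc hs, mul_neg]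

lemma HasWeakPartial.zero : HasWeakPartial Ω i 0 0 := by
  have h : ∀ θ : Euc N → ℝ, ∫ x in Ω, (0 : L2 Ω) x * θ x = 0 := by
    intro θ
    rw [integral_eq_zero_of_ae]
    filter_upwards [Lp.coeFn_zero ℝ 2 (vol Ω)] with x hx
    rw [hx]; simp
  intro φ _ _ _
  rw [h, h, neg_zero]

end weak

/-- `H¹(Ω)`: pairs of a function and its weak gradient, with the norm
`‖u‖² = ‖u‖²_{L²} + ∑ i, ‖∂_i u‖²_{L²}`. -/
noncomputable def H1 {N : ℕ} (Ω : Set (Euc N)) :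
    Submodule ℝ (WithLp 2 (L2 Ω × PiLp 2 (fun _ : Fin N => L2 Ω))) where
  carrier := {u | ∀ i, HasWeakPartial Ω i u.fst (u.snd i)}
  add_mem' hu hv i := (hu i).add (hv i)
  zero_mem' _ := HasWeakPartial.zero
  smul_mem' c _ hu i := (hu i).smul c

/-- The underlying `L²` function of an `H¹` function. -/
noncomputable def fnH1 {N : ℕ} {Ω : Set (Euc N)} (u : H1 Ω) : L2 Ω := u.1.fst

/-- The weak partial derivative `∂_i u` of an `H¹` function. -/
noncomputable def dH1 {N : ℕ} {Ω : Set (Euc N)} (u : H1 Ω) (i : Fin N) : L2 Ω := u.1.snd i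

/-- `H²(Ω)`: an `H¹` function together with weak partial derivatives `h (i, j) = ∂_j ∂_i u` of
its first-order derivatives, with the norm
`‖u‖² = ‖u‖²_{H¹} + ∑ i j, ‖∂_j ∂_i u‖²_{L²}`. -/
noncomputable def H2 {N : ℕ} (Ω : Set (Euc N)) :
    Submodule ℝ (WithLp 2 (H1 Ω × PiLp 2 (fun _ : Fin N × Fin N => L2 Ω))) where
  carrier := {u | ∀ i j, HasWeakPartial Ω j (dH1 u.fst i) (u.snd (i, j))}
  add_mem' hu hv i j := (hu i j).add (hv i j)
  zero_mem' _ _ := HasWeakPartial.zero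
  smul_mem' c _ hu i j := (hu i j).smul c

/-- An `H²` function as an `H¹` function. -/
noncomputable def toH1 {N : ℕ} {Ω : Set (Euc N)} (u : H2 Ω) : H1 Ω := u.1.fst

/-- The partial derivative `∂_i u` of an `H²` function, as an `H¹` function. -/
noncomputable def dH2 {N : ℕ} {Ω : Set (Euc N)} (u : H2 Ω) (i : Fin N) : H1 Ω :=
  ⟨WithLp.toLp 2 (dH1 u.1.fst i, WithLp.toLp 2 fun j => u.1.snd (i, j)), fun j => u.2 i j⟩

/-- The Laplacian `Δ u ∈ L²(Ω)` of an `H²` function. -/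
noncomputable def lapH2 {N : ℕ} {Ω : Set (Euc N)} (u : H2 Ω) : L2 Ω :=
  ∑ i, u.1.snd (i, i)

/-- `g ∈ L²(∂Ω; H^{N-1})` is the trace of `u ∈ H¹(Ω)`: the trace operator is the continuous
extension of `φ ↦ φ|_{∂Ω}` from functions smooth up to the boundary, so `g` is the
`L²(∂Ω)`-limit of the boundary values of smooth functions converging to `u` in `H¹(Ω)`. -/
def HasTrace {N : ℕ} {Ω : Set (Euc N)} (u : H1 Ω) (g : Euc N → ℝ) : Prop :=
  MemLp g 2 ((surfaceMeasure N).restrict (frontier Ω)) ∧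
  ∃ φ : ℕ → Euc N → ℝ, (∀ n, ContDiff ℝ ∞ (φ n)) ∧
    Tendsto (fun n => eLpNorm (fun x => φ n x - fnH1 u x) 2 (vol Ω)) atTop (𝓝 0) ∧
    (∀ i, Tendsto (fun n => eLpNorm
      (fun x => fderiv ℝ (φ n) x (stdVec i) - dH1 u i x) 2 (vol Ω)) atTop (𝓝 0)) ∧
    Tendsto (fun n => eLpNorm (fun x => φ n x - g x) 2
      ((surfaceMeasure N).restrict (frontier Ω))) atTop (𝓝 0)

section trace

variable {N : ℕ} {Ω : Set (Euc N)}

lemma tendsto_eLpNorm_add {α : Type*} [MeasurableSpace α] {μ : Measure α}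
    {a b c : ℕ → α → ℝ} (hma : ∀ n, AEStronglyMeasurable (a n) μ)
    (hmb : ∀ n, AEStronglyMeasurable (b n) μ)
    (ha : Tendsto (fun n => eLpNorm (a n) 2 μ) atTop (𝓝 0))
    (hb : Tendsto (fun n => eLpNorm (b n) 2 μ) atTop (𝓝 0))
    (hc : ∀ n, ∀ᵐ x ∂μ, c n x = a n x + b n x) :
    Tendsto (fun n => eLpNorm (c n) 2 μ) atTop (𝓝 0) := by
  have h := ha.add hb
  rw [add_zero] at h
  refine tendsto_of_tendsto_of_tendsto_of_le_of_le tendsto_const_nhds h (fun _ => zero_le) ?_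
  intro n
  have e : eLpNorm (c n) 2 μ = eLpNorm (a n + b n) 2 μ := eLpNorm_congr_ae (hc n)
  exact e.trans_le (eLpNorm_add_le (hma n) (hmb n) (by norm_num))

lemma tendsto_eLpNorm_smul {α : Type*} [MeasurableSpace α] {μ : Measure α}
    (r : ℝ) {a c : ℕ → α → ℝ}
    (ha : Tendsto (fun n => eLpNorm (a n) 2 μ) atTop (𝓝 0))
    (hc : ∀ n, ∀ᵐ x ∂μ, c n x = r * a n x) :
    Tendsto (fun n => eLpNorm (c n) 2 μ) atTop (𝓝 0) := by
  have h : Tendsto (fun n => ‖r‖ₑ * eLpNorm (a n) 2 μ) atTop (𝓝 (‖r‖ₑ * 0)) :=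
    ENNReal.Tendsto.const_mul ha (Or.inr (by simp))
  rw [mul_zero] at h
  refine h.congr fun n => ?_
  have e : eLpNorm (c n) 2 μ = eLpNorm (r • a n) 2 μ := eLpNorm_congr_ae (hc n)
  rw [e, eLpNorm_const_smul]

lemma fnH1_add (u v : H1 Ω) : fnH1 (u + v) = fnH1 u + fnH1 v := rfl

lemma dH1_add (u v : H1 Ω) (i : Fin N) : dH1 (u + v) i = dH1 u i + dH1 v i := rfl

lemma fnH1_smul (c : ℝ) (u : H1 Ω) : fnH1 (c • u) = c • fnH1 u := rfl

lemma dH1_smul (c : ℝ) (u : H1 Ω) (i : Fin N) : dH1 (c • u) i = c • dH1 u i := rfl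

lemma fnH1_zero : fnH1 (0 : H1 Ω) = 0 := rfl

lemma dH1_zero (i : Fin N) : dH1 (0 : H1 Ω) i = 0 := rfl

lemma HasTrace.add {u v : H1 Ω} {g h : Euc N → ℝ} (hu : HasTrace u g) (hv : HasTrace v h) :
    HasTrace (u + v) (g + h) := by
  obtain ⟨hg, φ, hφ, h1, h2, h3⟩ := hu
  obtain ⟨hh, θ, hθ, k1, k2, k3⟩ := hv
  refine ⟨hg.add hh, fun n => φ n + θ n, fun n => (hφ n).add (hθ n), ?_, fun i => ?_, ?_⟩
  · rw [fnH1_add]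
    refine tendsto_eLpNorm_add (a := fun n x => φ n x - fnH1 u x)
      (b := fun n x => θ n x - fnH1 v x)
      (fun n => (hφ n).continuous.aestronglyMeasurable.sub (Lp.aestronglyMeasurable _))
      (fun n => (hθ n).continuous.aestronglyMeasurable.sub (Lp.aestronglyMeasurable _))
      h1 k1 fun n => ?_
    filter_upwards [Lp.coeFn_add (fnH1 u) (fnH1 v)] with x hx
    rw [hx, Pi.add_apply, Pi.add_apply]
    ring
  · rw [dH1_add]
    refine tendsto_eLpNorm_add (a := fun n x => fderiv ℝ (φ n) x (stdVec i) - dH1 u i x)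
      (b := fun n x => fderiv ℝ (θ n) x (stdVec i) - dH1 v i x)
      (fun n => (continuous_partial (hφ n)).aestronglyMeasurable.sub (Lp.aestronglyMeasurable _))
      (fun n => (continuous_partial (hθ n)).aestronglyMeasurable.sub (Lp.aestronglyMeasurable _))
      (h2 i) (k2 i) fun n => ?_
    filter_upwards [Lp.coeFn_add (dH1 u i) (dH1 v i)] with x hx
    rw [hx, Pi.add_apply, fderiv_add ((hφ n).differentiable (by simp) x)
      ((hθ n).differentiable (by simp) x), add_apply]
    ring
  · refine tendsto_eLpNorm_add (a := fun n x => φ n x - g x) (b := fun n x => θ n x - h x)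
      (fun n => (hφ n).continuous.aestronglyMeasurable.sub hg.1)
      (fun n => (hθ n).continuous.aestronglyMeasurable.sub hh.1)
      h3 k3 fun n => Eventually.of_forall fun x => ?_
    simp only [Pi.add_apply]
    ring

lemma HasTrace.smul (c : ℝ) {u : H1 Ω} {g : Euc N → ℝ} (hu : HasTrace u g) :
    HasTrace (c • u) (c • g) := by
  obtain ⟨hg, φ, hφ, h1, h2, h3⟩ := hu
  refine ⟨hg.const_smul c, fun n x => c * φ n x, fun n => contDiff_const.mul (hφ n),
    ?_, fun i => ?_, ?_⟩
  · rw [fnH1_smul]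
    refine tendsto_eLpNorm_smul c h1 fun n => ?_
    filter_upwards [Lp.coeFn_smul c (fnH1 u)] with x hx
    rw [hx, Pi.smul_apply, smul_eq_mul, mul_sub]
  · rw [dH1_smul]
    refine tendsto_eLpNorm_smul c (h2 i) fun n => ?_
    filter_upwards [Lp.coeFn_smul c (dH1 u i)] with x hx
    rw [hx, Pi.smul_apply, smul_eq_mul,
      fderiv_const_mul ((hφ n).differentiable (by simp) x), mul_sub]
    rfl
  · refine tendsto_eLpNorm_smul c h3 fun n => Eventually.of_forall fun x => ?_
    rw [Pi.smul_apply, smul_eq_mul, mul_sub]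

lemma HasTrace.zero : HasTrace (0 : H1 Ω) (0 : Euc N → ℝ) := by
  have key : eLpNorm (fun x => (0 : ℝ) - (0 : L2 Ω) x) 2 (vol Ω) = 0 := by
    rw [eLpNorm_congr_ae (g := 0), eLpNorm_zero]
    filter_upwards [Lp.coeFn_zero ℝ 2 (vol Ω)] with x hx
    rw [hx]
    exact sub_zero (0 : ℝ)
  refine ⟨MemLp.zero, fun _ _ => 0, fun _ => contDiff_const, ?_, fun i => ?_, ?_⟩
  · rw [fnH1_zero]
    exact tendsto_const_nhds.congr fun n => key.symm
  · rw [dH1_zero]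
    refine tendsto_const_nhds.congr fun n => ?_
    rw [← key]
    congr 1
    ext x
    simp
  · simp

end trace

lemma dH2_add {N : ℕ} {Ω : Set (Euc N)} (u v : H2 Ω) (i : Fin N) :
    dH2 (u + v) i = dH2 u i + dH2 v i := Subtype.ext rfl

lemma dH2_smul {N : ℕ} {Ω : Set (Euc N)} (c : ℝ) (u : H2 Ω) (i : Fin N) :
    dH2 (c • u) i = c • dH2 u i := Subtype.ext rfl

lemma dH2_zero {N : ℕ} {Ω : Set (Euc N)} (i : Fin N) : dH2 (0 : H2 Ω) i = 0 := Subtype.ext rfl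

/-- `V = {u ∈ H¹(Ω) : Tr u = 0  H^{N-1}-a.e. on ΓD}`, with the `H¹` norm. -/
noncomputable def SpaceV {N : ℕ} (Ω ΓD : Set (Euc N)) : Submodule ℝ (H1 Ω) where
  carrier := {u | ∃ g, HasTrace u g ∧ ∀ᵐ x ∂(surfaceMeasure N).restrict ΓD, g x = 0}
  add_mem' := by
    rintro u v ⟨g, hg, hg0⟩ ⟨h, hh, hh0⟩
    refine ⟨g + h, hg.add hh, ?_⟩
    filter_upwards [hg0, hh0] with x h1 h2
    simp [h1, h2]
  zero_mem' := ⟨0, HasTrace.zero, by simp⟩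
  smul_mem' := by
    rintro c u ⟨g, hg, hg0⟩
    refine ⟨c • g, hg.smul c, ?_⟩
    filter_upwards [hg0] with x h1
    simp [h1]

/-- `X = {u ∈ H²(Ω) : ∂_ν u = ν · Tr (∇u) = 0  H^{N-1}-a.e. on ΓN}`, with the `H²` norm. -/
noncomputable def SpaceX {N : ℕ} (Ω ΓN : Set (Euc N)) : Submodule ℝ (H2 Ω) where
  carrier := {u | ∃ G : Fin N → Euc N → ℝ, (∀ i, HasTrace (dH2 u i) (G i)) ∧
    ∀ᵐ x ∂(surfaceMeasure N).restrict ΓN, ∀ ν, IsOuterNormal Ω x ν → ∑ i, ν i * G i x = 0}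
  add_mem' := by
    rintro u v ⟨G, hG, hG0⟩ ⟨K, hK, hK0⟩
    refine ⟨fun i => G i + K i, fun i => dH2_add u v i ▸ (hG i).add (hK i), ?_⟩
    filter_upwards [hG0, hK0] with x h1 h2 ν hν
    simp only [Pi.add_apply, mul_add, Finset.sum_add_distrib, h1 ν hν, h2 ν hν, add_zero]
  zero_mem' := ⟨fun _ => 0, fun i => dH2_zero (Ω := Ω) i ▸ HasTrace.zero, by simp⟩
  smul_mem' := by
    rintro c u ⟨G, hG, hG0⟩
    refine ⟨fun i => c • G i, fun i => dH2_smul c u i ▸ (hG i).smul c, ?_⟩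
    filter_upwards [hG0] with x h1 ν hν
    simp only [Pi.smul_apply, smul_eq_mul, mul_left_comm _ c, ← Finset.mul_sum, h1 ν hν, mul_zero]

/-- `X ∩ V`, with the `H²` norm. -/
noncomputable def SpaceXV {N : ℕ} (Ω ΓD ΓN : Set (Euc N)) : Submodule ℝ (H2 Ω) where
  carrier := {u | u ∈ SpaceX Ω ΓN ∧ toH1 u ∈ SpaceV Ω ΓD}
  add_mem' hu hv := ⟨add_mem hu.1 hv.1, (SpaceV Ω ΓD).add_mem hu.2 hv.2⟩
  zero_mem' := ⟨zero_mem _, (SpaceV Ω ΓD).zero_mem⟩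
  smul_mem' c _ hu := ⟨(SpaceX Ω ΓN).smul_mem c hu.1, (SpaceV Ω ΓD).smul_mem c hu.2⟩

/-- The underlying `L²` function of an element of `V`. -/
noncomputable def fnV {N : ℕ} {Ω ΓD : Set (Euc N)} (v : SpaceV Ω ΓD) : L2 Ω := fnH1 v.1

/-- The underlying `L²` function of an element of `X ∩ V`. -/
noncomputable def fnXV {N : ℕ} {Ω ΓD ΓN : Set (Euc N)} (u : SpaceXV Ω ΓD ΓN) : L2 Ω :=
  fnH1 (toH1 u.1)

/-- The Laplacian of an element of `X ∩ V`. -/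
noncomputable def lapXV {N : ℕ} {Ω ΓD ΓN : Set (Euc N)} (u : SpaceXV Ω ΓD ΓN) :
    L2 Ω := lapH2 u.1

/-- The dual space `V*`. -/
abbrev DualV {N : ℕ} (Ω ΓD : Set (Euc N)) : Type := StrongDual ℝ (SpaceV Ω ΓD)

/-- The operator `B : V → V*`, `⟨B u, v⟩ = ∫_Ω (∇u · ∇v + u v) dx`. -/
noncomputable def opB {N : ℕ} {Ω ΓD : Set (Euc N)} (u v : SpaceV Ω ΓD) : ℝ :=
  ∫ x in Ω, ((∑ i, dH1 u.1 i x * dH1 v.1 i x) + fnV u x * fnV v x)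

/-- Elliptic regularity `B⁻¹ w ∈ H²(Ω) ∩ V` for all `w ∈ L²(Ω) ⊆ V*`: the solution `u ∈ V` of
`B u = w` belongs to `H²(Ω)`. -/
def EllipticRegularity {N : ℕ} (Ω ΓD : Set (Euc N)) : Prop :=
  ∀ (w : L2 Ω) (u : SpaceV Ω ΓD), (∀ v : SpaceV Ω ΓD, opB u v = ∫ x in Ω, w x * fnV v x) →
    ∃ U : H2 Ω, toH1 U = u.1

/-! ### Functions of time -/

/-- Lebesgue measure on `(0, T)`. -/
noncomputable abbrev timeMeasure (T : ℝ) : Measure ℝ := (volume : Measure ℝ).restrict (Ioo 0 T)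

/-- `u ∈ W^{1,2}(0,T;E)` with weak derivative `∂_t u = u'`, where `u` is the representative that
is continuous on `[0,T]`. -/
structure IsW12 {E : Type*} [NormedAddCommGroup E] [NormedSpace ℝ E] (T : ℝ) (u u' : ℝ → E) :
    Prop where
  continuousOn : ContinuousOn u (Icc 0 T)
  memLp : MemLp u 2 (timeMeasure T)
  memLp_deriv : MemLp u' 2 (timeMeasure T)
  weak_deriv : ∀ φ : ℝ → ℝ, ContDiff ℝ ∞ φ → HasCompactSupport φ → tsupport φ ⊆ Ioo 0 T →
    ∫ t in Ioo 0 T, deriv φ t • u t = -∫ t in Ioo 0 T, φ t • u' t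

/-- `‖σ‖_{L^∞(Ω × (0,T))}`, possibly infinite. -/
noncomputable def spaceTimeSup {N : ℕ} {Ω : Set (Euc N)} {p : ℝ≥0∞} (T : ℝ)
    (σ : ℝ → Lp ℝ p (vol Ω)) : ℝ≥0∞ :=
  essSup (fun t => eLpNorm (σ t) ∞ (vol Ω)) (timeMeasure T)

/-- `z` is a strong solution on `[0,T]` of `∂I_{(-∞,0]}(∂_t z) - Δz + λz + σγ(z) ∋ f` with
`z = 0` on `ΓD`, `∂_ν z = 0` on `ΓN` and `z(0) = z₀`. The curve `Z` is `z` seen as an element of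
`L²(0,T;X ∩ V)`. -/
def IsStrongSolution {N : ℕ} {Ω : Set (Euc N)} (ΓD ΓN : Set (Euc N)) {p : ℝ≥0∞} (T lam : ℝ)
    (γ : ℝ → ℝ) (σ : ℝ → Lp ℝ p (vol Ω)) (f : ℝ → L2 Ω) (z₀ : L2 Ω) (z : ℝ → L2 Ω) : Prop :=
  ∃ (z' : ℝ → L2 Ω) (Z : ℝ → SpaceXV Ω ΓD ΓN),
    IsW12 T z z' ∧
    MemLp Z 2 (timeMeasure T) ∧ (∀ᵐ t ∂timeMeasure T, fnXV (Z t) = z t) ∧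
    (∀ᵐ t ∂timeMeasure T, ∀ᵐ x ∂vol Ω, z' t x ≤ 0 ∧
      -lapXV (Z t) x + lam * z t x + σ t x * γ (z t x) ≤ f t x) ∧
    (∀ᵐ t ∂timeMeasure T, ∀ᵐ x ∂vol Ω,
      z' t x * (-lapXV (Z t) x + lam * z t x + σ t x * γ (z t x) - f t x) = 0) ∧
    z 0 = z₀

/-- The energy `E(u,t) = ½‖∇u‖² + (λ/2)‖u‖² + ∫_Ω σ(t) γ̂(u) dx - ⟨f(t), u⟩_V`, where `F` is the
`V*`-valued curve `f`. -/
noncomputable def energy {N : ℕ} {Ω ΓD : Set (Euc N)} {p : ℝ≥0∞} (lam : ℝ) (γhat : ℝ → ℝ)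
    (σ : ℝ → Lp ℝ p (vol Ω)) (F : ℝ → DualV Ω ΓD) (u : SpaceV Ω ΓD) (t : ℝ) : ℝ :=
  1 / 2 * (∑ i, ‖dH1 u.1 i‖ ^ 2) + lam / 2 * ‖fnV u‖ ^ 2
    + (∫ x in Ω, σ t x * γhat (fnV u x)) - F t u

end UnidirectionalEvolution

open UnidirectionalEvolution

/-! Complementarity says that `∂ₜz` is orthogonal to the gradient of the energy at `z(t)`. In the
time derivative of `E(z(t),t)` only the explicit dependence on `σ(t)` and `f(t)` survives, and this
is the energy balance. For the equilibrium, the energy is semiconvex: the gradient term is convex,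
and `λ > L‖σ‖` outweighs the concavity that `γ̂` may have. A function at which the gradient of the
energy is nonpositive therefore minimises the energy among all functions below it (`energy_sub_ge`,
`energy_sub_ge_of_le`). The equation supplies this sign at almost every time `r`. A competitor `v ≤
z(t)` also lies below `z(r)` for `r < t`, since `z` decreases, so letting `r` tend to `t` gives
every time (`energy_le_of_le`). For stationary data the energy of `z(t)` equals that of `z₀`, and
the strict quadratic gain in the semiconvexity estimate forces `z(t) = z₀`.

The analytic difficulty is the chain rule, because `∂ₜz` takes values only in `L²(Ω)`. For the
quadratic part, convexity suffices: a lower bound of increments by a linear term, integrated over a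
time interval, already determines the derivative (`ae_sub_eq_integral_inner`). The exact remainder
in that bound then yields continuity with values in `V` (`exists_continuousOn_and_norm_sq_sub`). The
load is treated in `absolutelyContinuous_pairing`. The nonlinear term is treated in
`absolutelyContinuous_nonlinear`, where semiconvexity identifies the derivative by touching from
below. `energy_sub_eq_integral` adds the pieces.

Three facts about the domain are needed. Green's formula without boundary terms (`green`) comes from
a divergence theorem above Lipschitz graphs and a partition of unity. Completeness of `V`
(`isClosed_SpaceV`) comes from the trace inequality. The embedding of `V` into `L^{2p'}(Ω)`
(`exists_sobolev`) is proved by the Gagliardo–Nirenberg method; it makes the nonlinear energy finite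
and continuous on `V` (`exists_nemytskii`). -/

namespace UnidirectionalEvolution

/-! ### Sobolev functions of time as primitives of their weak derivatives -/

section W12

variable {E : Type*} [NormedAddCommGroup E] [NormedSpace ℝ E]

omit [NormedSpace ℝ E] in
lemma MemLp.intervalIntegrable_time {T : ℝ} (hT : 0 ≤ T) {g : ℝ → E} (h : MemLp g 2 (timeMeasure T)) :
    IntervalIntegrable g volume 0 T := by
  rw [intervalIntegrable_iff_integrableOn_Ioo_of_le hT]
  exact h.integrable (by norm_num)

omit [NormedSpace ℝ E] in
lemma IntervalIntegrable.mono_Icc {T : ℝ} {g : ℝ → E} (h : IntervalIntegrable g volume 0 T)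
    {s t : ℝ} (hs : s ∈ Icc 0 T) (ht : t ∈ Icc 0 T) : IntervalIntegrable g volume s t :=
  h.mono_set (by rw [uIcc_of_le (hs.1.trans hs.2)]; exact uIcc_subset_Icc hs ht)

lemma deriv_smoothTransition_eq_zero {x : ℝ} (hx : x < 0 ∨ 1 < x) :
    deriv Real.smoothTransition x = 0 := by
  rcases hx with hx | hx
  · have : Real.smoothTransition =ᶠ[𝓝 x] fun _ => 0 := by
      filter_upwards [Iio_mem_nhds hx] with y hy
      exact Real.smoothTransition.zero_of_nonpos (le_of_lt hy)
    rw [this.deriv_eq]; simp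
  · have : Real.smoothTransition =ᶠ[𝓝 x] fun _ => 1 := by
      filter_upwards [Ioi_mem_nhds hx] with y hy
      exact Real.smoothTransition.one_of_one_le (le_of_lt hy)
    rw [this.deriv_eq]; simp

lemma continuous_deriv_smoothTransition : Continuous (deriv Real.smoothTransition) :=
  (Real.smoothTransition.contDiff (n := 1)).continuous_deriv le_rfl

/-- Concentration of the derivative of a rescaled smooth step at its jump. -/
lemma tendsto_integral_step {T s : ℝ} (hs : s ∈ Ioo 0 T) [CompleteSpace E] {u : ℝ → E}
    (hu : ContinuousOn u (Icc 0 T)) :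
    Tendsto (fun n : ℕ => ∫ r in Ioo 0 T,
      (deriv (fun x => Real.smoothTransition (((n : ℝ) + 1) * (x - s))) r) • u r)
      atTop (𝓝 (u s)) := by
  have hT : 0 ≤ T := hs.1.le.trans hs.2.le
  obtain ⟨C, hC⟩ := isCompact_Icc.exists_bound_of_continuousOn hu
  have hev : ∀ᶠ n : ℕ in atTop, s + 1 / ((n : ℝ) + 1) < T := by
    have := tendsto_one_div_add_atTop_nhds_zero_nat (𝕜 := ℝ)
    have h2 := this.const_add s
    rw [add_zero] at h2
    exact h2.eventually_lt_const hs.2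
  -- The derivative vanishes off the interval from `s` to `s + 1/(n+1)`. Substituting `r = s +
  -- x/(n+1)` moves the integral to the fixed interval `[0,1]` and absorbs the factor `n + 1`.
  have key : ∀ᶠ n : ℕ in atTop, (∫ r in Ioo 0 T,
      (deriv (fun x => Real.smoothTransition (((n : ℝ) + 1) * (x - s))) r) • u r)
      = ∫ x in (0:ℝ)..1, deriv Real.smoothTransition x • u (s + x / ((n : ℝ) + 1)) := by
    filter_upwards [hev] with n hn
    have hn0 : (0 : ℝ) < (n : ℝ) + 1 := by positivity
    have hd : ∀ r, deriv (fun x => Real.smoothTransition (((n : ℝ) + 1) * (x - s))) r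
        = ((n : ℝ) + 1) * deriv Real.smoothTransition (((n : ℝ) + 1) * (r - s)) := by
      intro r
      have h1 : HasDerivAt Real.smoothTransition
          (deriv Real.smoothTransition (((n : ℝ) + 1) * (r - s))) (((n : ℝ) + 1) * (r - s)) :=
        ((Real.smoothTransition.contDiff (n := 1)).differentiable (by simp) _).hasDerivAt
      have h2 : HasDerivAt (fun x : ℝ => ((n : ℝ) + 1) * (x - s)) ((n : ℝ) + 1) r := by
        simpa using ((hasDerivAt_id r).sub_const s).const_mul ((n : ℝ) + 1)
      exact (h1.comp r h2).deriv.trans (mul_comm _ _)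
    have hsub : Ioc s (s + 1 / ((n : ℝ) + 1)) ⊆ Ioo 0 T := fun r hr =>
      ⟨hs.1.trans hr.1, hr.2.trans_lt hn⟩
    rw [setIntegral_eq_of_subset_of_ae_sdiff_eq_zero measurableSet_Ioo.nullMeasurableSet hsub]
    · rw [← intervalIntegral.integral_of_le (by linarith [one_div_pos.2 hn0])]
      have := intervalIntegral.integral_comp_add_div (a := 0) (b := 1)
        (fun r => deriv (fun x => Real.smoothTransition (((n : ℝ) + 1) * (x - s))) r • u r)
        hn0.ne' s
      rw [zero_div, add_zero] at this
      rw [← inv_smul_smul₀ hn0.ne' (∫ r in s..(s + 1 / ((n : ℝ) + 1)), _), ← this,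
        ← intervalIntegral.integral_smul]
      refine intervalIntegral.integral_congr fun x _ => ?_
      simp only [hd]
      rw [smul_smul]
      congr 1
      rw [show ((n : ℝ) + 1) * (s + x / ((n : ℝ) + 1) - s) = x by field_simp; ring]
      field_simp
    · have hne : ∀ᵐ r : ℝ, r ≠ s := by simp [ae_iff, measure_singleton]
      filter_upwards [hne] with r hrs hr
      rw [hd, deriv_smoothTransition_eq_zero, mul_zero, zero_smul]
      have : r < s ∨ s + 1 / ((n : ℝ) + 1) < r := by
        by_contra! h
        exact hr.2 ⟨lt_of_le_of_ne h.1 (Ne.symm hrs), h.2⟩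
      rcases this with h | h
      · left; exact mul_neg_of_pos_of_neg hn0 (by linarith)
      · right
        have : 1 / ((n : ℝ) + 1) < r - s := by linarith
        rw [div_lt_iff₀ hn0] at this
        linarith
  refine Tendsto.congr' (EventuallyEq.symm key) ?_
  have hint : ∫ x in (0:ℝ)..1, deriv Real.smoothTransition x • u s = u s := by
    rw [intervalIntegral.integral_smul_const, intervalIntegral.integral_deriv_eq_sub]
    · simp [Real.smoothTransition.zero, Real.smoothTransition.one]
    · exact fun x _ => (Real.smoothTransition.contDiff (n := 1)).differentiable (by simp) _
    · exact continuous_deriv_smoothTransition.intervalIntegrable _ _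
  conv => rhs; rw [← hint]
  have hmem : ∀ᶠ n : ℕ in atTop, ∀ x ∈ Ioc (0:ℝ) 1, s + x / ((n : ℝ) + 1) ∈ Icc 0 T := by
    filter_upwards [hev] with n hn x hx
    have hn0 : (0 : ℝ) < (n : ℝ) + 1 := by positivity
    refine ⟨by have := hs.1; have := hx.1; positivity, ?_⟩
    have : x / ((n : ℝ) + 1) ≤ 1 / ((n : ℝ) + 1) := by gcongr; exact hx.2
    linarith
  refine intervalIntegral.tendsto_integral_filter_of_dominated_convergence
    (fun x => ‖deriv Real.smoothTransition x‖ * C) ?_ ?_ ?_ ?_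
  · filter_upwards [hmem] with n hn
    rw [uIoc_of_le zero_le_one]
    refine ContinuousOn.aestronglyMeasurable ?_ measurableSet_Ioc
    refine continuous_deriv_smoothTransition.continuousOn.smul (hu.comp ?_ hn)
    fun_prop
  · filter_upwards [hmem] with n hn
    refine Eventually.of_forall fun x hx => ?_
    rw [uIoc_of_le zero_le_one] at hx
    rw [norm_smul]
    gcongr
    exact hC _ (hn x hx)
  · exact (continuous_deriv_smoothTransition.norm.mul continuous_const).intervalIntegrable _ _
  · refine Eventually.of_forall fun x hx => Tendsto.const_smul ?_ _
    have hc : ContinuousAt u s := hu.continuousAt (Icc_mem_nhds hs.1 hs.2)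
    refine hc.tendsto.comp ?_
    have := (tendsto_one_div_add_atTop_nhds_zero_nat (𝕜 := ℝ)).const_mul x
    have h2 := this.const_add s
    simpa [div_eq_mul_inv] using h2

lemma smoothTransition_tendsto {s r : ℝ} (_hr : r ≠ s) :
    Tendsto (fun n : ℕ => Real.smoothTransition (((n : ℝ) + 1) * (r - s))) atTop
      (𝓝 (if s < r then 1 else 0)) := by
  split_ifs with h
  · refine tendsto_const_nhds.congr' ?_
    have h1 : Tendsto (fun n : ℕ => ((n : ℝ) + 1) * (r - s)) atTop atTop :=
      (tendsto_atTop_add_const_right _ _ tendsto_natCast_atTop_atTop).atTop_mul_const (by linarith)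
    filter_upwards [h1.eventually_ge_atTop 1] with n hn
    exact (Real.smoothTransition.one_of_one_le hn).symm
  · refine tendsto_const_nhds.congr fun n => (Real.smoothTransition.zero_of_nonpos ?_).symm
    exact mul_nonpos_of_nonneg_of_nonpos (by positivity) (by linarith [not_lt.1 h])

/-- The weak derivative is tested with a difference of two steepening smooth steps. The test
functions tend to the indicator of `(s,t]`, while their derivatives concentrate at `s` and `t`. Both
points must be interior for the supports to be compact in `(0,T)`. -/
lemma IsW12.integral_eq_sub_of_mem_Ioo [CompleteSpace E] {T : ℝ} {u u' : ℝ → E} (h : IsW12 T u u')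
    {s t : ℝ} (hs : s ∈ Ioo 0 T) (ht : t ∈ Ioo 0 T) (hst : s < t) :
    ∫ r in s..t, u' r = u t - u s := by
  set S := Real.smoothTransition with hS
  let φ : ℕ → ℝ → ℝ := fun n x => S (((n : ℝ) + 1) * (x - s)) - S (((n : ℝ) + 1) * (x - t))
  have hsm : ∀ (n : ℕ) (a : ℝ), ContDiff ℝ ∞ fun x => S (((n : ℝ) + 1) * (x - a)) := fun n a =>
    Real.smoothTransition.contDiff.comp (by fun_prop)
  have hφ : ∀ n, ContDiff ℝ ∞ (φ n) := fun n => (hsm n s).sub (hsm n t)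
  -- The second step reaches `1` only at `t + 1/(n+1)`, so the support overshoots `t` and lies in
  -- `(0,T)` only for large `n`.
  have hsupp : ∀ n, tsupport (φ n) ⊆ Icc s (t + 1 / ((n : ℝ) + 1)) := by
    intro n
    refine closure_minimal (fun x hx => ?_) isClosed_Icc
    have hn0 : (0 : ℝ) < (n : ℝ) + 1 := by positivity
    by_contra hcon
    apply hx
    simp only [mem_Icc, not_and_or, not_le] at hcon
    simp only [φ]
    rcases hcon with hc | hc
    · rw [hS, Real.smoothTransition.zero_of_nonpos, Real.smoothTransition.zero_of_nonpos, sub_zero]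
      · exact mul_nonpos_of_nonneg_of_nonpos hn0.le (by linarith)
      · exact mul_nonpos_of_nonneg_of_nonpos hn0.le (by linarith)
    · have : 1 / ((n : ℝ) + 1) < x - t := by linarith
      rw [div_lt_iff₀ hn0] at this
      rw [hS, Real.smoothTransition.one_of_one_le, Real.smoothTransition.one_of_one_le, sub_self]
      · linarith
      · nlinarith
  have hev : ∀ᶠ n : ℕ in atTop, t + 1 / ((n : ℝ) + 1) < T := by
    have h2 := (tendsto_one_div_add_atTop_nhds_zero_nat (𝕜 := ℝ)).const_add t
    rw [add_zero] at h2
    exact h2.eventually_lt_const ht.2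
  have heq : ∀ᶠ n : ℕ in atTop, (∫ r in Ioo 0 T, deriv (fun x => S (((n : ℝ) + 1) * (x - s))) r • u r)
      - (∫ r in Ioo 0 T, deriv (fun x => S (((n : ℝ) + 1) * (x - t))) r • u r)
      = -∫ r in Ioo 0 T, φ n r • u' r := by
    filter_upwards [hev] with n hn
    have hsub : Icc s (t + 1 / ((n : ℝ) + 1)) ⊆ Ioo 0 T := fun x hx =>
      ⟨hs.1.trans_le hx.1, hx.2.trans_lt hn⟩
    have := h.weak_deriv (φ n) (hφ n) (HasCompactSupport.intro' isCompact_Icc isClosed_Icc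
      fun x hx => image_eq_zero_of_notMem_tsupport fun h' => hx (hsupp n h'))
      ((hsupp n).trans hsub)
    rw [← this, ← integral_sub]
    · refine integral_congr_ae (Eventually.of_forall fun r => ?_)
      simp only [φ]
      rw [← sub_smul, deriv_fun_sub ((hsm n s).differentiable (by simp) r)
        ((hsm n t).differentiable (by simp) r)]
    all_goals
      refine (IntegrableOn.mono_set ?_ Ioo_subset_Icc_self)
      refine ContinuousOn.integrableOn_compact isCompact_Icc
        (ContinuousOn.smul (Continuous.continuousOn ?_) h.continuousOn)
      exact (hsm n _).continuous_deriv (by simp)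
  have hlim1 := (tendsto_integral_step hs h.continuousOn).sub
    (tendsto_integral_step ht h.continuousOn)
  have hint : Integrable u' (timeMeasure T) := h.memLp_deriv.integrable (by norm_num)
  have hlim2 : Tendsto (fun n => ∫ r in Ioo 0 T, φ n r • u' r) atTop
      (𝓝 (∫ r in Ioo 0 T, (Ioc s t).indicator u' r)) := by
    refine tendsto_integral_of_dominated_convergence (fun r => ‖u' r‖)
      (fun n => (hφ n).continuous.aestronglyMeasurable.smul hint.1) hint.norm (fun n => ?_) ?_
    · refine Eventually.of_forall fun r => ?_
      rw [norm_smul]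
      refine mul_le_of_le_one_left (norm_nonneg _) ?_
      rw [Real.norm_eq_abs, abs_le]
      simp only [φ]
      have := Real.smoothTransition.nonneg (((n : ℝ) + 1) * (r - s))
      have := Real.smoothTransition.nonneg (((n : ℝ) + 1) * (r - t))
      have := Real.smoothTransition.le_one (((n : ℝ) + 1) * (r - s))
      have := Real.smoothTransition.le_one (((n : ℝ) + 1) * (r - t))
      constructor <;> linarith
    · have h1 : ∀ᵐ r : ℝ, r ≠ s := by simp [ae_iff, measure_singleton]
      have h2 : ∀ᵐ r : ℝ, r ≠ t := by simp [ae_iff, measure_singleton]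
      filter_upwards [ae_restrict_of_ae h1, ae_restrict_of_ae h2] with r hrs hrt
      have := ((smoothTransition_tendsto hrs).sub (smoothTransition_tendsto hrt)).smul_const (u' r)
      convert! this using 2
      by_cases h3 : s < r
      · by_cases h4 : t < r
        · simp [indicator, h3, h4]
        · simp [indicator, h3, h4, not_lt.1 h4]
      · have h4 : ¬ t < r := fun h => h3 (hst.trans h)
        simp [indicator, h3, h4]
  have := tendsto_nhds_unique (hlim1.congr' heq) hlim2.neg
  have hsub : Ioc s t ⊆ Ioo 0 T := fun x hx => ⟨hs.1.trans hx.1, hx.2.trans_lt ht.2⟩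
  rw [setIntegral_indicator measurableSet_Ioc, inter_eq_self_of_subset_right hsub] at this
  rw [intervalIntegral.integral_of_le hst.le, ← neg_inj, ← this, neg_sub]

/-- A `W^{1,2}` function is the primitive of its weak derivative. -/
lemma IsW12.integral_eq_sub [CompleteSpace E] {T : ℝ} (hT : 0 < T) {u u' : ℝ → E} (h : IsW12 T u u')
    {s t : ℝ} (hs : s ∈ Icc 0 T) (ht : t ∈ Icc 0 T) :
    ∫ r in s..t, u' r = u t - u s := by
  have hi := MemLp.intervalIntegrable_time hT.le h.memLp_deriv
  -- This difference is constant on the open interval by the previous lemma, and by continuity on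
  -- the closed one.
  let g : ℝ → E := fun x => u x - ∫ r in (0:ℝ)..x, u' r
  have hg : ContinuousOn g (Icc 0 T) := by
    refine h.continuousOn.sub ?_
    have := intervalIntegral.continuousOn_primitive_interval' hi (a := 0) (by simp)
    rwa [uIcc_of_le hT.le] at this
  have hmid : T / 2 ∈ Ioo 0 T := ⟨by linarith, by linarith⟩
  have hconst : ∀ x ∈ Ioo 0 T, g x = g (T / 2) := by
    have aux : ∀ x ∈ Ioo 0 T, ∀ y ∈ Ioo 0 T, x < y → g x = g y := by
      intro x hx y hy hxy
      have h1 := h.integral_eq_sub_of_mem_Ioo hx hy hxy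
      have hx' := Ioo_subset_Icc_self hx
      have hy' := Ioo_subset_Icc_self hy
      have h0 : (0:ℝ) ∈ Icc 0 T := ⟨le_rfl, hT.le⟩
      have h2 := intervalIntegral.integral_add_adjacent_intervals
        (IntervalIntegrable.mono_Icc hi h0 hx') (IntervalIntegrable.mono_Icc hi hx' hy')
      simp only [g]
      rw [← h2, h1]; abel
    intro x hx
    rcases lt_trichotomy x (T / 2) with hlt | heq | hgt
    · exact aux _ hx _ hmid hlt
    · rw [heq]
    · exact (aux _ hmid _ hx hgt).symm
  have hall : ∀ x ∈ Icc 0 T, g x = g (T / 2) := by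
    have : EqOn g (fun _ => g (T / 2)) (closure (Ioo 0 T)) := by
      refine EqOn.of_subset_closure (s := Ioo 0 T) (fun x hx => hconst x hx) ?_ continuousOn_const
        subset_closure subset_rfl
      rwa [closure_Ioo hT.ne]
    rwa [closure_Ioo hT.ne] at this
  have h0 : (0:ℝ) ∈ Icc 0 T := ⟨le_rfl, hT.le⟩
  have h2 := intervalIntegral.integral_add_adjacent_intervals
        (IntervalIntegrable.mono_Icc hi h0 hs) (IntervalIntegrable.mono_Icc hi hs ht)
  have h3 : g s = g t := (hall s hs).trans (hall t ht).symm
  simp only [g] at h3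
  rw [← h2] at h3
  have := sub_eq_zero.2 h3
  rw [← sub_eq_zero]
  rw [← this]; abel

lemma IsW12.ae_hasDerivAt [CompleteSpace E] {T : ℝ} (hT : 0 < T) {u u' : ℝ → E}
    (h : IsW12 T u u') : ∀ᵐ t ∂timeMeasure T, HasDerivAt u (u' t) t := by
  have hi := MemLp.intervalIntegrable_time hT.le h.memLp_deriv
  rw [ae_restrict_iff' measurableSet_Ioo]
  filter_upwards [hi.ae_hasDerivAt_integral] with t ht htm
  have h1 := ht (by rw [uIcc_of_le hT.le]; exact Ioo_subset_Icc_self htm) 0 (by simp)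
  refine (h1.const_add (u 0)).congr_of_eventuallyEq ?_
  filter_upwards [Ioo_mem_nhds htm.1 htm.2] with x hx
  rw [h.integral_eq_sub hT ⟨le_rfl, hT.le⟩ (Ioo_subset_Icc_self hx)]
  abel

lemma IsW12.norm_sub_le [CompleteSpace E] {T : ℝ} (hT : 0 < T) {u u' : ℝ → E} (h : IsW12 T u u')
    {s t : ℝ} (hs : s ∈ Icc 0 T) (ht : t ∈ Icc 0 T) (hst : s ≤ t) :
    ‖u t - u s‖ ≤ ∫ r in s..t, ‖u' r‖ := by
  rw [← h.integral_eq_sub hT hs ht]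
  exact intervalIntegral.norm_integral_le_integral_norm hst

/-- The increments of `e` are dominated by those of the primitive of `m`, which is absolutely
continuous. -/
lemma absolutelyContinuousOnInterval_of_le {T : ℝ} (hT : 0 ≤ T) {e m : ℝ → ℝ}
    (hm : IntervalIntegrable m volume 0 T)
    (h : ∀ s ∈ Icc 0 T, ∀ t ∈ Icc 0 T, s ≤ t → |e t - e s| ≤ ∫ r in s..t, m r) :
    AbsolutelyContinuousOnInterval e 0 T := by
  have hM := hm.absolutelyContinuousOnInterval_intervalIntegral (c := 0) (by simp)
  have hd : ∀ s ∈ Icc 0 T, ∀ t ∈ Icc 0 T, dist (e s) (e t) ≤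
      dist (∫ r in (0:ℝ)..s, m r) (∫ r in (0:ℝ)..t, m r) := by
    have aux : ∀ s ∈ Icc 0 T, ∀ t ∈ Icc 0 T, s ≤ t → dist (e s) (e t) ≤
      dist (∫ r in (0:ℝ)..s, m r) (∫ r in (0:ℝ)..t, m r) := by
      intro s hs t ht hst
      have h0 : (0:ℝ) ∈ Icc 0 T := ⟨le_rfl, hT⟩
      have h2 := intervalIntegral.integral_add_adjacent_intervals
        (IntervalIntegrable.mono_Icc hm h0 hs) (IntervalIntegrable.mono_Icc hm hs ht)
      rw [← h2, dist_self_add_right, dist_comm, Real.dist_eq]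
      exact (h s hs t ht hst).trans (le_abs_self _)
    intro s hs t ht
    rcases le_total s t with hst | hst
    · exact aux s hs t ht hst
    · rw [dist_comm, dist_comm (∫ r in (0:ℝ)..s, m r)]; exact aux t ht s hs hst
  refine squeeze_zero' (Eventually.of_forall fun _ => Finset.sum_nonneg fun _ _ => dist_nonneg) ?_ hM
  rw [eventually_inf_principal]
  refine Eventually.of_forall fun E hE => Finset.sum_le_sum fun i hi => ?_
  have := hE.1 i hi
  rw [uIcc_of_le hT] at this
  exact hd _ this.1 _ this.2

end W12

/-! ### Correlations of square integrable curves -/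

section translation

variable {H : Type*} [NormedAddCommGroup H] [InnerProductSpace ℝ H]

omit [InnerProductSpace ℝ H] in
lemma integrable_norm_sq_of_memLp {α : Type*} [MeasurableSpace α] {μ : Measure α} {w : α → H}
    (hw : MemLp w 2 μ) : Integrable (fun x => ‖w x‖ ^ 2) μ :=
  (memLp_two_iff_integrable_sq_norm hw.1).1 hw

lemma integrable_inner_of_memLp {α : Type*} [MeasurableSpace α] {μ : Measure α} {w g : α → H}
    (hw : MemLp w 2 μ) (hg : MemLp g 2 μ) : Integrable (fun x => (inner ℝ (w x) (g x) : ℝ)) μ := by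
  refine ((integrable_norm_sq_of_memLp hw).add (integrable_norm_sq_of_memLp hg)).mono'
    (hw.1.inner hg.1) (Eventually.of_forall fun x => ?_)
  refine (norm_inner_le_norm (𝕜 := ℝ) _ _).trans ?_
  simp only [Pi.add_apply]
  nlinarith [sq_nonneg (‖w x‖ - ‖g x‖), sq_nonneg (‖w x‖), sq_nonneg ‖g x‖]

omit [InnerProductSpace ℝ H] in
lemma MemLp.comp_add_left' {g : ℝ → H} (hg : MemLp g 2 volume) (k : ℝ) :
    MemLp (fun r => g (k + r)) 2 volume :=
  hg.comp_measurePreserving (measurePreserving_add_left volume k)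

/-- Correlations of square integrable functions are continuous in the shift. -/
lemma continuous_correlation {w g : ℝ → H} (hw : MemLp w 2 volume) (hg : MemLp g 2 volume) :
    Continuous fun k : ℝ => ∫ r, inner ℝ (w r) (g (k + r)) := by
  have : Fact ((2 : ℝ≥0∞) ≠ ⊤) := ⟨by simp⟩
  have hcont : Continuous fun k : ℝ =>
      (inner ℝ (hw.toLp w) (DomAddAct.mk k +ᵥ hg.toLp g) : ℝ) := by
    have h1 : Continuous fun k : ℝ => DomAddAct.mk k +ᵥ hg.toLp g :=
      (DomAddAct.continuous_mk).vadd continuous_const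
    exact continuous_const.inner h1
  refine hcont.congr fun k => ?_
  rw [L2.inner_def]
  refine integral_congr_ae ?_
  have h2 : (DomAddAct.mk k +ᵥ hg.toLp g : Lp H 2 volume) =
      (MemLp.comp_add_left' hg k).toLp _ := DomAddAct.mk_vadd_toLp k hg
  rw [h2]
  filter_upwards [hw.coeFn_toLp, (MemLp.comp_add_left' hg k).coeFn_toLp] with r h3 h4
  rw [h3, h4]

/-- This justifies exchanging the integrals over the shift and over time. The inner integral is
bounded uniformly in `k`, because translation preserves the `L²` norm. -/
lemma integrable_correlation_prod {w g : ℝ → H} (hw : MemLp w 2 volume) (hg : MemLp g 2 volume)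
    (a b : ℝ) : Integrable (Function.uncurry fun k r : ℝ => (inner ℝ (w r) (g (k + r)) : ℝ))
      ((volume.restrict (uIoc a b)).prod volume) := by
  have hm : AEStronglyMeasurable (Function.uncurry fun k r : ℝ => (inner ℝ (w r) (g (k + r)) : ℝ))
      ((volume.restrict (uIoc a b)).prod volume) := by
    refine AEStronglyMeasurable.inner (hw.1.comp_quasiMeasurePreserving
      Measure.quasiMeasurePreserving_snd) ?_
    have h1 : AEStronglyMeasurable (fun x : ℝ × ℝ => g (x.1 + x.2)) (volume.prod volume) :=
      hg.1.comp_quasiMeasurePreserving (Measure.quasiMeasurePreserving_snd.comp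
        (measurePreserving_prod_add volume volume).quasiMeasurePreserving)
    refine h1.mono_ac ?_
    rw [show (volume.restrict (uIoc a b)).prod (volume : Measure ℝ) =
      (volume.prod volume).restrict (uIoc a b ×ˢ univ) by
        rw [← Measure.prod_restrict, Measure.restrict_univ]]
    exact Measure.restrict_le_self.absolutelyContinuous
  rw [integrable_prod_iff hm]
  constructor
  · exact Eventually.of_forall fun k => integrable_inner_of_memLp hw (MemLp.comp_add_left' hg k)
  · have : IsFiniteMeasure ((volume : Measure ℝ).restrict (uIoc a b)) := ⟨by simp [uIoc]⟩
    refine Integrable.of_bound (C := (∫ r, ‖w r‖ ^ 2) + ∫ r, ‖g r‖ ^ 2)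
      hm.norm.integral_prod_right' ?_
    refine Eventually.of_forall fun k => ?_
    have hgk := MemLp.comp_add_left' hg k
    rw [Real.norm_of_nonneg (integral_nonneg fun _ => norm_nonneg _),
      ← integral_add_left_eq_self (fun r => ‖g r‖ ^ 2) k,
      ← integral_add (integrable_norm_sq_of_memLp hw) (integrable_norm_sq_of_memLp hgk)]
    refine integral_mono (integrable_inner_of_memLp hw hgk).norm
      ((integrable_norm_sq_of_memLp hw).add (integrable_norm_sq_of_memLp hgk)) fun r => ?_
    refine (norm_inner_le_norm (𝕜 := ℝ) _ _).trans ?_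
    nlinarith [sq_nonneg (‖w r‖ - ‖g (k + r)‖), sq_nonneg (‖w r‖), sq_nonneg ‖g (k + r)‖]

end translation

/-! ### Chain rule and continuity for the quadratic energy -/

section chain

variable {H : Type*} [NormedAddCommGroup H] [InnerProductSpace ℝ H] [CompleteSpace H]

/-- If increments of `e` are bounded below by `⟪w s, z t - z s⟫`, then `e' = ⟪w, z'⟫`. -/
lemma ae_sub_eq_integral_inner {T : ℝ} (hT : 0 < T) {w z z' : ℝ → H} {e : ℝ → ℝ}
    (hw : MemLp w 2 (timeMeasure T)) (hz : IsW12 T z z') (he : Integrable e (timeMeasure T))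
    {G : Set ℝ} (hG : ∀ᵐ t ∂timeMeasure T, t ∈ G)
    (hle : ∀ s ∈ G, ∀ t ∈ G, (inner ℝ (w s) (z t - z s) : ℝ) ≤ e t - e s) :
    ∃ G' : Set ℝ, (∀ᵐ t ∂timeMeasure T, t ∈ G') ∧ ∀ s ∈ G', ∀ t ∈ G',
      e t - e s = ∫ r in s..t, (inner ℝ (w r) (z' r) : ℝ) := by
  have hie : IntervalIntegrable e volume 0 T := by
    rw [intervalIntegrable_iff_integrableOn_Ioo_of_le hT.le]; exact he
  have hiz := MemLp.intervalIntegrable_time hT.le hz.memLp_deriv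
  let I : ℝ → ℝ := fun x => ∫ r in (0:ℝ)..x, e r
  have hI : ∀ᵐ t ∂timeMeasure T, HasDerivAt I (e t) t := by
    rw [ae_restrict_iff' measurableSet_Ioo]
    filter_upwards [hie.ae_hasDerivAt_integral] with t ht htm
    exact ht (by rw [uIcc_of_le hT.le]; exact Ioo_subset_Icc_self htm) 0 (by simp)
  -- The increment inequality between `r` and `r + h`, integrated over `r` in `(s,t)`, reads `Q h ≤
  -- R h` for small `h` of either sign, with equality at `h = 0`. Hence `Q` and `R` have the same
  -- derivative there: `e t - e s` for `R`, as `I` has derivative `e` at both endpoints, and the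
  -- correlation `c 0` for `Q`.
  have hmain : ∀ s ∈ Ioo 0 T, ∀ t ∈ Ioo 0 T, HasDerivAt I (e s) s → HasDerivAt I (e t) t →
      s ≤ t → e t - e s = ∫ r in s..t, (inner ℝ (w r) (z' r) : ℝ) := by
    intro s hs t ht hIs hIt hst
    have hsub : Ioc s t ⊆ Ioo 0 T := fun x hx => ⟨hs.1.trans hx.1, hx.2.trans_lt ht.2⟩
    let w₁ : ℝ → H := (Ioc s t).indicator w
    let g : ℝ → H := (Ioo 0 T).indicator z'
    have hw₁ : MemLp w₁ 2 volume := by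
      refine (memLp_indicator_iff_restrict measurableSet_Ioc).2 ?_
      exact hw.mono_measure (Measure.restrict_mono_set _ hsub)
    have hg : MemLp g 2 volume := (memLp_indicator_iff_restrict measurableSet_Ioo).2 hz.memLp_deriv
    let c : ℝ → ℝ := fun k => ∫ r, (inner ℝ (w₁ r) (g (k + r)) : ℝ)
    have hc : Continuous c := continuous_correlation hw₁ hg
    let Q : ℝ → ℝ := fun h => ∫ k in (0:ℝ)..h, c k
    let R : ℝ → ℝ := fun h => (I (t + h) - I (s + h)) - (I t - I s)
    have hQ : HasDerivAt Q (c 0) 0 := intervalIntegral.integral_hasDerivAt_right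
      (hc.intervalIntegrable _ _) (hc.stronglyMeasurableAtFilter _ _) hc.continuousAt
    have hR : HasDerivAt R (e t - e s) 0 := by
      have h1 : HasDerivAt (fun h => I (t + h)) (e t) 0 := by
        have : HasDerivAt I (e t) (t + 0) := by rwa [add_zero]
        exact this.comp_const_add t 0
      have h2 : HasDerivAt (fun h => I (s + h)) (e s) 0 := by
        have : HasDerivAt I (e s) (s + 0) := by rwa [add_zero]
        exact this.comp_const_add s 0
      exact (h1.sub h2).sub_const _
    have hmin : IsLocalMin (fun h => R h - Q h) 0 := by
      have hev : ∀ᶠ h : ℝ in 𝓝 0, s + h ∈ Ioo 0 T ∧ t + h ∈ Ioo 0 T := by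
        have h1 : Tendsto (fun h : ℝ => s + h) (𝓝 0) (𝓝 s) := by
          simpa using (tendsto_id (α := ℝ) (x := 𝓝 0)).const_add s
        have h2 : Tendsto (fun h : ℝ => t + h) (𝓝 0) (𝓝 t) := by
          simpa using (tendsto_id (α := ℝ) (x := 𝓝 0)).const_add t
        exact (h1.eventually (Ioo_mem_nhds hs.1 hs.2)).and (h2.eventually (Ioo_mem_nhds ht.1 ht.2))
      filter_upwards [hev] with h hh
      obtain ⟨hsh, hth⟩ := hh
      have h00 : R 0 - Q 0 = 0 := by simp [R, Q]
      rw [h00, sub_nonneg]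
      have h0m : (0:ℝ) ∈ Icc 0 T := ⟨le_rfl, hT.le⟩
      have hRe : R h = ∫ r in s..t, (e (r + h) - e r) := by
        have hsm := Ioo_subset_Icc_self hs
        have htm := Ioo_subset_Icc_self ht
        have hsm' := Ioo_subset_Icc_self hsh
        have htm' := Ioo_subset_Icc_self hth
        have i1 : IntervalIntegrable (fun r => e (r + h)) volume s t := by
          have := (IntervalIntegrable.mono_Icc hie hsm' htm').comp_add_right h
          simpa using this
        rw [intervalIntegral.integral_sub i1 (IntervalIntegrable.mono_Icc hie hsm htm),
          intervalIntegral.integral_comp_add_right]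
        simp only [R, I]
        rw [← intervalIntegral.integral_add_adjacent_intervals
          (IntervalIntegrable.mono_Icc hie h0m hsm') (IntervalIntegrable.mono_Icc hie hsm' htm'),
          ← intervalIntegral.integral_add_adjacent_intervals
          (IntervalIntegrable.mono_Icc hie h0m hsm) (IntervalIntegrable.mono_Icc hie hsm htm)]
        ring
      -- Here `z (r + h) - z r` is the integral of `z'` over the shift, and Fubini exchanges shift
      -- and time.
      have hQe : Q h = ∫ r in s..t, (inner ℝ (w r) (z (r + h) - z r) : ℝ) := by
        simp only [Q, c]
        rw [intervalIntegral_integral_swap (integrable_correlation_prod hw₁ hg 0 h),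
          intervalIntegral.integral_of_le hst, ← integral_indicator measurableSet_Ioc]
        refine integral_congr_ae (Eventually.of_forall fun r => ?_)
        by_cases hr : r ∈ Ioc s t
        · simp only [w₁, indicator_of_mem hr]
          have hr1 : r ∈ Ioo 0 T := hsub hr
          have hr2 : r + h ∈ Ioo 0 T := ⟨by linarith [hr.1, hsh.1], by linarith [hr.2, hth.2]⟩
          have hiz' := IntervalIntegrable.mono_Icc hiz (Ioo_subset_Icc_self hr1)
            (Ioo_subset_Icc_self hr2)
          have hgz : ∀ k ∈ uIcc r (r + h), g k = z' k := fun k hk =>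
            indicator_of_mem (Set.ordConnected_Ioo.uIcc_subset hr1 hr2 hk) _
          have hsw : (∫ k in (0:ℝ)..h, (inner ℝ (w r) (g (k + r)) : ℝ)) =
              ∫ k in r..(r + h), (inner ℝ (w r) (g k) : ℝ) := by
            rw [intervalIntegral.integral_comp_add_right (fun k => (inner ℝ (w r) (g k) : ℝ)),
              zero_add, add_comm h r]
          rw [hsw, intervalIntegral.integral_congr (g := fun k => (inner ℝ (w r) (z' k) : ℝ))
            (fun k hk => by simp only [hgz k hk]), ← hz.integral_eq_sub hT
            (Ioo_subset_Icc_self hr1) (Ioo_subset_Icc_self hr2)]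
          exact (innerSL ℝ (w r)).intervalIntegral_comp_comm hiz'
        · simp [w₁, indicator_of_notMem hr]
      rw [hRe, hQe]
      have hsm := Ioo_subset_Icc_self hs
      have htm := Ioo_subset_Icc_self ht
      have i1 : IntervalIntegrable (fun r => e (r + h)) volume s t := by
        have := (IntervalIntegrable.mono_Icc hie (Ioo_subset_Icc_self hsh)
          (Ioo_subset_Icc_self hth)).comp_add_right h
        simpa using this
      have i2 : IntervalIntegrable (fun r => (inner ℝ (w r) (z (r + h) - z r) : ℝ)) volume s t := by
        rw [intervalIntegrable_iff_integrableOn_Icc_of_le hst]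
        refine integrable_inner_of_memLp (hw.mono_measure (Measure.restrict_mono_set _ ?_)) ?_
        · exact fun x hx => ⟨hs.1.trans_le hx.1, hx.2.trans_lt ht.2⟩
        · have hcz : ContinuousOn (fun r => z (r + h) - z r) (Icc s t) := by
            refine (hz.continuousOn.comp (by fun_prop) fun x hx => ?_).sub
              (hz.continuousOn.mono (Icc_subset_Icc hs.1.le ht.2.le))
            exact ⟨by linarith [hx.1, hsh.1], by linarith [hx.2, hth.2]⟩
          obtain ⟨C, hC⟩ := isCompact_Icc.exists_bound_of_continuousOn hcz
          refine MemLp.of_bound (hcz.aestronglyMeasurable measurableSet_Icc) C ?_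
          exact (ae_restrict_mem measurableSet_Icc).mono hC
      refine intervalIntegral.integral_mono_ae_restrict hst i2
        (i1.sub (IntervalIntegrable.mono_Icc hie hsm htm)) ?_
      have hG1 : ∀ᵐ r, r ∈ Ioo 0 T → r ∈ G := (ae_restrict_iff' measurableSet_Ioo).1 hG
      have hG2 : ∀ᵐ r, r + h ∈ Ioo 0 T → r + h ∈ G :=
        (measurePreserving_add_right volume h).quasiMeasurePreserving.ae hG1
      filter_upwards [ae_restrict_of_ae hG1, ae_restrict_of_ae hG2,
        ae_restrict_mem measurableSet_Icc] with r h1 h2 hr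
      exact hle r (h1 ⟨hs.1.trans_le hr.1, hr.2.trans_lt ht.2⟩) (r + h)
        (h2 ⟨by linarith [hr.1, hsh.1], by linarith [hr.2, hth.2]⟩)
    have hder := hmin.hasDerivAt_eq_zero (hR.sub hQ)
    have hc0 : c 0 = ∫ r in s..t, (inner ℝ (w r) (z' r) : ℝ) := by
      simp only [c, zero_add]
      rw [intervalIntegral.integral_of_le hst, ← integral_indicator measurableSet_Ioc]
      refine integral_congr_ae (Eventually.of_forall fun r => ?_)
      by_cases hr : r ∈ Ioc s t
      · simp only [w₁, g, indicator_of_mem hr, indicator_of_mem (hsub hr)]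
      · simp [w₁, indicator_of_notMem hr]
    rw [← hc0]; linarith
  refine ⟨{t | t ∈ Ioo 0 T ∧ HasDerivAt I (e t) t}, ?_, ?_⟩
  · filter_upwards [hI, ae_restrict_mem measurableSet_Ioo] with t h1 h2 using ⟨h2, h1⟩
  · intro s hs t ht
    rcases le_total s t with hst | hst
    · exact hmain s hs.1 t ht.1 hs.2 ht.2 hst
    · have := hmain t ht.1 s hs.1 ht.2 hs.2 hst
      rw [intervalIntegral.integral_symm, ← this]; ring

variable {V : Type*} [NormedAddCommGroup V] [InnerProductSpace ℝ V] [CompleteSpace V]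

/-- A curve in `L²(0,T;V)` that is `W^{1,2}` in `H` and whose Riesz representative lies in
`L²(0,T;H)` is continuous with values in `V`, and its squared norm obeys the chain rule. -/
theorem exists_continuousOn_and_norm_sq_sub {T : ℝ} (hT : 0 < T) (ι : V →L[ℝ] H) {Z : ℝ → V}
    {w z z' : ℝ → H} (hZ : MemLp Z 2 (timeMeasure T)) (hw : MemLp w 2 (timeMeasure T))
    (hz : IsW12 T z z') (hιZ : ∀ᵐ t ∂timeMeasure T, ι (Z t) = z t)
    (hgreen : ∀ᵐ t ∂timeMeasure T, ∀ v, (inner ℝ (Z t) v : ℝ) = inner ℝ (w t) (ι v)) :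
    ∃ zV : ℝ → V, ContinuousOn zV (Icc 0 T) ∧ (∀ᵐ t ∂timeMeasure T, zV t = Z t) ∧
      (∀ t ∈ Icc 0 T, ι (zV t) = z t) ∧
      IntervalIntegrable (fun r => (inner ℝ (w r) (z' r) : ℝ)) volume 0 T ∧
      ∀ s ∈ Icc 0 T, ∀ t ∈ Icc 0 T, 1 / 2 * ‖zV t‖ ^ 2 - 1 / 2 * ‖zV s‖ ^ 2 =
        ∫ r in s..t, (inner ℝ (w r) (z' r) : ℝ) := by
  let e : ℝ → ℝ := fun t => 1 / 2 * ‖Z t‖ ^ 2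
  have he : Integrable e (timeMeasure T) := (integrable_norm_sq_of_memLp hZ).const_mul _
  let G : Set ℝ := {t | ι (Z t) = z t ∧ ∀ v, (inner ℝ (Z t) v : ℝ) = inner ℝ (w t) (ι v)}
  have hG : ∀ᵐ t ∂timeMeasure T, t ∈ G := hιZ.and hgreen
  -- The remainder serves twice: its sign gives the chain rule, and once the chain rule is known its
  -- size gives continuity in `V`.
  have hid : ∀ s ∈ G, ∀ t ∈ G, e t - e s =
      (inner ℝ (w s) (z t - z s) : ℝ) + 1 / 2 * ‖Z t - Z s‖ ^ 2 := by
    intro s hs t ht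
    have h1 := hs.2 (Z t - Z s)
    rw [map_sub, hs.1, ht.1, inner_sub_right, real_inner_self_eq_norm_sq] at h1
    rw [← h1, norm_sub_sq_real, real_inner_comm]
    simp only [e]; ring
  obtain ⟨G₁, hG₁, hch⟩ := ae_sub_eq_integral_inner hT hw hz he hG (fun s hs t ht => by
    rw [hid s hs t ht]; linarith [sq_nonneg ‖Z t - Z s‖])
  let A : Set ℝ := {t | t ∈ Ioo 0 T ∧ t ∈ G ∧ t ∈ G₁}
  have hA : ∀ᵐ t ∂timeMeasure T, t ∈ A := by
    filter_upwards [hG, hG₁, ae_restrict_mem measurableSet_Ioo] with t h1 h2 h3 using ⟨h3, h1, h2⟩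
  let m : ℝ → ℝ := fun r => ‖w r‖ ^ 2 + ‖z' r‖ ^ 2
  have hIw : Integrable (fun r => ‖w r‖ ^ 2) (timeMeasure T) := integrable_norm_sq_of_memLp hw
  have hIz : Integrable (fun r => ‖z' r‖ ^ 2) (timeMeasure T) :=
    integrable_norm_sq_of_memLp hz.memLp_deriv
  have hii : ∀ {F : ℝ → ℝ}, Integrable F (timeMeasure T) → IntervalIntegrable F volume 0 T :=
    fun h => (intervalIntegrable_iff_integrableOn_Ioo_of_le hT.le).2 h
  have him : IntervalIntegrable m volume 0 T := hii (hIw.add hIz)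
  have hiin : IntervalIntegrable (fun r => (inner ℝ (w r) (z' r) : ℝ)) volume 0 T :=
    hii (integrable_inner_of_memLp hw hz.memLp_deriv)
  have hbd : ∀ s ∈ A, ∀ t ∈ A, s ≤ t → |e t - e s| ≤ 1 / 2 * ∫ r in s..t, m r := by
    intro s hs t ht hst
    have hs' := Ioo_subset_Icc_self hs.1
    have ht' := Ioo_subset_Icc_self ht.1
    rw [hch s hs.2.2 t ht.2.2, ← intervalIntegral.integral_const_mul]
    refine (intervalIntegral.abs_integral_le_integral_abs hst).trans ?_
    refine intervalIntegral.integral_mono_on hst (IntervalIntegrable.mono_Icc hiin hs' ht').abs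
      ((IntervalIntegrable.mono_Icc him hs' ht').const_mul _) fun r _ => ?_
    refine (abs_real_inner_le_norm _ _).trans ?_
    simp only [m]
    nlinarith [sq_nonneg (‖w r‖ - ‖z' r‖)]
  -- Both endpoints are compared with an intermediate time `ρ` at which `‖w ρ‖²` does not exceed its
  -- mean, so that `‖w ρ‖ ∫ ‖z'‖` is controlled by `½ ∫ m`. Each comparison costs `2 ∫ m`, and
  -- squaring the triangle inequality gives the factor `8`.
  have hinc : ∀ s ∈ A, ∀ t ∈ A, s < t → ‖Z t - Z s‖ ^ 2 ≤ 8 * ∫ r in s..t, m r := by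
    intro s hs t ht hst
    have hs' := Ioo_subset_Icc_self hs.1
    have ht' := Ioo_subset_Icc_self ht.1
    have hsub : Ioo s t ⊆ Ioo 0 T := Ioo_subset_Ioo hs'.1 ht'.2
    obtain ⟨ρ, hρN, hρ⟩ := exists_notMem_null_le_average (μ := volume.restrict (Ioo s t))
      (f := fun r => ‖w r‖ ^ 2) (N := (A ∩ Ioo s t)ᶜ)
      (by rw [Ne, Measure.restrict_eq_zero, Real.volume_Ioo, ENNReal.ofReal_eq_zero]; linarith)
      (hIw.mono_measure (Measure.restrict_mono_set _ hsub)) (by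
        have h1 : ∀ᵐ r ∂volume.restrict (Ioo s t), r ∈ A :=
          ae_mono (Measure.restrict_mono_set _ hsub) hA
        exact (h1.and (ae_restrict_mem measurableSet_Ioo)))
    rw [notMem_compl_iff] at hρN
    obtain ⟨hρA, hρI⟩ := hρN
    have hρ' := Ioo_subset_Icc_self hρA.1
    have hw1 : (t - s) * ‖w ρ‖ ^ 2 ≤ ∫ r in s..t, ‖w r‖ ^ 2 := by
      rw [setAverage_eq, ← integral_Ioc_eq_integral_Ioo, ← intervalIntegral.integral_of_le hst.le,
        Real.volume_real_Ioo_of_le hst.le, smul_eq_mul, inv_mul_eq_div,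
        le_div_iff₀ (by linarith)] at hρ
      linarith
    have hsplit : ∫ r in s..t, m r = (∫ r in s..t, ‖w r‖ ^ 2) + ∫ r in s..t, ‖z' r‖ ^ 2 :=
      intervalIntegral.integral_add (IntervalIntegrable.mono_Icc (hii hIw) hs' ht')
        (IntervalIntegrable.mono_Icc (hii hIz) hs' ht')
    have hm0 : ∀ r, 0 ≤ m r := fun r => by positivity
    have hmono : ∀ a b, s ≤ a → a ≤ b → b ≤ t → ∫ r in a..b, m r ≤ ∫ r in s..t, m r := by
      intro a b h1 h2 h3
      exact intervalIntegral.integral_mono_interval h1 h2 h3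
        (Eventually.of_forall hm0) (IntervalIntegrable.mono_Icc him hs' ht')
    have hpt : ∀ a b, s ≤ a → a ≤ b → b ≤ t → ‖w ρ‖ * ‖z b - z a‖ ≤ 1 / 2 * ∫ r in s..t, m r := by
      intro a b h1 h2 h3
      have ha' : a ∈ Icc 0 T := ⟨hs'.1.trans h1, (h2.trans h3).trans ht'.2⟩
      have hb' : b ∈ Icc 0 T := ⟨hs'.1.trans (h1.trans h2), h3.trans ht'.2⟩
      have hz1 := hz.norm_sub_le hT ha' hb' h2
      have hzn : IntervalIntegrable (fun r => ‖z' r‖) volume 0 T :=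
        (MemLp.intervalIntegrable_time hT.le hz.memLp_deriv).norm
      have hz2 : ∫ r in a..b, ‖z' r‖ ≤ ∫ r in s..t, ‖z' r‖ :=
        intervalIntegral.integral_mono_interval h1 h2 h3
          (Eventually.of_forall fun r => norm_nonneg _) (IntervalIntegrable.mono_Icc hzn hs' ht')
      calc ‖w ρ‖ * ‖z b - z a‖ ≤ ‖w ρ‖ * ∫ r in s..t, ‖z' r‖ := by
            gcongr; exact hz1.trans hz2
        _ = ∫ r in s..t, ‖w ρ‖ * ‖z' r‖ := (intervalIntegral.integral_const_mul _ _).symm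
        _ ≤ ∫ r in s..t, (1 / 2 * ‖w ρ‖ ^ 2 + 1 / 2 * ‖z' r‖ ^ 2) := by
            refine intervalIntegral.integral_mono_on hst.le
              ((IntervalIntegrable.mono_Icc hzn hs' ht').const_mul _)
              (intervalIntegrable_const.add
                ((IntervalIntegrable.mono_Icc (hii hIz) hs' ht').const_mul _)) fun r _ => ?_
            nlinarith [sq_nonneg (‖w ρ‖ - ‖z' r‖)]
        _ = 1 / 2 * ((t - s) * ‖w ρ‖ ^ 2) + 1 / 2 * ∫ r in s..t, ‖z' r‖ ^ 2 := by
            rw [intervalIntegral.integral_add intervalIntegrable_const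
              ((IntervalIntegrable.mono_Icc (hii hIz) hs' ht').const_mul _),
              intervalIntegral.integral_const_mul (1 / 2) (fun r => ‖z' r‖ ^ 2),
              intervalIntegral.integral_const, smul_eq_mul]
            ring
        _ ≤ 1 / 2 * ∫ r in s..t, m r := by rw [hsplit]; linarith
    have h1 : ‖Z t - Z ρ‖ ^ 2 ≤ 2 * ∫ r in s..t, m r := by
      have := hid ρ hρA.2.1 t ht.2.1
      have h2 := (abs_le.1 (hbd ρ hρA t ht hρI.2.le)).2
      have h3 := hmono ρ t hρI.1.le hρI.2.le le_rfl
      have h4 := hpt ρ t hρI.1.le hρI.2.le le_rfl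
      have h5 := (abs_le.1 (abs_real_inner_le_norm (w ρ) (z t - z ρ))).1
      linarith
    have h1' : ‖Z s - Z ρ‖ ^ 2 ≤ 2 * ∫ r in s..t, m r := by
      have := hid ρ hρA.2.1 s hs.2.1
      have h2 := (abs_le.1 (hbd s hs ρ hρA hρI.1.le)).1
      have h3 := hmono s ρ le_rfl hρI.1.le hρI.2.le
      have h4 := hpt s ρ le_rfl hρI.1.le hρI.2.le
      have h5 := (abs_le.1 (abs_real_inner_le_norm (w ρ) (z s - z ρ))).1
      rw [norm_sub_rev] at h4
      linarith
    have h6 : ‖Z t - Z s‖ ≤ ‖Z t - Z ρ‖ + ‖Z s - Z ρ‖ := by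
      rw [← sub_sub_sub_cancel_right (Z t) (Z s) (Z ρ)]; exact norm_sub_le _ _
    nlinarith [norm_nonneg (Z t - Z s), sq_nonneg (‖Z t - Z ρ‖ - ‖Z s - Z ρ‖),
      norm_nonneg (Z t - Z ρ), norm_nonneg (Z s - Z ρ)]
  let M : ℝ → ℝ := fun x => ∫ r in (0:ℝ)..x, m r
  have hMc : ContinuousOn M (Icc 0 T) := by
    have := intervalIntegral.continuousOn_primitive_interval' him (a := 0) (by simp)
    rwa [uIcc_of_le hT.le] at this
  have h0m : (0:ℝ) ∈ Icc 0 T := ⟨le_rfl, hT.le⟩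
  have hincM : ∀ s ∈ A, ∀ t ∈ A, ‖Z t - Z s‖ ^ 2 ≤ 8 * |M t - M s| := by
    have aux : ∀ s ∈ A, ∀ t ∈ A, s < t → ‖Z t - Z s‖ ^ 2 ≤ 8 * |M t - M s| := by
      intro s hs t ht hst
      have h1 := intervalIntegral.integral_add_adjacent_intervals
        (IntervalIntegrable.mono_Icc him h0m (Ioo_subset_Icc_self hs.1))
        (IntervalIntegrable.mono_Icc him (Ioo_subset_Icc_self hs.1) (Ioo_subset_Icc_self ht.1))
      have h2 : M t - M s = ∫ r in s..t, m r := by simp only [M]; rw [← h1]; ring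
      rw [h2]
      refine (hinc s hs t ht hst).trans ?_
      gcongr; exact le_abs_self _
    intro s hs t ht
    rcases lt_trichotomy s t with h | h | h
    · exact aux s hs t ht h
    · rw [h]; simp
    · rw [norm_sub_rev, abs_sub_comm]; exact aux t ht s hs h
  have hcl : Icc 0 T ⊆ closure A := by
    have hd : Dense {x : ℝ | x ∈ Ioo 0 T → x ∈ A} :=
      Measure.dense_of_ae ((ae_restrict_iff' measurableSet_Ioo).1 hA)
    have h1 := hd.open_subset_closure_inter (isOpen_Ioo (a := 0) (b := T))
    have h2 : Ioo 0 T ∩ {x : ℝ | x ∈ Ioo 0 T → x ∈ A} ⊆ A := fun x hx => hx.2 hx.1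
    rw [← closure_Ioo hT.ne]
    exact closure_minimal (h1.trans (closure_mono h2)) isClosed_closure
  have hAI : A ⊆ Icc 0 T := fun x hx => Ioo_subset_Icc_self hx.1
  have hlim : ∀ x ∈ Icc 0 T, ∃ y, Tendsto Z (𝓝[A] x) (𝓝 y) := by
    intro x hx
    have : (𝓝[A] x).NeBot := mem_closure_iff_nhdsWithin_neBot.1 (hcl hx)
    refine CompleteSpace.complete (f := map Z (𝓝[A] x)) (Metric.cauchy_iff.2 ⟨inferInstance, ?_⟩)
    intro ε hε
    have hM := ((hMc x hx).mono hAI)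
    -- Two points whose `M`-values are within `ε²/16` of `M x` differ by less than `ε²/8` in `M`,
    -- and the factor `8` in `hincM` turns this into `ε²`.
    have hU := hM (Metric.ball_mem_nhds (M x) (show 0 < ε ^ 2 / 16 by positivity))
    refine ⟨Z '' (A ∩ {y | M y ∈ Metric.ball (M x) (ε ^ 2 / 16)}), image_mem_map
      (inter_mem self_mem_nhdsWithin hU), ?_⟩
    rintro _ ⟨a, ha, rfl⟩ _ ⟨b, hb, rfl⟩
    have h1 := hincM b hb.1 a ha.1
    have h2 : |M a - M b| < ε ^ 2 / 8 := by
      have ha' := ha.2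
      have hb' := hb.2
      simp only [Set.mem_ofPred_eq, Metric.mem_ball, Real.dist_eq] at ha' hb'
      have := abs_sub_le (M a) (M x) (M b)
      rw [abs_sub_comm (M x)] at this
      linarith
    rw [dist_eq_norm]
    exact lt_of_pow_lt_pow_left₀ 2 hε.le (by linarith)
  let zV : ℝ → V := extendFrom A Z
  have hzc : ContinuousOn zV (Icc 0 T) := continuousOn_extendFrom hcl hlim
  have hzA : ∀ t ∈ A, zV t = Z t := by
    intro t ht
    obtain ⟨y, hy⟩ := hlim t (hAI ht)
    have h1 : zV t = y := extendFrom_eq (hcl (hAI ht)) hy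
    have h2 : Tendsto Z (pure t) (𝓝 y) := hy.mono_left (pure_le_nhdsWithin ht)
    rw [h1]
    exact tendsto_nhds_unique h2 (tendsto_pure_nhds Z t)
  refine ⟨zV, hzc, hA.mono hzA, ?_, hiin, ?_⟩
  · refine EqOn.of_subset_closure (s := A) (fun x hx => ?_)
      (ι.continuous.comp_continuousOn hzc) hz.continuousOn hAI hcl
    rw [hzA x hx, hx.2.1.1]
  · have hNc : ContinuousOn (fun x => ∫ r in (0:ℝ)..x, (inner ℝ (w r) (z' r) : ℝ)) (Icc 0 T) := by
      have := intervalIntegral.continuousOn_primitive_interval' hiin (a := 0) (by simp)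
      rwa [uIcc_of_le hT.le] at this
    obtain ⟨s₀, hs₀⟩ : A.Nonempty := by
      have : (closure A).Nonempty := ⟨0, hcl h0m⟩
      exact closure_nonempty_iff.1 this
    have hconst : EqOn (fun x => 1 / 2 * ‖zV x‖ ^ 2 - ∫ r in (0:ℝ)..x, (inner ℝ (w r) (z' r) : ℝ))
        (fun _ => 1 / 2 * ‖zV s₀‖ ^ 2 - ∫ r in (0:ℝ)..s₀, (inner ℝ (w r) (z' r) : ℝ))
        (Icc 0 T) := by
      refine EqOn.of_subset_closure (s := A) (fun x hx => ?_)
        ((continuousOn_const.mul (hzc.norm.pow 2)).sub hNc) continuousOn_const hAI hcl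
      have h1 := hch s₀ hs₀.2.2 x hx.2.2
      have h2 := intervalIntegral.integral_add_adjacent_intervals
        (IntervalIntegrable.mono_Icc hiin h0m (hAI hs₀))
        (IntervalIntegrable.mono_Icc hiin (hAI hs₀) (hAI hx))
      simp only [hzA x hx, hzA s₀ hs₀, ← h2, ← h1, e]
      ring
    intro s hs t ht
    have h1 := (hconst hs).trans (hconst ht).symm
    have h2 := intervalIntegral.integral_add_adjacent_intervals
      (IntervalIntegrable.mono_Icc hiin h0m hs) (IntervalIntegrable.mono_Icc hiin hs ht)
    simp only at h1
    linarith

end chain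

/-! ### Calculus above a Lipschitz graph -/

section graph

variable {N : ℕ}

/-- The hyperplane orthogonal to `e`. -/
noncomputable abbrev Hyper (e : Euc N) : Submodule ℝ (Euc N) := (Submodule.span ℝ {e})ᗮ

/-- The `(N-1)`-dimensional Hausdorff measure on the hyperplane orthogonal to `e`. -/
noncomputable abbrev hyperMeasure (e : Euc N) : Measure (Hyper e) :=
  Measure.hausdorffMeasure (Module.finrank ℝ (Hyper e))

/-- The orthogonal projection to the hyperplane orthogonal to `e`. -/
noncomputable abbrev hyperProj (e : Euc N) : Euc N →L[ℝ] Hyper e :=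
  (Hyper e).orthogonalProjectionOnto

variable {e : Euc N}

lemma inner_hyper (w : Hyper e) : (inner ℝ e (w : Euc N) : ℝ) = 0 :=
  Submodule.mem_orthogonal_singleton_iff_inner_right.1 w.2

lemma coe_hyperProj (he : ‖e‖ = 1) (y : Euc N) :
    (hyperProj e y : Euc N) = y - (inner ℝ e y : ℝ) • e := by
  have := Submodule.starProjection_orthogonal_val (K := Submodule.span ℝ {e}) y
  rw [Submodule.starProjection_unit_singleton ℝ he] at this
  exact this

lemma finrank_hyper (he : ‖e‖ = 1) : (Module.finrank ℝ (Hyper e) : ℝ) = (N : ℝ) - 1 := by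
  have h := Submodule.finrank_add_finrank_orthogonal (Submodule.span ℝ {e})
  rw [finrank_span_singleton (by rintro rfl; simp at he), finrank_euclideanSpace_fin] at h
  have h' : (1 : ℝ) + (Module.finrank ℝ (Hyper e) : ℝ) = N := by exact_mod_cast h
  linarith

lemma hyperProj_graph (he : ‖e‖ = 1) (w : Hyper e) (s : ℝ) :
    hyperProj e ((w : Euc N) + s • e) = w := by
  apply Subtype.ext
  rw [coe_hyperProj he, inner_add_right, inner_hyper, inner_smul_right,
    real_inner_self_eq_norm_sq, he]
  simp

lemma inner_graph (he : ‖e‖ = 1) (w : Hyper e) (s : ℝ) :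
    (inner ℝ e ((w : Euc N) + s • e) : ℝ) = s := by
  rw [inner_add_right, inner_hyper, inner_smul_right, real_inner_self_eq_norm_sq, he]
  simp

lemma proj_add_inner (he : ‖e‖ = 1) (y : Euc N) :
    (hyperProj e y : Euc N) + (inner ℝ e y : ℝ) • e = y := by
  rw [coe_hyperProj he]; abel

/-- Orthogonal coordinates adapted to a unit vector. -/
noncomputable def hyperEquiv (he : ‖e‖ = 1) : (Hyper e × ℝ) ≃L[ℝ] Euc N :=
  LinearEquiv.toContinuousLinearEquiv
    { toFun := fun x => (x.1 : Euc N) + x.2 • e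
      invFun := fun y => (hyperProj e y, inner ℝ e y)
      map_add' := fun x y => by
        simp only [Prod.fst_add, Prod.snd_add, Submodule.coe_add, add_smul]; abel
      map_smul' := fun c x => by
        simp only [Prod.smul_fst, Prod.smul_snd, SetLike.val_smul, smul_add, smul_smul,
          smul_eq_mul, RingHom.id_apply]
      left_inv := fun x => Prod.ext (hyperProj_graph he _ _) (inner_graph he _ _)
      right_inv := fun y => proj_add_inner he y }

lemma hyperEquiv_apply (he : ‖e‖ = 1) (x : Hyper e × ℝ) :
    hyperEquiv he x = (x.1 : Euc N) + x.2 • e := rfl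

/-- Both sides are Haar measures, so uniqueness supplies the factor between the Hausdorff and
Lebesgue normalisations. Only its being nonzero matters. -/
lemma exists_map_hyperEquiv (he : ‖e‖ = 1) : ∃ c : NNReal, c ≠ 0 ∧
    ((hyperMeasure e).prod (volume : Measure ℝ)).map (hyperEquiv he) =
      c • (volume : Measure (Euc N)) := by
  have h := (hyperEquiv he).isAddHaarMeasure_map ((hyperMeasure e).prod (volume : Measure ℝ))
  refine ⟨_, ?_, Measure.isAddLeftInvariant_eq_smul _ _⟩
  intro h0
  have h1 := Measure.isAddLeftInvariant_eq_smul
    (((hyperMeasure e).prod (volume : Measure ℝ)).map (hyperEquiv he)) (volume : Measure (Euc N))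
  rw [h0, zero_smul] at h1
  exact NeZero.ne _ h1

/-- The constant relating Lebesgue measure to the product measure in adapted coordinates. -/
noncomputable def hyperConst (he : ‖e‖ = 1) : NNReal := (exists_map_hyperEquiv he).choose

lemma hyperConst_ne_zero (he : ‖e‖ = 1) : hyperConst he ≠ 0 :=
  (exists_map_hyperEquiv he).choose_spec.1

lemma map_hyperEquiv (he : ‖e‖ = 1) :
    ((hyperMeasure e).prod (volume : Measure ℝ)).map (hyperEquiv he) =
      hyperConst he • (volume : Measure (Euc N)) :=
  (exists_map_hyperEquiv he).choose_spec.2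

/-- The graph map of `ψ`. -/
noncomputable def graphMap (ψ : Hyper e → ℝ) (w : Hyper e) : Euc N := (w : Euc N) + ψ w • e

/-- Coordinates in which the graph of `ψ` is flat. -/
noncomputable def shear (he : ‖e‖ = 1) {ψ : Hyper e → ℝ} (hψ : Continuous ψ) :
    (Hyper e × ℝ) ≃ₜ Euc N where
  toFun x := (x.1 : Euc N) + (x.2 + ψ x.1) • e
  invFun y := (hyperProj e y, (inner ℝ e y : ℝ) - ψ (hyperProj e y))
  left_inv x := by
    simp only [hyperProj_graph he, inner_graph he, add_sub_cancel_right]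
  right_inv y := by
    simp only [sub_add_cancel]
    exact proj_add_inner he y
  continuous_toFun := by fun_prop
  continuous_invFun := by fun_prop

/-- This is Fubini in the orthogonal coordinates; translation invariance on each line parallel to
`e` absorbs the shift by `ψ w`. -/
lemma integral_shear (he : ‖e‖ = 1) {ψ : Hyper e → ℝ} (_hψ : Continuous ψ) {F : Euc N → ℝ}
    (hF : Integrable F) :
    (hyperConst he : ℝ) * ∫ y, F y =
      ∫ w, ∫ s, F ((w : Euc N) + (s + ψ w) • e) ∂(volume : Measure ℝ) ∂hyperMeasure e := by
  have hF' : Integrable F (hyperConst he • (volume : Measure (Euc N))) :=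
    hF.smul_measure_nnreal
  rw [← map_hyperEquiv he] at hF'
  have h1 : Integrable (fun x => F (hyperEquiv he x)) ((hyperMeasure e).prod (volume : Measure ℝ)) :=
    hF'.comp_measurable (hyperEquiv he).continuous.measurable
  have h2 : (hyperConst he : ℝ) * ∫ y, F y = ∫ y, F y ∂(hyperConst he • (volume : Measure (Euc N))) := by
    rw [integral_smul_nnreal_measure]; rfl
  rw [h2, ← map_hyperEquiv he, integral_map (hyperEquiv he).continuous.measurable.aemeasurable
    hF'.1, integral_prod _ h1]
  refine integral_congr_ae (Eventually.of_forall fun w => ?_)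
  simp only [hyperEquiv_apply]
  exact (integral_add_right_eq_self (fun s : ℝ => F ((w : Euc N) + s • e)) (ψ w)).symm

lemma hasCompactSupport_shear (he : ‖e‖ = 1) {ψ : Hyper e → ℝ} (hψ : Continuous ψ) {F : Euc N → ℝ}
    (hF : HasCompactSupport F) :
    HasCompactSupport (fun x : Hyper e × ℝ => F ((x.1 : Euc N) + (x.2 + ψ x.1) • e)) :=
  hF.comp_homeomorph (shear he hψ)

lemma hasCompactSupport_slice {X Y : Type*} [TopologicalSpace X] [TopologicalSpace Y] [T2Space X]
    [R1Space Y] {F : X × Y → ℝ} (hF : HasCompactSupport F) (y : Y) :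
    HasCompactSupport fun x => F (x, y) := by
  refine HasCompactSupport.intro (hF.image continuous_fst) fun x hx => ?_
  by_contra h
  exact hx ⟨(x, y), subset_tsupport _ h, rfl⟩

lemma hasCompactSupport_slice' {X Y : Type*} [TopologicalSpace X] [TopologicalSpace Y] [R1Space X]
    [T2Space Y] {F : X × Y → ℝ} (hF : HasCompactSupport F) (x : X) :
    HasCompactSupport fun y => F (x, y) := by
  refine HasCompactSupport.intro (hF.image continuous_snd) fun y hy => ?_
  by_contra h
  exact hy ⟨(x, y), subset_tsupport _ h, rfl⟩

lemma lipschitzWith_graphMap (he : ‖e‖ = 1) {ψ : Hyper e → ℝ} {K : NNReal} (hψ : LipschitzWith K ψ)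
    (s : ℝ) : LipschitzWith (1 + K) fun w : Hyper e => (w : Euc N) + (s + ψ w) • e := by
  refine LipschitzWith.add (LipschitzWith.subtype_val _) (LipschitzWith.of_dist_le_mul fun x y => ?_)
  rw [dist_eq_norm, ← sub_smul, norm_smul, he, mul_one, add_sub_add_left_eq_sub, ← dist_eq_norm]
  exact hψ.dist_le_mul x y

lemma contDiff_lipschitz {h : Euc N → ℝ} (hh : ContDiff ℝ 1 h) (hc : HasCompactSupport h) :
    ∃ C : NNReal, LipschitzWith C h :=
  ⟨_, (hh.lipschitzWith_of_hasCompactSupport hc (by simp)).choose_spec⟩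

/-- The conormal `∇(ψ∘P) - e` of the graph of `ψ`, as a functional. -/
noncomputable def conormal (ψ : Hyper e → ℝ) (x : Euc N) : Euc N →L[ℝ] ℝ :=
  (fderiv ℝ ψ (hyperProj e x)).comp (hyperProj e) - innerSL ℝ e

lemma conormal_apply (ψ : Hyper e → ℝ) (x v : Euc N) :
    conormal ψ x v = fderiv ℝ ψ (hyperProj e x) (hyperProj e v) - inner ℝ e v := rfl

set_option maxHeartbeats 1000000 in
/-- Divergence theorem in the region above a Lipschitz graph. -/
theorem integral_fderiv_epigraph (he : ‖e‖ = 1) {ψ : Hyper e → ℝ} {K : NNReal}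
    (hψ : LipschitzWith K ψ) {h : Euc N → ℝ} (hh : ContDiff ℝ 1 h) (hc : HasCompactSupport h)
    (v : Euc N) :
    (hyperConst he : ℝ) * ∫ y in {y | ψ (hyperProj e y) < inner ℝ e y}, fderiv ℝ h y v =
      ∫ w, h (graphMap ψ w) * conormal ψ (graphMap ψ w) v ∂hyperMeasure e := by
  have hψc := hψ.continuous
  have hDc : Continuous (fderiv ℝ h) := hh.continuous_fderiv (by simp)
  have hD : ∀ v, Continuous fun y => fderiv ℝ h y v := fun v => hDc.clm_apply continuous_const
  have hDs : ∀ v, HasCompactSupport fun y => fderiv ℝ h y v := fun v => hc.fderiv_apply (𝕜 := ℝ) v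
  have hmeas : MeasurableSet {y : Euc N | ψ (hyperProj e y) < inner ℝ e y} :=
    measurableSet_lt (by fun_prop) (by fun_prop)
  let Θ : Hyper e → ℝ → Euc N := fun w s => (w : Euc N) + (s + ψ w) • e
  have hΘc : Continuous fun x : Hyper e × ℝ => Θ x.1 x.2 := (shear he hψc).continuous
  have hGcont : Continuous (graphMap ψ) := by unfold graphMap; fun_prop
  have hΘ0 : ∀ w, Θ w 0 = graphMap ψ w := fun w => by simp [Θ, graphMap]
  have hshc : ∀ v, Continuous fun x : Hyper e × ℝ => fderiv ℝ h (Θ x.1 x.2) v :=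
    fun v => (hD v).comp hΘc
  have hshs : ∀ v, HasCompactSupport fun x : Hyper e × ℝ => fderiv ℝ h (Θ x.1 x.2) v :=
    fun v => hasCompactSupport_shear he hψc (hDs v)
  have hint : ∀ v, Integrable (fun x : Hyper e × ℝ => fderiv ℝ h (Θ x.1 x.2) v)
      ((hyperMeasure e).prod (volume.restrict (Ioi 0))) := fun v => by
    refine ((hshc v).integrable_of_hasCompactSupport (hshs v)
      (μ := (hyperMeasure e).prod volume)).mono_measure ?_
    exact Measure.prod_mono le_rfl Measure.restrict_le_self
  -- Fundamental theorem of calculus along the axis: compact support removes the contribution at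
  -- infinity.
  have hline : ∀ w, ∫ s in Ioi 0, fderiv ℝ h (Θ w s) e = -h (graphMap ψ w) := by
    intro w
    have hf : ContDiff ℝ 1 fun s => h (Θ w s) := hh.comp (by fun_prop)
    have hfs : HasCompactSupport fun s => h (Θ w s) :=
      hasCompactSupport_slice' (hasCompactSupport_shear he hψc hc) w
    rw [← hΘ0, ← hfs.integral_Ioi_deriv_eq hf 0]
    refine integral_congr_ae (Eventually.of_forall fun s => ?_)
    have h1 : HasDerivAt (Θ w) e s := by
      have := (((hasDerivAt_id s).add_const (ψ w)).smul_const e).const_add (w : Euc N)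
      rwa [one_smul] at this
    have h2 := ((hh.differentiable (by simp) (Θ w s)).hasFDerivAt).comp_hasDerivAt s h1
    exact h2.deriv.symm
  have hrad : ∀ᵐ w ∂hyperMeasure e, DifferentiableAt ℝ ψ w := hψ.ae_differentiableAt
  -- At fixed height `s` above the graph, `w ↦ h (Θ w s)` is Lipschitz with compact support, so its
  -- directional derivatives integrate to zero. Rademacher's theorem for `ψ` makes the chain rule
  -- valid almost everywhere.
  have htan : ∀ u : Hyper e, ∀ s : ℝ, ∫ w, (fderiv ℝ h (Θ w s) u
      + fderiv ℝ ψ w u * fderiv ℝ h (Θ w s) e) ∂hyperMeasure e = 0 := by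
    intro u s
    obtain ⟨C, hC⟩ := contDiff_lipschitz hh hc
    have hk : LipschitzWith (C * (1 + K)) fun w => h (Θ w s) :=
      hC.comp (lipschitzWith_graphMap he hψ s)
    have hks : HasCompactSupport fun w => h (Θ w s) :=
      hasCompactSupport_slice (hasCompactSupport_shear he hψc hc) s
    have h1 := (LipschitzWith.const (α := Hyper e) (1:ℝ)).integral_lineDeriv_mul_eq
      (μ := hyperMeasure e) hk hks (-u)
    simp only [lineDeriv, deriv_const, neg_neg, zero_mul, integral_zero, mul_one] at h1
    rw [h1]
    refine integral_congr_ae ?_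
    filter_upwards [hrad] with w hw
    have h2 : HasFDerivAt (fun w => Θ w s)
        ((Hyper e).subtypeL + (fderiv ℝ ψ w).smulRight e) w :=
      ((Hyper e).subtypeL.hasFDerivAt).add ((hw.hasFDerivAt.const_add s).smul_const e)
    have h3 := ((hh.differentiable (by simp) (Θ w s)).hasFDerivAt).comp w h2
    refine Eq.trans ?_ (h3.hasLineDerivAt u).lineDeriv.symm
    simp
  have hψb : ∀ w u, |fderiv ℝ ψ w u| ≤ K * ‖u‖ := fun w u => by
    rw [← Real.norm_eq_abs]
    exact (ContinuousLinearMap.le_opNorm _ _).trans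
      (by gcongr; exact norm_fderiv_le_of_lipschitz ℝ hψ)
  have hint2 : ∀ u : Hyper e, Integrable (fun x : Hyper e × ℝ =>
      fderiv ℝ ψ x.1 u * fderiv ℝ h (Θ x.1 x.2) e)
      ((hyperMeasure e).prod (volume.restrict (Ioi 0))) := fun u => by
    refine (hint e).bdd_mul (c := K * ‖u‖) ?_ (Eventually.of_forall fun x => hψb _ _)
    exact ((measurable_fderiv_apply_const ℝ ψ u).comp measurable_fst).aestronglyMeasurable
  have hGs : HasCompactSupport fun w => h (graphMap ψ w) := by
    have := hasCompactSupport_slice (hasCompactSupport_shear he hψc hc) 0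
    simpa [graphMap] using this
  -- Integrating `htan` over all heights trades the tangential derivative for `fderiv ℝ ψ w u` times
  -- the axial one, and `hline` evaluates the latter on the graph.
  have hG : ∀ u : Hyper e, ∫ w, (∫ s in Ioi 0, fderiv ℝ h (Θ w s) u) ∂hyperMeasure e =
      ∫ w, h (graphMap ψ w) * fderiv ℝ ψ w u ∂hyperMeasure e := by
    intro u
    have h1 : ∫ w, (∫ s in Ioi 0, (fderiv ℝ h (Θ w s) u
        + fderiv ℝ ψ w u * fderiv ℝ h (Θ w s) e)) ∂hyperMeasure e = 0 := by
      rw [integral_integral_swap ((hint u).add (hint2 u))]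
      simp only [htan, integral_zero]
    have h2 : ∫ w, (∫ s in Ioi 0, (fderiv ℝ h (Θ w s) u
        + fderiv ℝ ψ w u * fderiv ℝ h (Θ w s) e)) ∂hyperMeasure e =
        (∫ w, (∫ s in Ioi 0, fderiv ℝ h (Θ w s) u) ∂hyperMeasure e) +
        ∫ w, (∫ s in Ioi 0, fderiv ℝ ψ w u * fderiv ℝ h (Θ w s) e) ∂hyperMeasure e :=
      integral_integral_add (hint u) (hint2 u)
    have h3 : ∫ w, (∫ s in Ioi 0, fderiv ℝ ψ w u * fderiv ℝ h (Θ w s) e) ∂hyperMeasure e =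
        -∫ w, h (graphMap ψ w) * fderiv ℝ ψ w u ∂hyperMeasure e := by
      rw [← integral_neg]
      refine integral_congr_ae (Eventually.of_forall fun w => ?_)
      simp only [integral_const_mul, hline]; ring
    linarith
  have hL : (hyperConst he : ℝ) * ∫ y in {y | ψ (hyperProj e y) < inner ℝ e y}, fderiv ℝ h y v =
      ∫ w, (∫ s in Ioi 0, fderiv ℝ h (Θ w s) v) ∂hyperMeasure e := by
    rw [← integral_indicator hmeas, integral_shear he hψc
      (((hD v).integrable_of_hasCompactSupport (hDs v)).indicator hmeas)]
    refine integral_congr_ae (Eventually.of_forall fun w => ?_)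
    simp only
    rw [← integral_indicator measurableSet_Ioi]
    refine integral_congr_ae (Eventually.of_forall fun s => ?_)
    simp only [indicator, mem_Ioi, Set.mem_ofPred_eq, hyperProj_graph he, inner_graph he, Θ]
    simp
  have hdec : ∀ w s, fderiv ℝ h (Θ w s) v = fderiv ℝ h (Θ w s) (hyperProj e v : Euc N)
      + (inner ℝ e v : ℝ) * fderiv ℝ h (Θ w s) e := by
    intro w s
    conv_lhs => rw [← proj_add_inner he v, map_add, map_smul, smul_eq_mul]
  have hR : ∫ w, h (graphMap ψ w) * conormal ψ (graphMap ψ w) v ∂hyperMeasure e =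
      (∫ w, h (graphMap ψ w) * fderiv ℝ ψ w (hyperProj e v) ∂hyperMeasure e)
      - (inner ℝ e v : ℝ) * ∫ w, h (graphMap ψ w) ∂hyperMeasure e := by
    have i1 : Integrable (fun w => h (graphMap ψ w)) (hyperMeasure e) :=
      (hh.continuous.comp hGcont).integrable_of_hasCompactSupport hGs
    have i2 : Integrable (fun w => h (graphMap ψ w) * fderiv ℝ ψ w (hyperProj e v))
        (hyperMeasure e) :=
      i1.mul_bdd (c := K * ‖hyperProj e v‖)
        (measurable_fderiv_apply_const ℝ ψ _).aestronglyMeasurable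
        (Eventually.of_forall fun x => hψb _ _)
    rw [← integral_const_mul, ← integral_sub i2 (i1.const_mul _)]
    refine integral_congr_ae (Eventually.of_forall fun w => ?_)
    simp only [conormal_apply]
    rw [show hyperProj e (graphMap ψ w) = w from hyperProj_graph he w _]
    ring
  have h2 : ∫ w, (∫ s in Ioi 0, fderiv ℝ h (Θ w s) v) ∂hyperMeasure e =
        (∫ w, (∫ s in Ioi 0, fderiv ℝ h (Θ w s) (hyperProj e v : Euc N)) ∂hyperMeasure e) +
        ∫ w, (∫ s in Ioi 0, (inner ℝ e v : ℝ) * fderiv ℝ h (Θ w s) e) ∂hyperMeasure e := by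
    simp only [hdec]
    exact integral_integral_add (hint _) ((hint e).const_mul _)
  rw [hL, h2, hG, hR]
  simp only [integral_const_mul, hline, integral_neg]
  ring

end graph

/-! ### Charts of a Lipschitz boundary -/

section chart

variable {N : ℕ} {e : Euc N}

lemma range_graphMap (he : ‖e‖ = 1) (ψ : Hyper e → ℝ) :
    range (graphMap ψ) = {y | ψ (hyperProj e y) = inner ℝ e y} := by
  ext y
  constructor
  · rintro ⟨w, rfl⟩
    change ψ (hyperProj e (graphMap ψ w)) = inner ℝ e (graphMap ψ w)
    rw [graphMap, hyperProj_graph he, inner_graph he]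
  · intro hy
    change ψ (hyperProj e y) = inner ℝ e y at hy
    refine ⟨hyperProj e y, ?_⟩
    rw [graphMap, hy, proj_add_inner he]

lemma continuous_graphMap {ψ : Hyper e → ℝ} (hψ : Continuous ψ) : Continuous (graphMap ψ) := by
  unfold graphMap; fun_prop

/-- Lebesgue measure of the parameter domain is at most the surface measure of the graph. -/
lemma hyperMeasure_preimage_le (he : ‖e‖ = 1) (ψ : Hyper e → ℝ) (A : Set (Euc N)) :
    hyperMeasure e (graphMap ψ ⁻¹' A) ≤ surfaceMeasure N (A ∩ range (graphMap ψ)) := by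
  -- The projection is a 1-Lipschitz left inverse of the graph map.
  have hsub : graphMap ψ ⁻¹' A ⊆ hyperProj e '' (A ∩ range (graphMap ψ)) := fun w hw =>
    ⟨graphMap ψ w, ⟨hw, w, rfl⟩, hyperProj_graph he w _⟩
  refine (measure_mono hsub).trans ?_
  have := (Hyper e).lipschitzWith_orthogonalProjectionOnto.hausdorffMeasure_image_le
    (d := Module.finrank ℝ (Hyper e)) (by positivity) (A ∩ range (graphMap ψ))
  rw [ENNReal.coe_one, ENNReal.one_rpow, one_mul, finrank_hyper he] at this
  rw [hyperMeasure, finrank_hyper he]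
  exact this

/-- The surface measure of a Lipschitz graph is controlled by the parameter domain. -/
lemma surfaceMeasure_inter_range_le (he : ‖e‖ = 1) {ψ : Hyper e → ℝ} {K : NNReal}
    (hψ : LipschitzWith K ψ) (A : Set (Euc N)) :
    surfaceMeasure N (A ∩ range (graphMap ψ)) ≤
      ((1 + K : NNReal) : ℝ≥0∞) ^ (Module.finrank ℝ (Hyper e) : ℝ) *
        hyperMeasure e (graphMap ψ ⁻¹' A) := by
  have hsub : A ∩ range (graphMap ψ) = graphMap ψ '' (graphMap ψ ⁻¹' A) :=
    (image_preimage_eq_inter_range).symm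
  have hL : LipschitzWith (1 + K) (graphMap ψ) := by
    have h := lipschitzWith_graphMap he hψ 0
    simp only [zero_add] at h
    exact h
  rw [hsub, surfaceMeasure, ← finrank_hyper he]
  exact hL.hausdorffMeasure_image_le (by positivity) _

/-- A measure `μ` on part of the boundary of `Ω`, comparable to surface measure in the ball
`B(x₀, r)`, and a conormal field for which the divergence theorem holds. -/
structure BoundaryChart (Ω : Set (Euc N)) (x₀ : Euc N) (r : ℝ) (e : Euc N) (μ : Measure (Euc N))
    (n : Euc N → Euc N →L[ℝ] ℝ) (c : ℝ) (C : NNReal) : Prop where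
  norm_eq : ‖e‖ = 1
  finite : IsFiniteMeasure μ
  pos : 0 < c
  le_surface : μ ≤ (surfaceMeasure N).restrict (frontier Ω)
  surface_le : (surfaceMeasure N).restrict (frontier Ω ∩ Metric.ball x₀ r) ≤ C • μ
  measurable : ∀ v, Measurable fun x => n x v
  bound : ∀ x v, |n x v| ≤ C * ‖v‖
  apply_axis : ∀ x, n x e = -1
  divergence : ∀ h : Euc N → ℝ, ContDiff ℝ 1 h → HasCompactSupport h →
    tsupport h ⊆ Metric.ball x₀ r → ∀ v,
      c * ∫ y in Ω, fderiv ℝ h y v = ∫ x, h x * n x v ∂μ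
  normal : ∀ᵐ x ∂μ, ∃ (a : ℝ) (ν : Euc N), IsOuterNormal Ω x ν ∧ ∀ v, n x v = a * inner ℝ ν v

lemma conormal_axis (he : ‖e‖ = 1) (ψ : Hyper e → ℝ) (x : Euc N) : conormal ψ x e = -1 := by
  have h0 : hyperProj e e = 0 := by
    apply Subtype.ext
    rw [coe_hyperProj he, real_inner_self_eq_norm_sq, he]; simp
  rw [conormal_apply, h0, map_zero, real_inner_self_eq_norm_sq, he]; norm_num

/-- Near `x`, membership in `Ω` is the sign of `ψ ∘ hyperProj e - ⟪e, ·⟫`, whose derivative at `x`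
is the conormal. Outside thin cones about the kernel the linear part decides this sign, so the
normalised conormal is the outer normal. The error is taken relative to `ε ‖L‖` because of the
normalisation. -/
lemma isOuterNormal_of_differentiableAt (he : ‖e‖ = 1) {Ω : Set (Euc N)} {x₀ : Euc N} {r : ℝ}
    {ψ : Hyper e → ℝ}
    (hΩ : ∀ y ∈ Metric.ball x₀ r, y ∈ Ω ↔ ψ (hyperProj e y) < inner ℝ e y) {x : Euc N}
    (hx : x ∈ Metric.ball x₀ r) (hxg : ψ (hyperProj e x) = inner ℝ e x)
    (hd : DifferentiableAt ℝ ψ (hyperProj e x)) :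
    ∃ (a : ℝ) (ν : Euc N), IsOuterNormal Ω x ν ∧ ∀ v, conormal ψ x v = a * inner ℝ ν v := by
  set L := conormal ψ x with hL
  have hne : L ≠ 0 := fun h => by
    have := conormal_axis he ψ x
    rw [← hL, h] at this
    simp at this
  have hpos : 0 < ‖L‖ := norm_pos_iff.2 hne
  let g : Euc N := (InnerProductSpace.toDual ℝ (Euc N)).symm L
  have hg : ∀ v, (inner ℝ g v : ℝ) = L v := fun v => InnerProductSpace.toDual_symm_apply
  have hgn : ‖g‖ = ‖L‖ := LinearIsometryEquiv.norm_map _ _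
  refine ⟨‖L‖, ‖L‖⁻¹ • g, ⟨?_, ?_⟩, fun v => ?_⟩
  · rw [norm_smul, hgn, norm_inv, norm_norm, inv_mul_cancel₀ hpos.ne']
  · intro ε hε
    have hder : HasFDerivAt (fun y => ψ (hyperProj e y) - inner ℝ e y) L x := by
      exact (hd.hasFDerivAt.comp x (hyperProj e).hasFDerivAt).sub (innerSL ℝ e).hasFDerivAt
    have hlo := (hasFDerivAt_iff_isLittleO.1 hder).def (mul_pos hε hpos)
    obtain ⟨δ, hδ, hball⟩ := Metric.eventually_nhds_iff_ball.1
      (hlo.and (Metric.isOpen_ball.mem_nhds hx))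
    refine ⟨δ, hδ, fun y hy => ?_⟩
    obtain ⟨h1, h2⟩ := hball y hy
    rw [hxg, sub_self, sub_zero, Real.norm_eq_abs] at h1
    have h3 : (inner ℝ (y - x) (‖L‖⁻¹ • g) : ℝ) = ‖L‖⁻¹ * L (y - x) := by
      rw [inner_smul_right, real_inner_comm, hg]
    have h4 := abs_le.1 h1
    rw [h3]
    constructor
    · intro h
      rw [hΩ y h2]
      rw [inv_mul_lt_iff₀ hpos] at h
      nlinarith
    · intro h
      rw [hΩ y h2]
      rw [lt_inv_mul_iff₀ hpos] at h
      nlinarith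
  · rw [inner_smul_left, hg]; simp [hpos.ne']

/-- The measure is the image of the hyperplane measure under the graph map. Two-sided Lipschitz
bounds compare it with surface measure, and since only bounds and null sets matter below, no area
formula is required. -/
theorem exists_boundaryChart {Ω : Set (Euc N)} (ho : IsOpen Ω) (hlip : HasLipschitzBoundary Ω)
    {x₀ : Euc N} (hx₀ : x₀ ∈ frontier Ω) :
    ∃ r e μ n c C, 0 < r ∧ BoundaryChart Ω x₀ r e μ n c C := by
  obtain ⟨e, r, K, ψ₀, he, hr, hψ₀, hΩ₀⟩ := hlip x₀ hx₀
  let ψ : Hyper e → ℝ := fun w => ψ₀ w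
  have hψ : LipschitzWith K ψ := by
    have := hψ₀.comp (LipschitzWith.subtype_val (fun x => x ∈ Hyper e))
    rwa [mul_one] at this
  have hΩ : ∀ y ∈ Metric.ball x₀ r, y ∈ Ω ↔ ψ (hyperProj e y) < inner ℝ e y := by
    intro y hy
    rw [hΩ₀ y hy]
    simp only [ψ, coe_hyperProj he]
  have hψc := hψ.continuous
  have hGc := continuous_graphMap hψc
  let B := Metric.ball x₀ r
  have hBm : MeasurableSet B := Metric.isOpen_ball.measurableSet
  have hfr : frontier Ω ∩ B = B ∩ range (graphMap ψ) := by
    rw [range_graphMap he]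
    ext y
    constructor
    · rintro ⟨hy, hyB⟩
      refine ⟨hyB, le_antisymm ?_ ?_⟩
      · have hcl : y ∈ closure (Ω ∩ B) := by
          rw [inter_comm]
          exact Metric.isOpen_ball.inter_closure ⟨hyB, frontier_subset_closure hy⟩
        refine closure_minimal (fun z hz => ?_) (isClosed_le (f := fun z => ψ (hyperProj e z))
          (g := fun z => (inner ℝ e z : ℝ)) (by fun_prop) (by fun_prop)) hcl
        exact ((hΩ z hz.2).1 hz.1).le
      · have hn : y ∉ Ω := by rw [ho.frontier_eq] at hy; exact hy.2
        exact not_lt.1 fun h => hn ((hΩ y hyB).2 h)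
    · rintro ⟨hyB, hy⟩
      change ψ (hyperProj e y) = inner ℝ e y at hy
      refine ⟨?_, hyB⟩
      rw [ho.frontier_eq]
      refine ⟨?_, fun h => ((hΩ y hyB).1 h).ne hy⟩
      -- A point of the graph is the limit of points moved upwards along `e`, which lie in `Ω`.
      have ht : Tendsto (fun s : ℝ => y + s • e) (𝓝[>] 0) (𝓝 y) := by
        have : Continuous fun s : ℝ => y + s • e := by fun_prop
        have h2 := this.tendsto 0
        rw [zero_smul, add_zero] at h2
        exact h2.mono_left nhdsWithin_le_nhds
      refine mem_closure_of_tendsto ht ?_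
      filter_upwards [ht.eventually (Metric.isOpen_ball.mem_nhds hyB), self_mem_nhdsWithin]
        with s hs hs0
      rw [hΩ _ hs]
      have h0 : hyperProj e (y + s • e) = hyperProj e y := by
        apply Subtype.ext
        rw [coe_hyperProj he, coe_hyperProj he, inner_add_right, inner_smul_right,
          real_inner_self_eq_norm_sq, he, add_smul]
        simp
      rw [h0, hy, inner_add_right, inner_smul_right, real_inner_self_eq_norm_sq, he]
      simpa using hs0
  let μ : Measure (Euc N) := ((hyperMeasure e).map (graphMap ψ)).restrict B
  have hμ : ∀ A, MeasurableSet A → μ A = hyperMeasure e (graphMap ψ ⁻¹' (A ∩ B)) := fun A hA => by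
    rw [Measure.restrict_apply hA, Measure.map_apply hGc.measurable (hA.inter hBm)]
  have hAB : ∀ A, A ∩ B ∩ range (graphMap ψ) = A ∩ (frontier Ω ∩ B) := fun A => by
    rw [hfr, inter_assoc]
  let d : ℝ := Module.finrank ℝ (Hyper e)
  -- The first summand of the constant serves the comparison with surface measure, the second the
  -- bound on the conormal.
  refine ⟨r, e, μ, conormal ψ, hyperConst he, (1 + K) ^ d + (K + 1), hr,
    ⟨he, ⟨?_⟩, ?_, ?_, ?_, ?_, ?_, conormal_axis he ψ, ?_, ?_⟩⟩
  · rw [hμ _ MeasurableSet.univ, univ_inter]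
    refine Bornology.IsBounded.measure_lt_top (Metric.isBounded_iff_subset_closedBall 0 |>.2
      ⟨‖x₀‖ + r, fun w hw => ?_⟩)
    rw [mem_closedBall_zero_iff]
    have h1 : dist (graphMap ψ w) x₀ < r := hw
    have h2 : ‖hyperProj e (graphMap ψ w)‖ ≤ ‖graphMap ψ w‖ :=
      (ContinuousLinearMap.le_of_opNorm_le _ (Submodule.orthogonalProjectionOnto_norm_le _)
        _).trans_eq (one_mul _)
    rw [show hyperProj e (graphMap ψ w) = w from hyperProj_graph he w _] at h2
    have h3 := norm_le_norm_add_norm_sub' (graphMap ψ w) x₀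
    rw [← dist_eq_norm] at h3
    linarith
  · exact NNReal.coe_pos.2 (pos_iff_ne_zero.2 (hyperConst_ne_zero he))
  · refine Measure.le_iff.2 fun A hA => ?_
    rw [hμ A hA, Measure.restrict_apply hA]
    refine (hyperMeasure_preimage_le he ψ _).trans (measure_mono ?_)
    rw [hAB]
    exact inter_subset_inter_right _ inter_subset_left
  · refine Measure.le_iff.2 fun A hA => ?_
    rw [Measure.restrict_apply hA, ← hAB, Measure.smul_apply, hμ A hA]
    refine (surfaceMeasure_inter_range_le he hψ _).trans ?_
    rw [ENNReal.smul_def, smul_eq_mul]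
    gcongr
    rw [← ENNReal.coe_rpow_of_nonneg _ (Nat.cast_nonneg _)]
    exact ENNReal.coe_le_coe.2 le_self_add
  · intro v
    simp only [conormal_apply]
    exact ((measurable_fderiv_apply_const ℝ ψ _).comp (hyperProj e).continuous.measurable).sub
      (by fun_prop)
  · intro x v
    have h1 : |fderiv ℝ ψ (hyperProj e x) (hyperProj e v)| ≤ K * ‖v‖ := by
      rw [← Real.norm_eq_abs]
      refine (ContinuousLinearMap.le_opNorm _ _).trans ?_
      gcongr
      · exact norm_fderiv_le_of_lipschitz ℝ hψ
      · exact (ContinuousLinearMap.le_of_opNorm_le _ (Submodule.orthogonalProjectionOnto_norm_le _)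
          v).trans_eq (one_mul _)
    have h2 : |(inner ℝ e v : ℝ)| ≤ ‖v‖ := by
      have := abs_real_inner_le_norm e v
      rwa [he, one_mul] at this
    rw [conormal_apply]
    have h3 : (0:ℝ) ≤ ((1 + K) ^ d : NNReal) * ‖v‖ := by positivity
    refine (abs_sub _ _).trans ?_
    push_cast at h3 ⊢
    nlinarith
  · intro h hh hc hs v
    have hzero : ∀ y ∉ B, h y = 0 := fun y hy =>
      image_eq_zero_of_notMem_tsupport fun h' => hy (hs h')
    have hDzero : ∀ y ∉ B, fderiv ℝ h y = 0 := fun y hy =>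
      image_eq_zero_of_notMem_tsupport fun h' => hy (hs (tsupport_fderiv_subset ℝ h'))
    have h1 : ∫ y in Ω, fderiv ℝ h y v =
        ∫ y in {y | ψ (hyperProj e y) < inner ℝ e y}, fderiv ℝ h y v := by
      have hm : MeasurableSet {y : Euc N | ψ (hyperProj e y) < inner ℝ e y} :=
        measurableSet_lt (by fun_prop) (by fun_prop)
      rw [← integral_indicator hm, ← integral_indicator ho.measurableSet]
      congr 1
      ext y
      by_cases hy : y ∈ B
      · by_cases hyΩ : y ∈ Ω
        · have hy' : y ∈ {y : Euc N | ψ (hyperProj e y) < inner ℝ e y} := (hΩ y hy).1 hyΩ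
          rw [indicator_of_mem hyΩ, indicator_of_mem hy']
        · have hy' : y ∉ {y : Euc N | ψ (hyperProj e y) < inner ℝ e y} :=
            fun h' => hyΩ ((hΩ y hy).2 h')
          rw [indicator_of_notMem hyΩ, indicator_of_notMem hy']
      · simp only [indicator, hDzero y hy, zero_apply, ite_self]
    have hpm : Measurable fun x => h x * conormal ψ x v := by
      refine hh.continuous.measurable.mul ?_
      simp only [conormal_apply]
      exact ((measurable_fderiv_apply_const ℝ ψ _).comp (hyperProj e).continuous.measurable).sub
        (by fun_prop)
    rw [h1, integral_fderiv_epigraph he hψ hh hc v,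
      ← integral_map (f := fun x => h x * conormal ψ x v) hGc.measurable.aemeasurable
        hpm.aestronglyMeasurable]
    refine (setIntegral_eq_integral_of_forall_compl_eq_zero fun y hy => ?_).symm
    rw [hzero y hy, zero_mul]
  · have h1 : ∀ᵐ w ∂hyperMeasure e, DifferentiableAt ℝ ψ w := hψ.ae_differentiableAt
    have hms : MeasurableSet {x : Euc N | DifferentiableAt ℝ ψ (hyperProj e x) ∧
        ψ (hyperProj e x) = inner ℝ e x} :=
      ((measurableSet_of_differentiableAt ℝ ψ).preimage (hyperProj e).continuous.measurable).inter
        (measurableSet_eq_fun (by fun_prop) (by fun_prop))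
    have h2 : ∀ᵐ x ∂(hyperMeasure e).map (graphMap ψ), DifferentiableAt ℝ ψ (hyperProj e x) ∧
        ψ (hyperProj e x) = inner ℝ e x := by
      rw [ae_map_iff hGc.measurable.aemeasurable hms]
      filter_upwards [h1] with w hw
      simp only [graphMap, hyperProj_graph he, inner_graph he]
      exact ⟨hw, trivial⟩
    filter_upwards [ae_restrict_of_ae h2, ae_restrict_mem hBm] with x hx hxB
    exact isOuterNormal_of_differentiableAt he hΩ hxB hx.2 hx.1

end chart

/-! ### The divergence theorem on a Lipschitz domain -/

section divergence

variable {N : ℕ}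

open scoped Manifold in
/-- Smooth finite partitions of unity on compact sets. -/
lemma exists_finset_partition {E : Type*} [NormedAddCommGroup E] [NormedSpace ℝ E]
    [FiniteDimensional ℝ E] {K : Set E} (hK : IsCompact K) {U : E → Set E}
    (hU : ∀ x ∈ K, IsOpen (U x) ∧ x ∈ U x ∧ Bornology.IsBounded (U x)) :
    ∃ (s : Finset E) (χ : E → E → ℝ), (∀ i ∈ s, i ∈ K) ∧
      (∀ i ∈ s, ContDiff ℝ ∞ (χ i) ∧ tsupport (χ i) ⊆ U i ∧ HasCompactSupport (χ i) ∧
        ∀ x, 0 ≤ χ i x) ∧ ∀ x ∈ K, ∑ i ∈ s, χ i x = 1 := by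
  classical
  obtain ⟨s, hs, hcov⟩ := hK.elim_nhds_subcover U fun x hx => (hU x hx).1.mem_nhds (hU x hx).2.1
  obtain ⟨f, hf⟩ := SmoothPartitionOfUnity.exists_isSubordinate (ι := s) 𝓘(ℝ, E) hK.isClosed
    (fun i => U i) (fun i => (hU i (hs i i.2)).1) (by
      refine hcov.trans fun x hx => ?_
      simp only [mem_iUnion] at hx ⊢
      obtain ⟨i, hi, hx⟩ := hx
      exact ⟨⟨i, hi⟩, hx⟩)
  refine ⟨s, fun i => if h : i ∈ s then f ⟨i, h⟩ else 0, hs, fun i hi => ?_, fun x hx => ?_⟩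
  · simp only [hi, dif_pos]
    have h2 : tsupport (f ⟨i, hi⟩) ⊆ U i := hf ⟨i, hi⟩
    refine ⟨(f ⟨i, hi⟩).contMDiff.contDiff, h2, ?_, fun x => f.nonneg _ x⟩
    exact Metric.isCompact_of_isClosed_isBounded (isClosed_tsupport _)
      ((hU i (hs i hi)).2.2.subset h2)
  · have h1 := f.sum_eq_one hx
    rw [finsum_eq_sum_of_fintype] at h1
    rw [← h1, ← Finset.sum_coe_sort s]
    refine Finset.sum_congr rfl fun i _ => ?_
    simp

lemma integral_fderiv_eq_zero {h : Euc N → ℝ} (hh : ContDiff ℝ 1 h) (hc : HasCompactSupport h)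
    (v : Euc N) : ∫ y, fderiv ℝ h y v = 0 := by
  obtain ⟨C, hC⟩ := contDiff_lipschitz hh hc
  have h1 := (LipschitzWith.const (α := Euc N) (1:ℝ)).integral_lineDeriv_mul_eq
    (μ := (volume : Measure (Euc N))) hC hc (-v)
  simp only [lineDeriv, deriv_const, neg_neg, zero_mul, integral_zero, mul_one] at h1
  rw [h1]
  refine integral_congr_ae (Eventually.of_forall fun y => ?_)
  exact ((hh.differentiable (by simp) y).hasFDerivAt.hasLineDerivAt v).lineDeriv.symm

/-- Finitely many boundary measures and weights representing boundary integrals. -/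
structure BoundaryIntegral (Ω : Set (Euc N)) (μ : Measure (Euc N))
    (β : Euc N → Euc N →L[ℝ] ℝ) (C : ℝ) : Prop where
  le_surface : μ ≤ (surfaceMeasure N).restrict (frontier Ω)
  measurable : ∀ v, Measurable fun x => β x v
  bound : ∀ x v, |β x v| ≤ C * ‖v‖
  normal : ∀ᵐ x ∂μ, ∃ (a : ℝ) (ν : Euc N), IsOuterNormal Ω x ν ∧ ∀ v, β x v = a * inner ℝ ν v

/-- Near an interior point the support stays in `Ω` and there is no boundary term, so the zero
measure works. At a boundary point the chart formula is divided by its constant `c`. -/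
lemma exists_local_divergence {Ω : Set (Euc N)} (ho : IsOpen Ω) (hb : Bornology.IsBounded Ω)
    (hlip : HasLipschitzBoundary Ω) {x : Euc N} (hx : x ∈ closure Ω) :
    ∃ U : Set (Euc N), (IsOpen U ∧ x ∈ U ∧ Bornology.IsBounded U) ∧
      ∃ μ β C, BoundaryIntegral Ω μ β C ∧ ∀ h : Euc N → ℝ, ContDiff ℝ 1 h → HasCompactSupport h →
        tsupport h ⊆ U → ∀ v, ∫ y in Ω, fderiv ℝ h y v = ∫ x, h x * β x v ∂μ := by
  by_cases hxΩ : x ∈ Ω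
  · refine ⟨Ω, ⟨ho, hxΩ, hb⟩, 0, 0, 0, ⟨Measure.zero_le _, fun v => measurable_const, by simp,
      by simp⟩, ?_⟩
    intro h hh hc hs v
    rw [integral_zero_measure, ← integral_fderiv_eq_zero hh hc v]
    refine setIntegral_eq_integral_of_forall_compl_eq_zero fun y hy => ?_
    rw [image_eq_zero_of_notMem_tsupport fun h' => hy (hs (tsupport_fderiv_subset ℝ h')),
      zero_apply]
  · have hxf : x ∈ frontier Ω := by rw [ho.frontier_eq]; exact ⟨hx, hxΩ⟩
    obtain ⟨r, e, μ, n, c, C, hr, hch⟩ := exists_boundaryChart ho hlip hxf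
    refine ⟨Metric.ball x r, ⟨Metric.isOpen_ball, Metric.mem_ball_self hr, Metric.isBounded_ball⟩,
      μ, fun x => c⁻¹ • n x, c⁻¹ * C, ⟨hch.le_surface, fun v => ?_, fun x v => ?_, ?_⟩, ?_⟩
    · exact (hch.measurable v).const_mul c⁻¹
    · rw [smul_apply, smul_eq_mul, abs_mul, abs_of_pos (inv_pos.2 hch.pos), mul_assoc]
      have := hch.pos
      gcongr
      exact hch.bound x v
    · filter_upwards [hch.normal] with x hx
      obtain ⟨a, ν, h1, h2⟩ := hx
      refine ⟨c⁻¹ * a, ν, h1, fun v => ?_⟩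
      rw [smul_apply, smul_eq_mul, h2, mul_assoc]
    · intro h hh hc hs v
      have h1 := hch.divergence h hh hc hs v
      have h2 : ∫ x, h x * (c⁻¹ • n x) v ∂μ = c⁻¹ * ∫ x, h x * n x v ∂μ := by
        rw [← integral_const_mul]
        refine integral_congr_ae (Eventually.of_forall fun x => ?_)
        simp only [smul_apply, smul_eq_mul]; ring
      rw [h2, ← h1, inv_mul_cancel_left₀ hch.pos.ne']

/-- Divergence theorem on a bounded Lipschitz domain. -/
theorem exists_divergence {Ω : Set (Euc N)} (ho : IsOpen Ω) (hb : Bornology.IsBounded Ω)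
    (hlip : HasLipschitzBoundary Ω) :
    ∃ (s : Finset (Euc N)) (μ : Euc N → Measure (Euc N)) (β : Euc N → Euc N → Euc N →L[ℝ] ℝ)
      (C : Euc N → ℝ), (∀ j ∈ s, BoundaryIntegral Ω (μ j) (β j) (C j)) ∧
      ∀ h : Euc N → ℝ, ContDiff ℝ 1 h → ∀ v,
        ∫ y in Ω, fderiv ℝ h y v = ∑ j ∈ s, ∫ x, h x * β j x v ∂(μ j) := by
  have hloc := fun x (hx : x ∈ closure Ω) => exists_local_divergence ho hb hlip hx
  choose! U hU μ β C hβ hdiv using hloc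
  have hK : IsCompact (closure Ω) := hb.isCompact_closure
  obtain ⟨s, χ, hs, hχ, hsum⟩ := exists_finset_partition hK hU
  have hbd : ∀ j ∈ s, ∃ M, ∀ x, |χ j x| ≤ M := fun j hj => by
    obtain ⟨M, hM⟩ := (hχ j hj).1.continuous.bounded_above_of_compact_support (hχ j hj).2.2.1
    exact ⟨M, fun x => hM x⟩
  choose! M hM using hbd
  -- The partition functions are absorbed into the boundary weights, so `h` itself needs no compact
  -- support.
  refine ⟨s, μ, fun j x => χ j x • β j x, fun j => M j * C j, fun j hj => ?_, fun h hh v => ?_⟩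
  · have hb := hβ j (hs j hj)
    refine ⟨hb.le_surface, fun v => ?_, fun x v => ?_, ?_⟩
    · exact (hχ j hj).1.continuous.measurable.mul (hb.measurable v)
    · rw [smul_apply, smul_eq_mul, abs_mul, mul_assoc]
      exact mul_le_mul (hM j hj x) (hb.bound x v) (abs_nonneg _)
        ((abs_nonneg _).trans (hM j hj x))
    · filter_upwards [hb.normal] with x hx
      obtain ⟨a, ν, h1, h2⟩ := hx
      refine ⟨χ j x * a, ν, h1, fun v => ?_⟩
      rw [smul_apply, smul_eq_mul, h2, mul_assoc]
  · have hj1 : ∀ j ∈ s, ContDiff ℝ 1 fun x => χ j x * h x := fun j hj =>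
      ((hχ j hj).1.of_le (by exact_mod_cast le_top)).mul hh
    have hj2 : ∀ j ∈ s, HasCompactSupport fun x => χ j x * h x := fun j hj =>
      (hχ j hj).2.2.1.mul_right
    have h1 : ∀ j ∈ s, ∫ x, h x * (χ j x • β j x) v ∂(μ j) =
        ∫ y in Ω, fderiv ℝ (fun x => χ j x * h x) y v := by
      intro j hj
      rw [hdiv j (hs j hj) _ (hj1 j hj) (hj2 j hj) ((closure_mono
        (Function.support_mul_subset_left _ _)).trans (hχ j hj).2.1) v]
      refine integral_congr_ae (Eventually.of_forall fun x => ?_)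
      simp only [smul_apply, smul_eq_mul]; ring
    rw [Finset.sum_congr rfl h1, ← integral_finsetSum]
    · refine setIntegral_congr_fun ho.measurableSet fun y hy => ?_
      -- The partition sums to one only on the closure of `Ω`; openness makes the identity hold near
      -- `y`, so it may be differentiated.
      have hev : h =ᶠ[𝓝 y] fun x => ∑ j ∈ s, χ j x * h x := by
        filter_upwards [ho.mem_nhds hy] with x hx
        rw [← Finset.sum_mul, hsum x (subset_closure hx), one_mul]
      rw [hev.fderiv_eq, fderiv_fun_sum fun j hj => (hj1 j hj).differentiable (by simp) y,
        sum_apply]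
    · intro j hj
      exact ((((hj1 j hj).continuous_fderiv (by simp)).clm_apply
        continuous_const).integrable_of_hasCompactSupport
          ((hj2 j hj).fderiv_apply (𝕜 := ℝ) v)).integrableOn

end divergence

/-! ### Green's formula for Sobolev functions -/

section green

lemma abs_integral_mul_le {α : Type*} [MeasurableSpace α] {μ : Measure α} {f g : α → ℝ}
    (hf : MemLp f 2 μ) (hg : MemLp g 2 μ) :
    |∫ x, f x * g x ∂μ| ≤ (eLpNorm f 2 μ).toReal * (eLpNorm g 2 μ).toReal := by
  have h1 : ∫ x, f x * g x ∂μ = inner ℝ (hf.toLp f) (hg.toLp g) := by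
    rw [L2.inner_def]
    refine integral_congr_ae ?_
    filter_upwards [hf.coeFn_toLp, hg.coeFn_toLp] with x h1 h2
    rw [h1, h2, real_inner_eq_re_inner]; simp [mul_comm]
  rw [h1]
  refine (abs_real_inner_le_norm _ _).trans_eq ?_
  rw [Lp.norm_toLp, Lp.norm_toLp]

/-- The approximants need not be square integrable, but their differences from the limits eventually
are, and the product is expanded around the limits. -/
lemma tendsto_integral_mul {α : Type*} [MeasurableSpace α] {μ : Measure α} {a b : α → ℝ}
    {A B : ℕ → α → ℝ} (ha : MemLp a 2 μ) (hb : MemLp b 2 μ)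
    (hAm : ∀ n, AEStronglyMeasurable (A n) μ) (hBm : ∀ n, AEStronglyMeasurable (B n) μ)
    (hA : Tendsto (fun n => eLpNorm (fun x => A n x - a x) 2 μ) atTop (𝓝 0))
    (hB : Tendsto (fun n => eLpNorm (fun x => B n x - b x) 2 μ) atTop (𝓝 0)) :
    Tendsto (fun n => ∫ x, A n x * B n x ∂μ) atTop (𝓝 (∫ x, a x * b x ∂μ)) := by
  have hA' := (ENNReal.tendsto_toReal ENNReal.zero_ne_top).comp hA
  have hB' := (ENNReal.tendsto_toReal ENNReal.zero_ne_top).comp hB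
  rw [ENNReal.toReal_zero] at hA' hB'
  rw [tendsto_iff_dist_tendsto_zero]
  have hlim : Tendsto (fun n => (eLpNorm (fun x => A n x - a x) 2 μ).toReal *
      (eLpNorm (fun x => B n x - b x) 2 μ).toReal + (eLpNorm (fun x => A n x - a x) 2 μ).toReal *
      (eLpNorm b 2 μ).toReal + (eLpNorm a 2 μ).toReal *
      (eLpNorm (fun x => B n x - b x) 2 μ).toReal) atTop (𝓝 0) := by
    have := ((hA'.mul hB').add (hA'.mul_const (eLpNorm b 2 μ).toReal)).add
      (hB'.const_mul (eLpNorm a 2 μ).toReal)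
    simpa using this
  refine squeeze_zero' (Eventually.of_forall fun _ => dist_nonneg) ?_ hlim
  filter_upwards [hA.eventually_lt_const ENNReal.zero_lt_top,
    hB.eventually_lt_const ENNReal.zero_lt_top] with n h1 h2
  have m1 : MemLp (fun x => A n x - a x) 2 μ := ⟨(hAm n).sub ha.1, h1⟩
  have m2 : MemLp (fun x => B n x - b x) 2 μ := ⟨(hBm n).sub hb.1, h2⟩
  have i1 : Integrable (fun x => (A n x - a x) * (B n x - b x)) μ := m1.integrable_mul m2
  have i2 : Integrable (fun x => (A n x - a x) * b x) μ := m1.integrable_mul hb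
  have i3 : Integrable (fun x => a x * (B n x - b x)) μ := ha.integrable_mul m2
  have i4 : Integrable (fun x => a x * b x) μ := ha.integrable_mul hb
  have heq : ∫ x, A n x * B n x ∂μ = (∫ x, (A n x - a x) * (B n x - b x) ∂μ)
      + (∫ x, (A n x - a x) * b x ∂μ) + (∫ x, a x * (B n x - b x) ∂μ) + ∫ x, a x * b x ∂μ := by
    have i12 : Integrable (fun x => (A n x - a x) * (B n x - b x) + (A n x - a x) * b x) μ :=
      i1.add i2
    have i123 : Integrable (fun x => (A n x - a x) * (B n x - b x) + (A n x - a x) * b x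
      + a x * (B n x - b x)) μ := i12.add i3
    rw [← integral_add i1 i2, ← integral_add i12 i3, ← integral_add i123 i4]
    refine integral_congr_ae (Eventually.of_forall fun x => ?_)
    ring
  rw [Real.dist_eq, heq, add_sub_cancel_right]
  refine (abs_add_le _ _).trans (add_le_add ((abs_add_le _ _).trans (add_le_add ?_ ?_)) ?_)
  · exact abs_integral_mul_le m1 m2
  · exact abs_integral_mul_le m1 hb
  · exact abs_integral_mul_le ha m2

lemma tendsto_eLpNorm_mono_measure {α : Type*} [MeasurableSpace α] {μ ν : Measure α} (h : μ ≤ ν)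
    {f : ℕ → α → ℝ} (hf : Tendsto (fun n => eLpNorm (f n) 2 ν) atTop (𝓝 0)) :
    Tendsto (fun n => eLpNorm (f n) 2 μ) atTop (𝓝 0) :=
  tendsto_of_tendsto_of_tendsto_of_le_of_le tendsto_const_nhds hf (fun _ => zero_le)
    fun _ => eLpNorm_mono_measure _ h

variable {N : ℕ} {Ω : Set (Euc N)}

/-- Integration by parts for `H¹` functions with traces. -/
lemma integral_partial_mul_of_hasTrace {s : Finset (Euc N)} {μ : Euc N → Measure (Euc N)}
    {β : Euc N → Euc N → Euc N →L[ℝ] ℝ} {C : Euc N → ℝ}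
    (hβ : ∀ j ∈ s, BoundaryIntegral Ω (μ j) (β j) (C j))
    (hdiv : ∀ h : Euc N → ℝ, ContDiff ℝ 1 h → ∀ v,
        ∫ y in Ω, fderiv ℝ h y v = ∑ j ∈ s, ∫ x, h x * β j x v ∂(μ j))
    (hb : Bornology.IsBounded Ω)
    {u v : H1 Ω} {g k : Euc N → ℝ} (hu : HasTrace u g) (hv : HasTrace v k) (i : Fin N) :
    (∫ x in Ω, dH1 u i x * fnH1 v x) + (∫ x in Ω, fnH1 u x * dH1 v i x) =
      ∑ j ∈ s, ∫ x, g x * (k x * β j x (stdVec i)) ∂(μ j) := by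
  obtain ⟨hg, φ, hφ, h1, h2, h3⟩ := hu
  obtain ⟨hk, θ, hθ, k1, k2, k3⟩ := hv
  have hfin : IsFiniteMeasure (vol Ω) := ⟨by
    rw [Measure.restrict_apply_univ]; exact hb.measure_lt_top⟩
  have hL : Tendsto (fun n => (∫ x in Ω, fderiv ℝ (φ n) x (stdVec i) * θ n x)
      + ∫ x in Ω, φ n x * fderiv ℝ (θ n) x (stdVec i)) atTop
      (𝓝 ((∫ x in Ω, dH1 u i x * fnH1 v x) + (∫ x in Ω, fnH1 u x * dH1 v i x))) :=
    (tendsto_integral_mul (Lp.memLp _) (Lp.memLp _)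
      (fun n => (continuous_partial (hφ n)).aestronglyMeasurable)
      (fun n => (hθ n).continuous.aestronglyMeasurable) (h2 i) k1).add
    (tendsto_integral_mul (Lp.memLp _) (Lp.memLp _)
      (fun n => (hφ n).continuous.aestronglyMeasurable)
      (fun n => (continuous_partial (hθ n)).aestronglyMeasurable) h1 (k2 i))
  -- The weights `β j` are bounded, so multiplication by them preserves the `L²` convergence of the
  -- boundary values.
  have hR : Tendsto (fun n => ∑ j ∈ s, ∫ x, φ n x * (θ n x * β j x (stdVec i)) ∂(μ j)) atTop
      (𝓝 (∑ j ∈ s, ∫ x, g x * (k x * β j x (stdVec i)) ∂(μ j))) := by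
    refine tendsto_finsetSum _ fun j hj => ?_
    have hm := (hβ j hj).le_surface
    have hbm := (hβ j hj).measurable (stdVec i)
    refine tendsto_integral_mul (hg.mono_measure hm) ?_
      (fun n => (hφ n).continuous.aestronglyMeasurable)
      (fun n => (hθ n).continuous.aestronglyMeasurable.mul hbm.aestronglyMeasurable)
      (tendsto_eLpNorm_mono_measure hm h3) ?_
    · refine MemLp.of_le_mul (c := C j * ‖stdVec (N := N) i‖) (hk.mono_measure hm)
        ((hk.mono_measure hm).1.mul hbm.aestronglyMeasurable) (Eventually.of_forall fun x => ?_)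
      rw [norm_mul, mul_comm]
      gcongr
      exact (hβ j hj).bound x _
    · have hlim := ENNReal.Tendsto.const_mul (tendsto_eLpNorm_mono_measure hm k3)
        (a := ENNReal.ofReal (C j * ‖stdVec (N := N) i‖)) (Or.inr ENNReal.ofReal_ne_top)
      rw [mul_zero] at hlim
      refine tendsto_of_tendsto_of_tendsto_of_le_of_le tendsto_const_nhds hlim (fun _ => zero_le)
        fun n => ?_
      refine eLpNorm_le_mul_eLpNorm_of_ae_le_mul (Eventually.of_forall fun x => ?_) _
      rw [← sub_mul, norm_mul, mul_comm]
      gcongr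
      exact (hβ j hj).bound x _
  refine tendsto_nhds_unique hL (hR.congr fun n => ?_)
  have hprod : ContDiff ℝ 1 fun x => φ n x * θ n x :=
    ((hφ n).mul (hθ n)).of_le (by exact_mod_cast le_top)
  have h4 := hdiv _ hprod (stdVec i)
  have hint : ∀ f : Euc N → ℝ, Continuous f → Integrable f (vol Ω) := fun f hf =>
    (hf.continuousOn.integrableOn_compact hb.isCompact_closure).mono_set subset_closure
  rw [← integral_add]
  · simp only [← mul_assoc]
    rw [← h4]
    refine integral_congr_ae (Eventually.of_forall fun x => ?_)
    simp only
    rw [fderiv_fun_mul ((hφ n).differentiable (by simp) x) ((hθ n).differentiable (by simp) x)]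
    simp only [add_apply, smul_apply, smul_eq_mul]
    ring
  · exact hint _ ((continuous_partial (hφ n)).mul (hθ n).continuous)
  · exact hint _ ((hφ n).continuous.mul (continuous_partial (hθ n)))

lemma inner_stdVec (ν : Euc N) (i : Fin N) : (inner ℝ ν (stdVec i) : ℝ) = ν i := by
  simp [stdVec, EuclideanSpace.inner_single_right]

/-- Green's formula: boundary terms vanish for `U ∈ X`, `v ∈ V`. -/
theorem green {ΓD ΓN : Set (Euc N)} (hΩ : IsMixedDomain Ω ΓD ΓN) {U : H2 Ω} (hU : U ∈ SpaceX Ω ΓN)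
    {v : H1 Ω} (hv : v ∈ SpaceV Ω ΓD) :
    ∑ i, (inner ℝ (dH1 (toH1 U) i) (dH1 v i) : ℝ) = -inner ℝ (lapH2 U) (fnH1 v) := by
  obtain ⟨s, μ, β, C, hβ, hdiv⟩ := exists_divergence hΩ.isOpen hΩ.isBounded hΩ.lipschitz
  obtain ⟨g, hg, hg0⟩ := hv
  obtain ⟨G, hG, hG0⟩ := hU
  have hin : ∀ a b : L2 Ω, (inner ℝ a b : ℝ) = ∫ x in Ω, a x * b x := fun a b => by
    rw [L2.inner_def]
    refine integral_congr_ae (Eventually.of_forall fun x => ?_)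
    simp [mul_comm]
  have hib := fun i => integral_partial_mul_of_hasTrace hβ hdiv hΩ.isBounded (hG i) hg i
  have hfrm : MeasurableSet (frontier Ω) := isClosed_frontier.measurableSet
  have hD : MeasurableSet ΓD := by
    obtain ⟨O, hO, rfl⟩ := hΩ.relOpen_D; exact hO.measurableSet.inter hfrm
  have hN : MeasurableSet ΓN := by
    obtain ⟨O, hO, rfl⟩ := hΩ.relOpen_N; exact hO.measurableSet.inter hfrm
  have hae : ∀ᵐ x ∂(surfaceMeasure N).restrict (frontier Ω),
      g x = 0 ∨ ∀ ν, IsOuterNormal Ω x ν → ∑ i, ν i * G i x = 0 := by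
    rw [ae_restrict_iff' hD] at hg0
    rw [ae_restrict_iff' hN] at hG0
    have hnull : ∀ᵐ x ∂surfaceMeasure N, x ∉ frontier Ω \ (ΓD ∪ ΓN) :=
      measure_eq_zero_iff_ae_notMem.1 hΩ.null
    rw [ae_restrict_iff' hfrm]
    filter_upwards [hg0, hG0, hnull] with x h1 h2 h3 hx
    have : x ∈ ΓD ∪ ΓN := by by_contra h; exact h3 ⟨hx, h⟩
    rcases this with h | h
    · exact Or.inl (h1 h)
    · exact Or.inr (h2 h)
  -- The weight is a multiple of the outer normal, so the sum over `i` is a multiple of `∂_ν U`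
  -- times the trace of `v`. Almost everywhere on the boundary one of these two factors vanishes.
  have hzero : ∀ j ∈ s, ∑ i, ∫ x, G i x * (g x * β j x (stdVec i)) ∂(μ j) = 0 := by
    intro j hj
    have hm := (hβ j hj).le_surface
    rw [← integral_finsetSum]
    · refine integral_eq_zero_of_ae ?_
      filter_upwards [(Measure.absolutelyContinuous_of_le hm).ae_le hae, (hβ j hj).normal]
        with x h1 h2
      obtain ⟨a, ν, hν, hβν⟩ := h2
      simp only [hβν, inner_stdVec, Pi.zero_apply]
      rcases h1 with h1 | h1
      · simp [h1]
      · have : ∑ i, G i x * (g x * (a * ν i)) = g x * a * ∑ i, ν i * G i x := by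
          rw [Finset.mul_sum]; exact Finset.sum_congr rfl fun i _ => by ring
        rw [this, h1 ν hν, mul_zero]
    · intro i _
      have hg2 := hg.1.mono_measure hm
      refine MemLp.integrable_mul (p := 2) (q := 2) ((hG i).1.mono_measure hm) ?_
      refine MemLp.of_le_mul (c := C j * ‖stdVec (N := N) i‖) hg2
        (hg2.1.mul ((hβ j hj).measurable _).aestronglyMeasurable) (Eventually.of_forall fun x => ?_)
      rw [norm_mul, mul_comm]
      gcongr
      exact (hβ j hj).bound x _
  have hsum : ∑ i, ((inner ℝ (U.1.snd (i, i)) (fnH1 v) : ℝ)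
      + inner ℝ (dH1 (toH1 U) i) (dH1 v i)) = 0 := by
    have h1 : ∀ i, ((inner ℝ (U.1.snd (i, i)) (fnH1 v) : ℝ) + inner ℝ (dH1 (toH1 U) i) (dH1 v i)) =
        ∑ j ∈ s, ∫ x, G i x * (g x * β j x (stdVec i)) ∂(μ j) := fun i => by
      rw [← hib i, hin, hin]; rfl
    rw [Finset.sum_congr rfl fun i _ => h1 i, Finset.sum_comm, Finset.sum_eq_zero hzero]
  rw [Finset.sum_add_distrib] at hsum
  rw [lapH2, sum_inner]
  linarith

end green

/-! ### The trace inequality and completeness -/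

section traceInequality

variable {N : ℕ} {Ω : Set (Euc N)}

lemma norm_sq_functional (A : Euc N →L[ℝ] ℝ) : ‖A‖ ^ 2 = ∑ i, A (stdVec i) ^ 2 := by
  let g : Euc N := (InnerProductSpace.toDual ℝ (Euc N)).symm A
  have hg : ∀ v, (inner ℝ g v : ℝ) = A v := fun v => InnerProductSpace.toDual_symm_apply
  have hgn : ‖g‖ = ‖A‖ := LinearIsometryEquiv.norm_map _ _
  rw [← hgn, EuclideanSpace.norm_sq_eq]
  refine Finset.sum_congr rfl fun i _ => ?_
  rw [← hg, inner_stdVec, Real.norm_eq_abs, sq_abs]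

/-- The integrand of the squared `H¹` norm of a smooth function. -/
noncomputable def h1Density (φ : Euc N → ℝ) (x : Euc N) : ℝ := φ x ^ 2 + ‖fderiv ℝ φ x‖ ^ 2

lemma continuous_h1Density {φ : Euc N → ℝ} (hφ : ContDiff ℝ 1 φ) : Continuous (h1Density φ) :=
  (hφ.continuous.pow 2).add ((hφ.continuous_fderiv (by simp)).norm.pow 2)

lemma integrableOn_of_continuous {f : Euc N → ℝ} (hb : Bornology.IsBounded Ω) (hf : Continuous f) :
    Integrable f (vol Ω) :=
  (hf.continuousOn.integrableOn_compact hb.isCompact_closure).mono_set subset_closure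

/-- The divergence formula of the chart is applied to `χ φ²` in the direction `e`. The conormal
takes the value `-1` on `e`, so the boundary integral of `χ φ²` itself appears, and Young's
inequality bounds the volume term. -/
lemma exists_local_trace_bound {x₀ : Euc N} {r : ℝ} {e : Euc N} {μ : Measure (Euc N)}
    {n : Euc N → Euc N →L[ℝ] ℝ} {c : ℝ} {C : NNReal} (hch : BoundaryChart Ω x₀ r e μ n c C)
    (hb : Bornology.IsBounded Ω) {χ : Euc N → ℝ} (hχ : ContDiff ℝ ∞ χ)
    (hs : tsupport χ ⊆ Metric.ball x₀ r) (hc : HasCompactSupport χ) (h0 : ∀ x, 0 ≤ χ x) :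
    ∃ M : ℝ, 0 ≤ M ∧ ∀ φ : Euc N → ℝ, ContDiff ℝ 1 φ →
      ∫⁻ x in frontier Ω, ENNReal.ofReal (χ x * φ x ^ 2) ∂surfaceMeasure N ≤
        ENNReal.ofReal (M * ∫ x in Ω, h1Density φ x) := by
  obtain ⟨M₁, hM₁⟩ := hχ.continuous.bounded_above_of_compact_support hc
  obtain ⟨M₂, hM₂⟩ := (hχ.continuous_fderiv (by simp)).bounded_above_of_compact_support
    (hc.fderiv (𝕜 := ℝ))
  have hM₁0 : 0 ≤ M₁ := (norm_nonneg _).trans (hM₁ 0)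
  have hM₂0 : 0 ≤ M₂ := (norm_nonneg _).trans (hM₂ 0)
  have hc0 := hch.pos
  have hfin := hch.finite
  refine ⟨C * (c * (M₁ + M₂)), by positivity, fun φ hφ => ?_⟩
  have hχ1 : ContDiff ℝ 1 χ := hχ.of_le (by exact_mod_cast le_top)
  have hp : ContDiff ℝ 1 fun x => χ x * φ x ^ 2 := hχ1.mul (hφ.pow 2)
  have hpc : HasCompactSupport fun x => χ x * φ x ^ 2 := hc.mul_right
  have hps : tsupport (fun x => χ x * φ x ^ 2) ⊆ Metric.ball x₀ r :=
    (closure_mono (Function.support_mul_subset_left _ _)).trans hs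
  have hp0 : ∀ x, 0 ≤ χ x * φ x ^ 2 := fun x => mul_nonneg (h0 x) (sq_nonneg _)
  have hI : Integrable (fun x => χ x * φ x ^ 2) μ :=
    hp.continuous.integrable_of_hasCompactSupport hpc
  have h1 : ∫⁻ x in frontier Ω, ENNReal.ofReal (χ x * φ x ^ 2) ∂surfaceMeasure N =
      ∫⁻ x in frontier Ω ∩ Metric.ball x₀ r, ENNReal.ofReal (χ x * φ x ^ 2) ∂surfaceMeasure N := by
    rw [← Measure.restrict_restrict_of_subset inter_subset_left,
      ← lintegral_indicator (isClosed_frontier.measurableSet.inter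
        Metric.isOpen_ball.measurableSet)]
    refine lintegral_congr_ae ?_
    filter_upwards [ae_restrict_mem isClosed_frontier.measurableSet] with x hx
    by_cases hxb : x ∈ Metric.ball x₀ r
    · have hm : x ∈ frontier Ω ∩ Metric.ball x₀ r := ⟨hx, hxb⟩
      rw [indicator_of_mem hm]
    · have hm : x ∉ frontier Ω ∩ Metric.ball x₀ r := fun h => hxb h.2
      rw [indicator_of_notMem hm,
        image_eq_zero_of_notMem_tsupport (f := fun x => χ x * φ x ^ 2) fun h' => hxb (hps h'),
        ENNReal.ofReal_zero]
  have h2 : ∫⁻ x in frontier Ω ∩ Metric.ball x₀ r, ENNReal.ofReal (χ x * φ x ^ 2)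
      ∂surfaceMeasure N ≤ C * ∫⁻ x, ENNReal.ofReal (χ x * φ x ^ 2) ∂μ := by
    refine (lintegral_mono' hch.surface_le le_rfl).trans_eq ?_
    rw [lintegral_smul_measure]; rfl
  have h3 : ∫ x, χ x * φ x ^ 2 ∂μ = -(c * ∫ y in Ω, fderiv ℝ (fun x => χ x * φ x ^ 2) y e) := by
    rw [hch.divergence _ hp hpc hps e, ← integral_neg]
    refine integral_congr_ae (Eventually.of_forall fun x => ?_)
    simp only [hch.apply_axis]; ring
  have h4 : -(∫ y in Ω, fderiv ℝ (fun x => χ x * φ x ^ 2) y e) ≤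
      (M₁ + M₂) * ∫ x in Ω, h1Density φ x := by
    rw [← integral_neg, ← integral_const_mul]
    have hcd : Continuous fun y => fderiv ℝ (fun x => χ x * φ x ^ 2) y e :=
      (hp.continuous_fderiv (by simp)).clm_apply continuous_const
    refine integral_mono (integrableOn_of_continuous hb hcd).neg
      ((integrableOn_of_continuous hb (continuous_h1Density hφ)).const_mul _) fun y => ?_
    have hd : fderiv ℝ (fun x => χ x * φ x ^ 2) y e =
        χ y * (2 * φ y * fderiv ℝ φ y e) + φ y ^ 2 * fderiv ℝ χ y e := by
      rw [fderiv_fun_mul (hχ1.differentiable (by simp) y)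
        ((hφ.pow 2).differentiable (by simp) y), fderiv_fun_pow 2 (hφ.differentiable (by simp) y)]
      simp only [add_apply, smul_apply, smul_eq_mul]
      simp
    have a1 : |χ y| ≤ M₁ := hM₁ y
    have a2 : |fderiv ℝ χ y e| ≤ M₂ := by
      have := (fderiv ℝ χ y).le_opNorm e
      rw [hch.norm_eq, mul_one] at this
      exact this.trans (hM₂ y)
    have a3 : |fderiv ℝ φ y e| ≤ ‖fderiv ℝ φ y‖ := by
      have := (fderiv ℝ φ y).le_opNorm e
      rwa [hch.norm_eq, mul_one] at this
    have a4 : |2 * φ y * fderiv ℝ φ y e| ≤ h1Density φ y := by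
      rw [abs_mul, abs_mul, abs_two, h1Density, ← sq_abs (φ y)]
      nlinarith [sq_nonneg (|φ y| - ‖fderiv ℝ φ y‖), abs_nonneg (φ y)]
    have a5 : 0 ≤ h1Density φ y := (abs_nonneg _).trans a4
    have a6 : φ y ^ 2 ≤ h1Density φ y := by unfold h1Density; linarith [sq_nonneg ‖fderiv ℝ φ y‖]
    simp only [hd]
    calc -(χ y * (2 * φ y * fderiv ℝ φ y e) + φ y ^ 2 * fderiv ℝ χ y e)
        ≤ |χ y * (2 * φ y * fderiv ℝ φ y e) + φ y ^ 2 * fderiv ℝ χ y e| := neg_le_abs _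
      _ ≤ |χ y| * |2 * φ y * fderiv ℝ φ y e| + |φ y ^ 2| * |fderiv ℝ χ y e| := by
          rw [← abs_mul, ← abs_mul]; exact abs_add_le _ _
      _ ≤ M₁ * h1Density φ y + h1Density φ y * M₂ := by
          rw [abs_of_nonneg (sq_nonneg (φ y))]
          gcongr
      _ = _ := by ring
  rw [h1]
  refine h2.trans ?_
  rw [← ofReal_integral_eq_lintegral_ofReal hI (Eventually.of_forall hp0), h3,
    ← ENNReal.ofReal_coe_nnreal, ← ENNReal.ofReal_mul NNReal.zero_le_coe]
  refine ENNReal.ofReal_le_ofReal ?_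
  rw [mul_assoc, mul_assoc, ← mul_neg]
  gcongr

/-- The trace inequality for smooth functions. -/
theorem exists_trace_bound (ho : IsOpen Ω) (hb : Bornology.IsBounded Ω)
    (hlip : HasLipschitzBoundary Ω) :
    ∃ M : ℝ, 0 ≤ M ∧ ∀ φ : Euc N → ℝ, ContDiff ℝ 1 φ →
      ∫⁻ x in frontier Ω, ENNReal.ofReal (φ x ^ 2) ∂surfaceMeasure N ≤
        ENNReal.ofReal (M * ∫ x in Ω, h1Density φ x) := by
  have hloc := fun x (hx : x ∈ frontier Ω) => exists_boundaryChart ho hlip hx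
  choose! r e μ n c C hr hch using hloc
  have hK : IsCompact (frontier Ω) :=
    hb.isCompact_closure.of_isClosed_subset isClosed_frontier frontier_subset_closure
  obtain ⟨s, χ, hs, hχ, hsum⟩ := exists_finset_partition hK (U := fun x => Metric.ball x (r x))
    fun x hx => ⟨Metric.isOpen_ball, Metric.mem_ball_self (hr x hx), Metric.isBounded_ball⟩
  have hj := fun j (hj : j ∈ s) => exists_local_trace_bound (hch j (hs j hj)) hb (hχ j hj).1
    (hχ j hj).2.1 (hχ j hj).2.2.1 (hχ j hj).2.2.2
  choose! M hM0 hM using hj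
  refine ⟨∑ j ∈ s, M j, Finset.sum_nonneg hM0, fun φ hφ => ?_⟩
  have h1 : ∫⁻ x in frontier Ω, ENNReal.ofReal (φ x ^ 2) ∂surfaceMeasure N =
      ∫⁻ x in frontier Ω, ∑ j ∈ s, ENNReal.ofReal (χ j x * φ x ^ 2) ∂surfaceMeasure N := by
    refine lintegral_congr_ae ?_
    filter_upwards [ae_restrict_mem isClosed_frontier.measurableSet] with x hx
    rw [← ENNReal.ofReal_sum_of_nonneg fun j hj =>
      mul_nonneg ((hχ j hj).2.2.2 x) (sq_nonneg _), ← Finset.sum_mul, hsum x hx, one_mul]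
  have hd0 : 0 ≤ ∫ x in Ω, h1Density φ x := integral_nonneg fun x => by
    unfold h1Density; positivity
  rw [h1, lintegral_finsetSum' _ fun j hj => ?_, Finset.sum_mul, ENNReal.ofReal_sum_of_nonneg
    fun j hj => mul_nonneg (hM0 j hj) hd0]
  · exact Finset.sum_le_sum fun j hj => hM j hj φ hφ
  · exact (((hχ j hj).1.continuous.mul (hφ.continuous.pow 2)).measurable.ennreal_ofReal).aemeasurable

lemma norm_sq_H1 (u : H1 Ω) : ‖u‖ ^ 2 = ‖fnH1 u‖ ^ 2 + ∑ i, ‖dH1 u i‖ ^ 2 := by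
  rw [Submodule.coe_norm, WithLp.prod_norm_sq_eq_of_L2, PiLp.norm_sq_eq_of_L2]; rfl

lemma inner_H1 (u v : H1 Ω) :
    (inner ℝ u v : ℝ) = inner ℝ (fnH1 u) (fnH1 v) + ∑ i, inner ℝ (dH1 u i) (dH1 v i) := by
  rw [Submodule.coe_inner, WithLp.prod_inner_apply, PiLp.inner_apply]; rfl

lemma inner_L2_eq {α : Type*} [MeasurableSpace α] {μ : Measure α} (a b : Lp ℝ 2 μ) :
    (inner ℝ a b : ℝ) = ∫ x, a x * b x ∂μ := by
  rw [L2.inner_def]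
  exact integral_congr_ae (Eventually.of_forall fun x => by simp [mul_comm])

/-- Passing to the limit in the smooth inequality bounds the trace by the `H¹` norm; closedness of
`V` rests on this. -/
theorem exists_eLpNorm_trace_le (ho : IsOpen Ω) (hb : Bornology.IsBounded Ω)
    (hlip : HasLipschitzBoundary Ω) :
    ∃ M : ℝ, 0 ≤ M ∧ ∀ (u : H1 Ω) (g : Euc N → ℝ), HasTrace u g →
      eLpNorm g 2 ((surfaceMeasure N).restrict (frontier Ω)) ≤ ENNReal.ofReal (M * ‖u‖) := by
  obtain ⟨M, hM0, hM⟩ := exists_trace_bound ho hb hlip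
  refine ⟨Real.sqrt M, Real.sqrt_nonneg _, ?_⟩
  rintro u g ⟨hg, φ, hφ, h1, h2, h3⟩
  have hφ1 : ∀ n, ContDiff ℝ 1 (φ n) := fun n => (hφ n).of_le (by exact_mod_cast le_top)
  let S := (surfaceMeasure N).restrict (frontier Ω)
  have hI : Tendsto (fun n => ∫ x in Ω, h1Density (φ n) x) atTop (𝓝 (‖u‖ ^ 2)) := by
    have hlim : Tendsto (fun n => (∫ x in Ω, φ n x * φ n x) + ∑ i, ∫ x in Ω,
        fderiv ℝ (φ n) x (stdVec i) * fderiv ℝ (φ n) x (stdVec i)) atTop (𝓝 (‖u‖ ^ 2)) := by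
      rw [norm_sq_H1, ← real_inner_self_eq_norm_sq, inner_L2_eq]
      simp only [← real_inner_self_eq_norm_sq (dH1 u _), inner_L2_eq]
      refine (tendsto_integral_mul (Lp.memLp _) (Lp.memLp _)
        (fun n => (hφ n).continuous.aestronglyMeasurable)
        (fun n => (hφ n).continuous.aestronglyMeasurable) h1 h1).add ?_
      exact tendsto_finsetSum _ fun i _ => tendsto_integral_mul (Lp.memLp _) (Lp.memLp _)
        (fun n => (continuous_partial (hφ n)).aestronglyMeasurable)
        (fun n => (continuous_partial (hφ n)).aestronglyMeasurable) (h2 i) (h2 i)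
    refine hlim.congr fun n => ?_
    have hi : ∀ f : Euc N → ℝ, Continuous f → Integrable f (vol Ω) := fun f hf =>
      integrableOn_of_continuous hb hf
    have hc := (hφ n).continuous
    have hd := fun i => continuous_partial (i := i) (hφ n)
    have hii : ∀ i ∈ Finset.univ, Integrable (fun x => fderiv ℝ (φ n) x (stdVec i) *
        fderiv ℝ (φ n) x (stdVec i)) (vol Ω) := fun i _ => hi _ ((hd i).mul (hd i))
    have hi0 : Integrable (fun x => φ n x * φ n x) (vol Ω) := hi _ (hc.mul hc)
    rw [← integral_finsetSum _ hii, ← integral_add hi0 (integrable_finsetSum _ hii)]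
    refine integral_congr_ae (Eventually.of_forall fun x => ?_)
    simp only [h1Density, norm_sq_functional]
    simp only [sq]
  have hle : ∀ n, eLpNorm (φ n) 2 S ≤ ENNReal.ofReal (Real.sqrt (M * ∫ x in Ω, h1Density (φ n) x)) := by
    intro n
    have h4 := hM (φ n) (hφ1 n)
    have h5 : eLpNorm (φ n) 2 S ^ (2:ℝ) = ∫⁻ x, ENNReal.ofReal (φ n x ^ 2) ∂S := by
      have := eLpNorm_nnreal_pow_eq_lintegral (μ := S) (f := φ n) (p := 2) (by norm_num)
      push_cast at this
      rw [this]
      refine lintegral_congr fun x => ?_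
      rw [← sq_abs, ENNReal.ofReal_pow (abs_nonneg _), Real.enorm_eq_ofReal_abs]
      norm_num
    have hd0 : 0 ≤ M * ∫ x in Ω, h1Density (φ n) x := mul_nonneg hM0 (integral_nonneg fun x => by
      unfold h1Density; positivity)
    have h6 : eLpNorm (φ n) 2 S ^ (2:ℝ) ≤
        ENNReal.ofReal (Real.sqrt (M * ∫ x in Ω, h1Density (φ n) x)) ^ (2:ℝ) := by
      rw [h5]
      refine h4.trans_eq ?_
      rw [ENNReal.rpow_two, ← ENNReal.ofReal_pow (Real.sqrt_nonneg _), Real.sq_sqrt hd0]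
    exact (ENNReal.rpow_le_rpow_iff (by norm_num)).1 h6
  have hlim : Tendsto (fun n => eLpNorm (fun x => φ n x - g x) 2 S +
      ENNReal.ofReal (Real.sqrt (M * ∫ x in Ω, h1Density (φ n) x))) atTop
      (𝓝 (0 + ENNReal.ofReal (Real.sqrt (M * ‖u‖ ^ 2)))) :=
    h3.add ((ENNReal.continuous_ofReal.tendsto _).comp
      ((Real.continuous_sqrt.tendsto _).comp (hI.const_mul M)))
  rw [zero_add, Real.sqrt_mul hM0, Real.sqrt_sq (norm_nonneg _)] at hlim
  refine ge_of_tendsto' hlim fun n => ?_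
  have h7 : eLpNorm g 2 S ≤ eLpNorm (fun x => φ n x - g x) 2 S + eLpNorm (φ n) 2 S := by
    have hm : AEStronglyMeasurable (fun x => φ n x - g x) S :=
      (hφ n).continuous.aestronglyMeasurable.sub hg.1
    have := eLpNorm_sub_le (p := 2) (hφ n).continuous.aestronglyMeasurable hm (by norm_num)
    rw [add_comm]
    refine le_trans (le_of_eq ?_) this
    congr 1
    ext x; simp
  exact h7.trans (by gcongr; exact hle n)

end traceInequality

section complete

variable {N : ℕ} {Ω : Set (Euc N)}

lemma continuous_integral_mul_test {φ : Euc N → ℝ} (hφ : Continuous φ) (hc : HasCompactSupport φ) :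
    Continuous fun u : L2 Ω => ∫ x in Ω, u x * φ x := by
  have hm : MemLp φ 2 (vol Ω) := hφ.memLp_of_hasCompactSupport hc
  have : Continuous fun u : L2 Ω => (inner ℝ u (hm.toLp φ) : ℝ) :=
    continuous_id.inner continuous_const
  refine this.congr fun u => ?_
  rw [inner_L2_eq]
  refine integral_congr_ae ?_
  filter_upwards [hm.coeFn_toLp] with x hx
  rw [hx]

lemma isClosed_H1 : IsClosed (H1 Ω : Set (WithLp 2 (L2 Ω × PiLp 2 (fun _ : Fin N => L2 Ω)))) := by
  have : (H1 Ω : Set (WithLp 2 (L2 Ω × PiLp 2 (fun _ : Fin N => L2 Ω)))) =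
      {u | ∀ (i : Fin N) (φ : Euc N → ℝ), ContDiff ℝ ∞ φ → HasCompactSupport φ → tsupport φ ⊆ Ω →
        ∫ x in Ω, u.fst x * fderiv ℝ φ x (stdVec i) = -∫ x in Ω, u.snd i x * φ x} := rfl
  rw [this]
  simp only [Set.ofPred_forall]
  refine isClosed_iInter fun i => isClosed_iInter fun φ => isClosed_iInter fun hφ =>
    isClosed_iInter fun hc => isClosed_iInter fun _ => isClosed_eq ?_ ?_
  · exact (continuous_integral_mul_test (continuous_partial hφ) (hasCompactSupport_partial hc)).comp
      (WithLp.continuous_fst 2 _ _)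
  · refine ((continuous_integral_mul_test hφ.continuous hc).comp
      ((PiLp.continuous_apply 2 _ i).comp (WithLp.continuous_snd 2 _ _))).neg

instance completeSpace_H1 : CompleteSpace (H1 Ω) := isClosed_H1.completeSpace_coe

/-- Weak derivatives are unique by the fundamental lemma of the calculus of variations, so the `L²`
function determines the whole `H¹` element. -/
lemma fnH1_injective (ho : IsOpen Ω) {u v : H1 Ω} (h : fnH1 u = fnH1 v) : u = v := by
  have key : ∀ w : H1 Ω, fnH1 w = 0 → w = 0 := by
    intro w hw
    have hd : ∀ i, dH1 w i = 0 := by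
      intro i
      have hli : LocallyIntegrableOn (dH1 w i) Ω volume :=
        locallyIntegrableOn_of_locallyIntegrable_restrict
          ((Lp.memLp (dH1 w i)).locallyIntegrable (by norm_num))
      have h0 := ho.ae_eq_zero_of_integral_contDiff_smul_eq_zero hli fun φ hφ hc hs => by
        have h1 := w.2 i φ hφ hc hs
        have h2 : ∫ x in Ω, (fnH1 w) x * fderiv ℝ φ x (stdVec i) = 0 := by
          refine integral_eq_zero_of_ae ?_
          rw [hw]
          filter_upwards [Lp.coeFn_zero ℝ 2 (vol Ω)] with x hx
          rw [hx]; simp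
        have h3 : ∫ x in Ω, dH1 w i x * φ x = 0 := by
          have : ∫ x in Ω, dH1 w i x * φ x = -∫ x in Ω, (fnH1 w) x * fderiv ℝ φ x (stdVec i) := by
            rw [← neg_eq_iff_eq_neg]; exact h1.symm
          rw [this, h2, neg_zero]
        rw [← h3]
        refine (setIntegral_eq_integral_of_forall_compl_eq_zero fun x hx => ?_).symm.trans
          (integral_congr_ae (Eventually.of_forall fun x => mul_comm _ _))
        rw [image_eq_zero_of_notMem_tsupport fun h' => hx (hs h'), zero_smul]
      refine Lp.ext ?_
      filter_upwards [(ae_restrict_iff' ho.measurableSet).2 h0, Lp.coeFn_zero ℝ 2 (vol Ω)]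
        with x h1 h2
      rw [h1, h2]; rfl
    have : ‖w‖ ^ 2 = 0 := by rw [norm_sq_H1, hw]; simp [hd]
    exact norm_eq_zero.1 (pow_eq_zero_iff (by norm_num) |>.1 this)
  have h2 : fnH1 (u - v) = 0 := by
    have : fnH1 (u - v) = fnH1 u - fnH1 v := rfl
    rw [this, h, sub_self]
  exact sub_eq_zero.1 (key _ h2)

/-- By the trace inequality the traces of a convergent sequence are Cauchy in `L²(∂Ω)`, and their
limit still vanishes on `ΓD`. Choosing for each `n` one smooth function within `1/(n+1)` of the
`n`-th element, inside and on the boundary, shows that this limit is the trace of the limit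
function. -/
lemma isClosed_SpaceV {ΓD ΓN : Set (Euc N)} (hΩ : IsMixedDomain Ω ΓD ΓN) :
    IsClosed (SpaceV Ω ΓD : Set (H1 Ω)) := by
  obtain ⟨M, hM0, hM⟩ := exists_eLpNorm_trace_le hΩ.isOpen hΩ.isBounded hΩ.lipschitz
  let S := (surfaceMeasure N).restrict (frontier Ω)
  refine IsSeqClosed.isClosed fun u u₀ hu hlim => ?_
  choose g hg hg0 using hu
  have hS : (surfaceMeasure N).restrict ΓD ≤ S := by
    obtain ⟨O, -, rfl⟩ := hΩ.relOpen_D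
    exact Measure.restrict_mono_set _ inter_subset_right
  let G : ℕ → Lp ℝ 2 S := fun n => (hg n).1.toLp (g n)
  have hG : ∀ n m, dist (G n) (G m) ≤ M * dist (u n) (u m) := by
    intro n m
    have h1 := hM (u n + (-1 : ℝ) • u m) _ ((hg n).add ((hg m).smul (-1)))
    rw [dist_edist, dist_eq_norm, Lp.edist_toLp_toLp]
    refine ENNReal.toReal_le_of_le_ofReal (by positivity) ?_
    convert! h1 using 2
    · ext x; simp [sub_eq_add_neg]
    · congr 2; rw [neg_one_smul, sub_eq_add_neg]
  have hcau : CauchySeq G := by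
    have hu := hlim.cauchySeq
    rw [Metric.cauchySeq_iff'] at hu ⊢
    intro ε hε
    obtain ⟨n₀, hn₀⟩ := hu (ε / (M + 1)) (by positivity)
    refine ⟨n₀, fun n hn => (hG n n₀).trans_lt ?_⟩
    have h1 := hn₀ n hn
    rw [lt_div_iff₀ (by positivity)] at h1
    nlinarith [dist_nonneg (x := u n) (y := u n₀)]
  obtain ⟨g₀, hg₀⟩ := cauchySeq_tendsto_of_complete hcau
  have hgn : Tendsto (fun n => eLpNorm (fun x => g n x - g₀ x) 2 S) atTop (𝓝 0) := by
    have h1 := tendsto_iff_edist_tendsto_0.1 hg₀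
    refine h1.congr fun n => ?_
    rw [Lp.edist_def]
    refine eLpNorm_congr_ae ?_
    filter_upwards [(hg n).1.coeFn_toLp] with x hx
    simp only [Pi.sub_apply, G]
    rw [hx]
  have hpick : ∀ n, ∃ φ : Euc N → ℝ, ContDiff ℝ ∞ φ ∧
      eLpNorm (fun x => φ x - fnH1 (u n) x) 2 (vol Ω) < ENNReal.ofReal (1 / ((n:ℝ) + 1)) ∧
      (∀ i, eLpNorm (fun x => fderiv ℝ φ x (stdVec i) - dH1 (u n) i x) 2 (vol Ω) <
        ENNReal.ofReal (1 / ((n:ℝ) + 1))) ∧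
      eLpNorm (fun x => φ x - g n x) 2 S < ENNReal.ofReal (1 / ((n:ℝ) + 1)) := by
    intro n
    obtain ⟨-, φ, hφ, h1, h2, h3⟩ := hg n
    have hpos : (0 : ℝ≥0∞) < ENNReal.ofReal (1 / ((n:ℝ) + 1)) :=
      ENNReal.ofReal_pos.2 (by positivity)
    have hev := (h1.eventually_lt_const hpos).and
      ((eventually_all.2 fun i => (h2 i).eventually_lt_const hpos).and
        (h3.eventually_lt_const hpos))
    obtain ⟨k, k1, k2, k3⟩ := hev.exists
    exact ⟨φ k, hφ k, k1, k2, k3⟩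
  choose φ hφ h1 h2 h3 using hpick
  have hε : Tendsto (fun n : ℕ => ENNReal.ofReal (1 / ((n:ℝ) + 1))) atTop (𝓝 0) := by
    have := (ENNReal.continuous_ofReal.tendsto _).comp
      (tendsto_one_div_add_atTop_nhds_zero_nat (𝕜 := ℝ))
    rwa [ENNReal.ofReal_zero] at this
  have hsq : ∀ F : ℕ → ℝ≥0∞, (∀ n, F n < ENNReal.ofReal (1 / ((n:ℝ) + 1))) →
      Tendsto F atTop (𝓝 0) := fun F hF =>
    tendsto_of_tendsto_of_tendsto_of_le_of_le tendsto_const_nhds hε (fun _ => zero_le)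
      fun n => (hF n).le
  have hLp : ∀ (a : ℕ → L2 Ω) (a₀ : L2 Ω), Tendsto a atTop (𝓝 a₀) →
      Tendsto (fun n => eLpNorm (fun x => a n x - a₀ x) 2 (vol Ω)) atTop (𝓝 0) := by
    intro a a₀ ha
    exact (Lp.tendsto_Lp_iff_tendsto_eLpNorm' a a₀).1 ha
  have hcf : Continuous (fnH1 : H1 Ω → L2 Ω) :=
    (WithLp.continuous_fst 2 _ _).comp continuous_subtype_val
  have hcd : ∀ i, Continuous (fun u : H1 Ω => dH1 u i) := fun i =>
    (PiLp.continuous_apply 2 _ i).comp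
      ((WithLp.continuous_snd 2 _ _).comp continuous_subtype_val)
  refine ⟨g₀, ⟨Lp.memLp _, φ, hφ, ?_, fun i => ?_, ?_⟩, ?_⟩
  · refine tendsto_eLpNorm_add (fun n => (hφ n).continuous.aestronglyMeasurable.sub
      (Lp.aestronglyMeasurable _)) (fun n => (Lp.aestronglyMeasurable _).sub
      (Lp.aestronglyMeasurable _)) (hsq _ h1) (hLp _ _ ((hcf.tendsto _).comp hlim))
      fun n => Eventually.of_forall fun x => ?_
    simp
  · refine tendsto_eLpNorm_add (fun n => (continuous_partial (hφ n)).aestronglyMeasurable.sub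
      (Lp.aestronglyMeasurable _)) (fun n => (Lp.aestronglyMeasurable _).sub
      (Lp.aestronglyMeasurable _)) (hsq _ fun n => h2 n i) (hLp _ _ (((hcd i).tendsto _).comp hlim))
      fun n => Eventually.of_forall fun x => ?_
    simp
  · refine tendsto_eLpNorm_add (fun n => (hφ n).continuous.aestronglyMeasurable.sub
      (hg n).1.1) (fun n => (hg n).1.1.sub (Lp.aestronglyMeasurable _)) (hsq _ h3) hgn
      fun n => Eventually.of_forall fun x => ?_
    simp
  · have h4 := tendsto_eLpNorm_mono_measure hS hgn
    have h5 : ∀ n, eLpNorm (fun x => g n x - g₀ x) 2 ((surfaceMeasure N).restrict ΓD) =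
        eLpNorm g₀ 2 ((surfaceMeasure N).restrict ΓD) := by
      intro n
      rw [← eLpNorm_neg (f := (g₀ : Euc N → ℝ))]
      refine eLpNorm_congr_ae ?_
      filter_upwards [hg0 n] with x hx
      simp [hx]
    simp only [h5] at h4
    have h6 := tendsto_nhds_unique h4 tendsto_const_nhds
    have h7 := (eLpNorm_eq_zero_iff ((Lp.aestronglyMeasurable g₀).mono_measure hS)
      (by norm_num)).1 h6.symm
    exact h7

lemma completeSpace_SpaceV {ΓD ΓN : Set (Euc N)} (hΩ : IsMixedDomain Ω ΓD ΓN) :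
    CompleteSpace (SpaceV Ω ΓD) := (isClosed_SpaceV hΩ).completeSpace_coe

end complete

/-! ### Sobolev embedding of `V`, without an extension operator -/

section sobolev

variable {N : ℕ} {Ω : Set (Euc N)}

/-- Inside the ball `B(x₀, r)`, the set `Ω` is stable under translation along the vector `d`. -/
def StableAlong (Ω : Set (Euc N)) (x₀ : Euc N) (r : ℝ) (d : Euc N) : Prop :=
  ∀ x ∈ Ω, x ∈ Metric.ball x₀ r → ∀ t : ℝ, 0 ≤ t → x + t • d ∈ Metric.ball x₀ r → x + t • d ∈ Ω

/-- Above a `K`-Lipschitz graph the stable directions include the open cone where `K` times the part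
orthogonal to `e` is smaller than the component along `e`. The cone contains `e`, so it spans and
contains a basis. At an interior point any basis works. -/
lemma exists_basis_stableAlong (ho : IsOpen Ω) (hlip : HasLipschitzBoundary Ω) {x₀ : Euc N}
    (hx₀ : x₀ ∈ closure Ω) : ∃ r > 0, ∃ b : Module.Basis (Fin N) ℝ (Euc N),
      ∀ i, StableAlong Ω x₀ r (b i) := by
  by_cases hx : x₀ ∈ Ω
  · obtain ⟨r, hr, hb⟩ := Metric.isOpen_iff.1 ho x₀ hx
    exact ⟨r, hr, (EuclideanSpace.basisFun (Fin N) ℝ).toBasis, fun i x _ _ t _ h => hb h⟩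
  obtain ⟨e, r, K, ψ, he, hr, hψ, h⟩ := hlip x₀ ⟨hx₀, by rwa [ho.interior_eq]⟩
  set S : Set (Euc N) := {d | K * ‖d - (inner ℝ e d : ℝ) • e‖ < (inner ℝ e d : ℝ)} with hS
  have hSo : IsOpen S := isOpen_lt (by fun_prop) (by fun_prop)
  have heS : e ∈ S := by simp [hS, he]
  have hspan : Submodule.span ℝ S = ⊤ :=
    Submodule.eq_top_of_nonempty_interior' _
      ⟨e, interior_mono Submodule.subset_span (by rwa [hSo.interior_eq])⟩
  set b₀ := Module.Basis.ofSpan hspan.ge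
  set b := b₀.reindex (b₀.indexEquiv (EuclideanSpace.basisFun (Fin N) ℝ).toBasis)
  refine ⟨r, hr, b, fun i x hxΩ hxb t ht hyb => ?_⟩
  have hd : b i ∈ S := by
    apply Module.Basis.ofSpan_subset hspan.ge
    rw [Module.Basis.reindex_apply]
    exact ⟨_, rfl⟩
  set d := b i
  rw [h _ hyb]
  have h1 := (h _ hxb).1 hxΩ
  have h2 : x + t • d - (inner ℝ e (x + t • d) : ℝ) • e =
      (x - (inner ℝ e x : ℝ) • e) + t • (d - (inner ℝ e d : ℝ) • e) := by
    rw [inner_add_right, inner_smul_right]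
    module
  have h3 : ψ (x + t • d - (inner ℝ e (x + t • d) : ℝ) • e) ≤ ψ (x - (inner ℝ e x : ℝ) • e) +
      K * (t * ‖d - (inner ℝ e d : ℝ) • e‖) := by
    have := hψ.dist_le_mul (x + t • d - (inner ℝ e (x + t • d) : ℝ) • e) (x - (inner ℝ e x : ℝ) • e)
    rw [h2, dist_eq_norm, dist_eq_norm, add_sub_cancel_left, norm_smul, Real.norm_of_nonneg ht] at this
    rw [h2]
    linarith [le_abs_self (ψ (x - (inner ℝ e x : ℝ) • e + t • (d - (inner ℝ e d : ℝ) • e)) -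
      ψ (x - (inner ℝ e x : ℝ) • e)), Real.norm_eq_abs (ψ (x - (inner ℝ e x : ℝ) • e +
      t • (d - (inner ℝ e d : ℝ) • e)) - ψ (x - (inner ℝ e x : ℝ) • e))]
  rw [inner_add_right, inner_smul_right] at *
  have h4 : t * (K * ‖d - (inner ℝ e d : ℝ) • e‖) ≤ t * (inner ℝ e d : ℝ) :=
    mul_le_mul_of_nonneg_left hd.le ht
  nlinarith

/-- Along the ray from `x` in the direction `d`, every point in the ball belongs to `Ω`, and outside
the ball `h` vanishes. The fundamental theorem of calculus therefore sees the gradient only inside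
`Ω`. The bound is stated with the whole line, as the Gagliardo–Nirenberg argument requires. -/
lemma enorm_le_lintegral_ray {x₀ : Euc N} {r : ℝ} {d : Euc N} (hd0 : d ≠ 0)
    (hd : StableAlong Ω x₀ r d)
    {h : Euc N → ℝ} (hh : ContDiff ℝ 1 h) (hc : HasCompactSupport h)
    (hs : tsupport h ⊆ Metric.ball x₀ r) {x : Euc N} (hx : x ∈ Ω) :
    ‖h x‖ₑ ≤ ∫⁻ t : ℝ, Ω.indicator (fun y => ‖fderiv ℝ h y d‖ₑ) (x + t • d) := by
  by_cases hxb : x ∈ Metric.ball x₀ r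
  swap
  · rw [image_eq_zero_of_notMem_tsupport fun h' => hxb (hs h')]
    simp
  -- The parameter is reversed so that the ray corresponds to the half-line `t ≤ 0`.
  set g : ℝ → ℝ := fun t => h (x - t • d) with hg
  have hder : ∀ t, HasDerivAt g (-(fderiv ℝ h (x - t • d) d)) t := by
    intro t
    have h1 : HasDerivAt (fun t : ℝ => x - t • d) (-d) t := by
      simpa using ((hasDerivAt_id t).smul_const d).const_sub x
    have h2 := ((hh.differentiable (by simp) (x - t • d)).hasFDerivAt).comp_hasDerivAt t h1
    rwa [map_neg] at h2
  have hgc : ContDiff ℝ 1 g := hh.comp (by fun_prop)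
  have hgs : HasCompactSupport g := by
    refine hc.comp_isClosedEmbedding (g := fun t : ℝ => x - t • d) ?_
    have h1 := (isClosedEmbedding_smul_left (𝕜 := ℝ) hd0)
    exact (Homeomorph.subLeft x).isClosedEmbedding.comp h1
  have h1 := HasCompactSupport.enorm_le_lintegral_Ici_deriv hgc hgs 0
  have h2 : ‖g 0‖ₑ = ‖h x‖ₑ := by simp [hg]
  rw [h2] at h1
  refine h1.trans ?_
  rw [← lintegral_neg_eq_self (μ := (volume : Measure ℝ)) (fun t => Ω.indicator (fun y => ‖fderiv ℝ h y d‖ₑ) (x + t • d))]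
  rw [← lintegral_indicator measurableSet_Iic]
  refine lintegral_mono fun t => ?_
  by_cases ht : t ∈ Iic (0:ℝ)
  swap
  · simp [indicator_of_notMem ht]
  rw [indicator_of_mem ht, (hder t).deriv, enorm_neg, neg_smul, ← sub_eq_add_neg]
  by_cases hy : x - t • d ∈ Metric.ball x₀ r
  · have h3 : x - t • d ∈ Ω := by
      have := hd x hx hxb (-t) (by simpa using ht)
      rw [neg_smul, ← sub_eq_add_neg] at this
      exact this hy
    rw [indicator_of_mem h3]
  · have h3 : fderiv ℝ h (x - t • d) = 0 :=
      image_eq_zero_of_notMem_tsupport fun h' => hy (hs (tsupport_fderiv_subset ℝ h'))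
    simp [h3]

/-- The Gagliardo–Nirenberg exponent `N / (N - 1)`. -/
noncomputable def gnExponent (N : ℕ) : ℝ≥0∞ := N / (N - 1)

lemma one_le_gnExponent (hN : 1 ≤ N) : 1 ≤ gnExponent N := by
  rw [gnExponent, ENNReal.le_div_iff_mul_le (Or.inr (by positivity)) (Or.inr (by simp)), one_mul]
  exact tsub_le_self

lemma gnExponent_eq_ofReal (hN : 1 < N) : gnExponent N = ENNReal.ofReal (N / (N - 1)) := by
  have hN1 : (1:ℝ) < N := by exact_mod_cast hN
  rw [ENNReal.ofReal_div_of_pos (by linarith), ENNReal.ofReal_sub _ zero_le_one]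
  simp [gnExponent]

/-- In the coordinates of the basis the rays become coordinate lines, and `|h|` is bounded by the
integral of one function along each of the `N` lines. The Gagliardo–Nirenberg product inequality
`lintegral_prod_lintegral_pow_le` concludes; the linear change of variables only changes constants.
-/
lemma exists_eLpNorm_le_local (hN : 1 ≤ N) (ho : IsOpen Ω) {x₀ : Euc N} {r : ℝ}
    (b : Module.Basis (Fin N) ℝ (Euc N)) (hb : ∀ i, StableAlong Ω x₀ r (b i)) :
    ∃ C : NNReal, ∀ h : Euc N → ℝ, ContDiff ℝ 1 h → HasCompactSupport h →
      tsupport h ⊆ Metric.ball x₀ r →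
      eLpNorm h (gnExponent N) (vol Ω) ≤ C * ∫⁻ x in Ω, ‖fderiv ℝ h x‖ₑ := by
  set E : (Fin N → ℝ) ≃L[ℝ] Euc N := b.equivFunL.symm with hE
  have hEa : ∀ a, E a = ∑ i, a i • b i := fun a => b.equivFun_symm_apply a
  obtain ⟨c, hc⟩ : ∃ c : NNReal, (volume : Measure (Euc N)) = c • (volume.map E) :=
    ⟨_, Measure.isAddLeftInvariant_eq_smul _ _⟩
  obtain ⟨c', hc'⟩ : ∃ c : NNReal, (volume.map E) = c • (volume : Measure (Euc N)) :=
    ⟨_, Measure.isAddLeftInvariant_eq_smul _ _⟩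
  have hmap : ∀ G : Euc N → ℝ≥0∞, ∫⁻ x, G x ∂(volume.map E) = ∫⁻ a, G (E a) := fun G =>
    lintegral_map_equiv G E.toHomeomorph.toMeasurableEquiv
  set M : NNReal := ∑ i, ‖b i‖₊ with hM
  have hup : ∀ (a : Fin N → ℝ) i t, E (Function.update a i t) = E a + (t - a i) • b i := by
    intro a i t
    rw [hEa, hEa, ← sub_eq_iff_eq_add', ← Finset.sum_sub_distrib, Finset.sum_eq_single i]
    · simp [sub_smul]
    · intro j _ hj
      simp [Function.update_of_ne hj]
    · simp
  have key : ∀ h : Euc N → ℝ, ContDiff ℝ 1 h → HasCompactSupport h →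
      tsupport h ⊆ Metric.ball x₀ r → ∃ f : (Fin N → ℝ) → ℝ≥0∞, Measurable f ∧
      (∀ a i, E a ∈ Ω → ‖h (E a)‖ₑ ≤ ∫⁻ t, f (Function.update a i t)) ∧
      ∫⁻ a, f a = c' * M * ∫⁻ x in Ω, ‖fderiv ℝ h x‖ₑ := by
    intro h hh hcs hs
    have hm : Measurable fun y => ‖fderiv ℝ h y‖ₑ :=
      (hh.continuous_fderiv (by simp)).enorm.measurable
    refine ⟨fun a => Ω.indicator (fun y => M * ‖fderiv ℝ h y‖ₑ) (E a),
      ((hm.const_mul _).indicator ho.measurableSet).comp E.continuous.measurable,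
      fun a i ha => ?_, ?_⟩
    · refine (enorm_le_lintegral_ray (b.ne_zero i) (hb i) hh hcs hs ha).trans ?_
      simp only [hup]
      rw [lintegral_sub_right_eq_self (μ := (volume : Measure ℝ))
        (fun t => Ω.indicator (fun y => M * ‖fderiv ℝ h y‖ₑ) (E a + t • b i)) (a i)]
      refine lintegral_mono fun t => indicator_le_indicator ?_
      refine (ContinuousLinearMap.le_opENorm _ _).trans ?_
      rw [mul_comm]
      gcongr
      rw [enorm_eq_nnnorm, ENNReal.coe_le_coe]
      exact Finset.single_le_sum (f := fun i => ‖b i‖₊) (fun _ _ => zero_le) (Finset.mem_univ i)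
    · rw [← hmap, hc', lintegral_smul_measure, lintegral_indicator ho.measurableSet,
        lintegral_const_mul _ hm, mul_assoc]
      rfl
  rcases hN.eq_or_lt with h1 | h1
  · subst h1
    refine ⟨c' * M, fun h hh hcs hs => ?_⟩
    obtain ⟨f, hfm, hf, hfi⟩ := key h hh hcs hs
    -- In dimension one the exponent is `1 / 0 = ⊤`, and the line integral itself is the supremum
    -- bound.
    have hexp : gnExponent 1 = ⊤ := by simp [gnExponent]
    rw [hexp, eLpNorm_exponent_top]
    refine eLpNormEssSup_le_of_ae_enorm_bound ?_
    filter_upwards [ae_restrict_mem ho.measurableSet] with x hx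
    obtain ⟨a, rfl⟩ := E.surjective x
    refine (hf a 0 hx).trans ?_
    have h2 := (volume_preserving_funUnique (Fin 1) ℝ).symm.lintegral_comp hfm
    rw [ENNReal.coe_mul, ← hfi]
    refine le_trans ?_ h2.le
    refine lintegral_mono fun t => le_of_eq ?_
    congr 1
    ext j
    rw [Subsingleton.elim j 0, Function.update_self]
    rfl
  · have hN1 : (1:ℝ) < N := by exact_mod_cast h1
    set p : ℝ := N / (N - 1) with hp
    have hp0 : 0 < p := div_pos (by linarith) (by linarith)
    have hconj : Real.HolderConjugate (Fintype.card (Fin N)) p := by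
      rw [Fintype.card_fin]
      exact Real.HolderConjugate.conjExponent hN1
    have hexp : gnExponent N = ENNReal.ofReal p := gnExponent_eq_ofReal h1
    refine ⟨c ^ (1 / p) * (c' * M), fun h hh hcs hs => ?_⟩
    obtain ⟨f, hfm, hf, hfi⟩ := key h hh hcs hs
    have h2 : ∫⁻ x in Ω, ‖h x‖ₑ ^ p ≤ c * (∫⁻ a, f a) ^ p := by
      rw [← lintegral_indicator ho.measurableSet]
      conv_lhs => rw [hc]
      rw [lintegral_smul_measure, hmap]
      refine mul_le_mul_right (le_trans (lintegral_mono fun a => ?_)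
        (lintegral_prod_lintegral_pow_le (fun _ : Fin N => (volume : Measure ℝ)) hconj hfm)) _
      by_cases ha : E a ∈ Ω
      swap
      · rw [indicator_of_notMem ha]; exact zero_le
      rw [indicator_of_mem ha]
      have h3 : ‖h (E a)‖ₑ ^ p = ∏ i : Fin N, ‖h (E a)‖ₑ ^ ((1:ℝ) / (Fintype.card (Fin N) - 1 : ℝ)) := by
        rw [Finset.prod_const, Finset.card_univ, Fintype.card_fin, ← ENNReal.rpow_natCast,
          ← ENNReal.rpow_mul]
        congr 1
        rw [hp]; ring
      rw [h3]
      refine Finset.prod_le_prod' fun i _ => ENNReal.rpow_le_rpow (hf a i ha) ?_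
      rw [Fintype.card_fin]
      exact div_nonneg zero_le_one (by linarith)
    rw [hexp, eLpNorm_eq_lintegral_rpow_enorm_toReal (by simpa using hp0) (by simp),
      ENNReal.toReal_ofReal hp0.le]
    refine (ENNReal.rpow_le_rpow h2 (by positivity)).trans ?_
    rw [ENNReal.mul_rpow_of_nonneg _ _ (by positivity), ← ENNReal.rpow_mul, mul_one_div_cancel hp0.ne',
      ENNReal.rpow_one, hfi, ENNReal.coe_mul, ENNReal.coe_mul, ENNReal.coe_rpow_of_nonneg _ (by positivity)]
    exact le_of_eq (by ring)

theorem exists_eLpNorm_le_lintegral (hN : 1 ≤ N) (ho : IsOpen Ω) (hbd : Bornology.IsBounded Ω)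
    (hlip : HasLipschitzBoundary Ω) :
    ∃ C : NNReal, ∀ h : Euc N → ℝ, ContDiff ℝ 1 h →
      eLpNorm h (gnExponent N) (vol Ω) ≤ C * ∫⁻ x in Ω, (‖h x‖ₑ + ‖fderiv ℝ h x‖ₑ) := by
  have h1 : ∀ x₀ ∈ closure Ω, ∃ r > 0, ∃ C : NNReal, ∀ h : Euc N → ℝ, ContDiff ℝ 1 h →
      HasCompactSupport h → tsupport h ⊆ Metric.ball x₀ r →
      eLpNorm h (gnExponent N) (vol Ω) ≤ C * ∫⁻ x in Ω, ‖fderiv ℝ h x‖ₑ := by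
    intro x₀ hx₀
    obtain ⟨r, hr, b, hb⟩ := exists_basis_stableAlong ho hlip hx₀
    exact ⟨r, hr, exists_eLpNorm_le_local hN ho b hb⟩
  choose! r hr C hC using h1
  obtain ⟨s, χ, hs, hχ, hsum⟩ := exists_finset_partition
    (Metric.isCompact_of_isClosed_isBounded isClosed_closure hbd.closure)
    (U := fun x => Metric.ball x (r x))
    fun x hx => ⟨Metric.isOpen_ball, Metric.mem_ball_self (hr x hx), Metric.isBounded_ball⟩
  have hbound : ∀ j ∈ s, ∃ M : NNReal, ∀ x, ‖χ j x‖ₑ ≤ M ∧ ‖fderiv ℝ (χ j) x‖ₑ ≤ M := fun j hj => by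
    obtain ⟨M, hM⟩ := (hχ j hj).1.continuous.bounded_above_of_compact_support (hχ j hj).2.2.1
    obtain ⟨M', hM'⟩ := ((hχ j hj).1.continuous_fderiv (by simp)).bounded_above_of_compact_support
      ((hχ j hj).2.2.1.fderiv ℝ)
    refine ⟨(max M M').toNNReal, fun x => ⟨?_, ?_⟩⟩
    · rw [← ofReal_norm]
      exact ENNReal.ofReal_le_ofReal ((hM x).trans (le_max_left _ _))
    · rw [← ofReal_norm]
      exact ENNReal.ofReal_le_ofReal ((hM' x).trans (le_max_right _ _))
  choose! M hM using hbound
  refine ⟨∑ j ∈ s, C j * M j, fun h hh => ?_⟩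
  have h2 : eLpNorm h (gnExponent N) (vol Ω) =
      eLpNorm (∑ j ∈ s, fun x => χ j x * h x) (gnExponent N) (vol Ω) := by
    refine eLpNorm_congr_ae ?_
    filter_upwards [ae_restrict_mem ho.measurableSet] with x hx
    rw [Finset.sum_apply, ← Finset.sum_mul, hsum x (subset_closure hx), one_mul]
  have h3 : ∀ j ∈ s, ContDiff ℝ 1 fun x => χ j x * h x := fun j hj =>
    ((hχ j hj).1.of_le (by simp)).mul hh
  rw [h2, ENNReal.ofNNReal_finsetSum, Finset.sum_mul]
  refine (eLpNorm_sum_le (fun j hj => (h3 j hj).continuous.aestronglyMeasurable)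
    (one_le_gnExponent hN)).trans (Finset.sum_le_sum fun j hj => ?_)
  refine (hC j (hs j hj) _ (h3 j hj) (hχ j hj).2.2.1.mul_right
    ((tsupport_mul_subset_left).trans (hχ j hj).2.1)).trans ?_
  rw [ENNReal.coe_mul, mul_assoc]
  refine mul_le_mul_right ?_ _
  rw [← lintegral_const_mul _ (by
    have := hh.continuous
    have := hh.continuous_fderiv (by simp)
    fun_prop)]
  refine lintegral_mono fun x => ?_
  rw [fderiv_fun_mul ((hχ j hj).1.differentiable (by simp) x) (hh.differentiable (by simp) x)]
  refine (enorm_add_le (χ j x • fderiv ℝ h x) (h x • fderiv ℝ (χ j) x)).trans ?_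
  rw [enorm_smul, enorm_smul, add_comm, mul_add]
  refine add_le_add ?_ ?_
  · rw [mul_comm]
    exact mul_le_mul_left (hM j hj x).2 _
  · exact mul_le_mul_left (hM j hj x).1 _

lemma memLp_of_continuous (hbd : Bornology.IsBounded Ω) {F : Type*} [NormedAddCommGroup F]
    [SecondCountableTopology F] {φ : Euc N → F} (hφ : Continuous φ) (P : ℝ≥0∞) :
    MemLp φ P (vol Ω) := by
  have hK := Metric.isCompact_of_isClosed_isBounded isClosed_closure hbd.closure
  obtain ⟨M, hM⟩ := hK.exists_bound_of_continuousOn hφ.continuousOn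
  have : IsFiniteMeasure (vol Ω) := ⟨by simpa using hbd.measure_lt_top⟩
  refine MemLp.of_bound hφ.aestronglyMeasurable M ?_
  have h1 : ∀ᵐ x ∂vol (closure Ω), ‖φ x‖ ≤ M := by
    filter_upwards [ae_restrict_mem isClosed_closure.measurableSet] with x hx using hM x hx
  exact ae_mono (Measure.restrict_mono_set _ subset_closure) h1

/-- The Gagliardo–Nirenberg trick: apply the `W^{1,1}` estimate to `|φ|^q`. -/
theorem exists_eLpNorm_le_eLpNorm (hN : 1 ≤ N) (ho : IsOpen Ω) (hbd : Bornology.IsBounded Ω)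
    (hlip : HasLipschitzBoundary Ω) {q : NNReal} (hq : 1 < q)
    (hqN : ENNReal.ofReal (2 * (q - 1)) ≤ gnExponent N * ENNReal.ofReal q) :
    ∃ C : NNReal, ∀ φ : Euc N → ℝ, ContDiff ℝ 1 φ →
      eLpNorm φ (gnExponent N * ENNReal.ofReal q) (vol Ω) ≤
        C * (eLpNorm φ 2 (vol Ω) + eLpNorm (fderiv ℝ φ) 2 (vol Ω)) := by
  have hq' : (1:ℝ) < q := hq
  obtain ⟨C, hC⟩ := exists_eLpNorm_le_lintegral hN ho hbd hlip
  set P := gnExponent N * ENNReal.ofReal q with hP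
  -- Power of the volume in the inclusion of `L^P` into `L^{2(q-1)}`. For `P = ⊤` the term `1 /
  -- P.toReal` is `1 / 0 = 0`, which is the correct value.
  set κ : ℝ := 1 / (ENNReal.ofReal (2 * (q - 1))).toReal - 1 / P.toReal with hκ
  have hκ0 : 0 ≤ κ := by
    rw [hκ, ENNReal.toReal_ofReal (by linarith), sub_nonneg]
    rcases eq_or_ne P ⊤ with h | h
    · rw [h]
      simp only [ENNReal.toReal_top, _root_.div_zero]
      exact one_div_nonneg.2 (by linarith)
    · have h1 := ENNReal.toReal_mono h hqN
      rw [ENNReal.toReal_ofReal (by linarith)] at h1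
      exact one_div_le_one_div_of_le (by linarith) h1
  have hfin : volume Ω ^ κ ≠ ⊤ := ENNReal.rpow_ne_top_of_nonneg hκ0 hbd.measure_lt_top.ne
  set K : NNReal := (volume Ω ^ κ).toNNReal with hK
  have hKc : (K : ℝ≥0∞) = volume Ω ^ κ := ENNReal.coe_toNNReal hfin
  refine ⟨C * (q * K ^ ((q:ℝ) - 1)), fun φ hφ => ?_⟩
  set A := eLpNorm φ 2 (vol Ω) + eLpNorm (fderiv ℝ φ) 2 (vol Ω) with hA
  have hcφ := hφ.continuous
  have hcd := hφ.continuous_fderiv (by simp)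
  set a := eLpNorm φ P (vol Ω) with ha
  have ha_top : a ≠ ⊤ := (memLp_of_continuous hbd hcφ P).2.ne
  have h1 := hC _ (hφ.norm_rpow hq')
  rw [eLpNorm_norm_rpow _ (by linarith)] at h1
  -- Cauchy–Schwarz, with the factor `|φ|^(q-1)` measured in `L²`, that is, `φ` in `L^{2(q-1)}`.
  have hCS : ∀ g : Euc N → ℝ≥0∞, Measurable g →
      ∫⁻ x in Ω, ‖φ x‖ₑ ^ ((q:ℝ) - 1) * g x ≤
        (a * K) ^ ((q:ℝ) - 1) * (∫⁻ x in Ω, g x ^ (2:ℝ)) ^ (1 / (2:ℝ)) := by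
    intro g hg
    refine (ENNReal.lintegral_mul_le_Lp_mul_Lq (vol Ω) Real.HolderConjugate.two_two
      (by fun_prop) hg.aemeasurable).trans ?_
    refine mul_le_mul_left ?_ _
    have h2 := eLpNorm_le_eLpNorm_mul_rpow_measure_univ (μ := vol Ω) hqN
      hcφ.aestronglyMeasurable
    rw [Measure.restrict_apply_univ, ← hκ, ← hKc] at h2
    refine le_trans (le_of_eq ?_) (ENNReal.rpow_le_rpow h2 (by linarith))
    rw [eLpNorm_eq_lintegral_rpow_enorm_toReal (by simpa using hq') ENNReal.ofReal_ne_top,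
      ENNReal.toReal_ofReal (by linarith), ← ENNReal.rpow_mul]
    congr 1
    · refine lintegral_congr fun x => ?_
      rw [← ENNReal.rpow_mul]
      congr 1
      ring
    · have : (q:ℝ) - 1 ≠ 0 := by linarith
      field_simp
  have h2 : ∫⁻ x in Ω, (‖‖φ x‖ ^ (q:ℝ)‖ₑ + ‖fderiv ℝ (fun x => ‖φ x‖ ^ (q:ℝ)) x‖ₑ) ≤
      q * ((a * K) ^ ((q:ℝ) - 1) * A) := by
    have h3 : ∀ x, ‖‖φ x‖ ^ (q:ℝ)‖ₑ + ‖fderiv ℝ (fun x => ‖φ x‖ ^ (q:ℝ)) x‖ₑ ≤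
        q * (‖φ x‖ₑ ^ ((q:ℝ) - 1) * ‖φ x‖ₑ + ‖φ x‖ₑ ^ ((q:ℝ) - 1) * ‖fderiv ℝ φ x‖ₑ) := by
      intro x
      rw [mul_add]
      refine add_le_add ?_ ?_
      · have h4 : ‖‖φ x‖ ^ (q:ℝ)‖ₑ = ‖φ x‖ₑ ^ ((q:ℝ) - 1) * ‖φ x‖ₑ := by
          rw [← ofReal_norm, Real.norm_of_nonneg (by positivity), ← ofReal_norm (φ x),
            ENNReal.ofReal_rpow_of_nonneg (norm_nonneg _) (by linarith),
            ← ENNReal.ofReal_mul (by positivity)]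
          congr 1
          rcases eq_or_ne (‖φ x‖) 0 with h0 | h0
          · rw [h0, Real.zero_rpow (by linarith), mul_zero]
          · rw [Real.rpow_sub_one h0, div_mul_cancel₀ _ h0]
        rw [h4]
        refine le_mul_of_one_le_left zero_le ?_
        exact_mod_cast hq.le
      · rw [← mul_assoc]
        exact enorm_fderiv_norm_rpow_le (hφ.differentiable (by simp)) hq
    refine (lintegral_mono h3).trans ?_
    rw [lintegral_const_mul _ (by fun_prop)]
    refine mul_le_mul_right ?_ _
    rw [lintegral_add_left (by fun_prop), hA, mul_add]
    refine add_le_add ((hCS _ (by fun_prop)).trans (le_of_eq ?_))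
      ((hCS _ (by fun_prop)).trans (le_of_eq ?_))
    · rw [eLpNorm_eq_lintegral_rpow_enorm_toReal (by simp) (by simp), ENNReal.toReal_ofNat]
    · rw [eLpNorm_eq_lintegral_rpow_enorm_toReal (by simp) (by simp), ENNReal.toReal_ofNat]
  -- The estimate has `a ^ q` on the left and `a ^ (q - 1)` on the right. Cancelling requires `a` to
  -- be nonzero and finite; finiteness holds because `φ` is bounded on `Ω`.
  rcases eq_or_ne a 0 with h0 | h0
  · rw [h0]; exact zero_le
  have h3 := h1.trans (mul_le_mul_right h2 _)
  have h4 : a ^ ((q:ℝ) - 1) ≠ 0 := by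
    simp [ENNReal.rpow_eq_zero_iff, h0, ha_top]
  have h5 : a ^ ((q:ℝ) - 1) ≠ ⊤ := ENNReal.rpow_ne_top_of_nonneg (by linarith) ha_top
  rw [← ENNReal.mul_le_mul_iff_right h4 h5]
  calc a ^ ((q:ℝ) - 1) * a = a ^ (q:ℝ) := by
        nth_rw 2 [← ENNReal.rpow_one a]
        rw [← ENNReal.rpow_add _ _ h0 ha_top, sub_add_cancel]
    _ ≤ _ := h3
    _ = _ := by
        rw [ENNReal.mul_rpow_of_nonneg _ _ (by linarith), ENNReal.coe_mul, ENNReal.coe_mul,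
          ENNReal.coe_rpow_of_nonneg _ (by linarith)]
        ring

/-- The smooth functions in the definition of the trace approximate `v` in `H¹`. Fatou along an
almost everywhere convergent subsequence carries the estimate to `v`, up to an `ε` in the norms that
is finally removed. -/
theorem exists_eLpNorm_fnV_le (hN : 1 ≤ N) {ΓD ΓN : Set (Euc N)} (hΩ : IsMixedDomain Ω ΓD ΓN)
    {q : NNReal} (hq : 1 < q)
    (hqN : ENNReal.ofReal (2 * (q - 1)) ≤ gnExponent N * ENNReal.ofReal q) {P : ℝ≥0∞}
    (hP : P ≤ gnExponent N * ENNReal.ofReal q) :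
    ∃ C : NNReal, ∀ v : SpaceV Ω ΓD, eLpNorm (fnV v) P (vol Ω) ≤ C * ENNReal.ofReal ‖v‖ := by
  have hfin : IsFiniteMeasure (vol Ω) := ⟨by simpa using hΩ.isBounded.measure_lt_top⟩
  obtain ⟨C, hC⟩ := exists_eLpNorm_le_eLpNorm hN hΩ.isOpen hΩ.isBounded hΩ.lipschitz hq hqN
  obtain ⟨C', hC'⟩ : ∃ C' : NNReal, ∀ w : Euc N → ℝ, AEStronglyMeasurable w (vol Ω) →
      eLpNorm w P (vol Ω) ≤ C' * eLpNorm w (gnExponent N * ENNReal.ofReal q) (vol Ω) := by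
    set κ : ℝ := 1 / P.toReal - 1 / (gnExponent N * ENNReal.ofReal q).toReal with hκ
    rcases eq_or_ne P 0 with h0 | h0
    · exact ⟨0, fun w _ => by simp [h0]⟩
    have hκ0 : 0 ≤ κ := by
      rw [hκ, sub_nonneg]
      rcases eq_or_ne (gnExponent N * ENNReal.ofReal q) ⊤ with h | h
      · rw [h]
        simp
      · exact one_div_le_one_div_of_le (ENNReal.toReal_pos h0 (ne_top_of_le_ne_top h hP))
          (ENNReal.toReal_mono h hP)
    have htop : vol Ω univ ^ κ ≠ ⊤ := ENNReal.rpow_ne_top_of_nonneg hκ0 (measure_ne_top _ _)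
    refine ⟨(vol Ω univ ^ κ).toNNReal, fun w hw => ?_⟩
    rw [ENNReal.coe_toNNReal htop, mul_comm]
    exact eLpNorm_le_eLpNorm_mul_rpow_measure_univ hP hw
  refine ⟨C' * (C * (1 + N)), fun v => ?_⟩
  obtain ⟨g, ⟨-, φ, hφ, hφ0, hφ1, -⟩, -⟩ := v.2
  have hm := fun n => (hφ n).continuous.aestronglyMeasurable (μ := vol Ω)
  have hmi : ∀ i n, AEStronglyMeasurable (fun x => fderiv ℝ (φ n) x (stdVec i)) (vol Ω) :=
    fun i n => (continuous_partial (hφ n)).aestronglyMeasurable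
  obtain ⟨ns, hns, hae⟩ := (tendstoInMeasure_of_tendsto_eLpNorm (by simp) hm
    (Lp.aestronglyMeasurable (fnV v)) hφ0).exists_seq_tendsto_ae
  have hlim := Lp.eLpNorm_lim_le_liminf_eLpNorm (p := P) (fun n => hm (ns n)) _ hae
  have hnorm : ∀ (a : ℕ → Euc N → ℝ) (b : L2 Ω), (∀ n, AEStronglyMeasurable (a n) (vol Ω)) →
      Tendsto (fun n => eLpNorm (fun x => a n x - b x) 2 (vol Ω)) atTop (𝓝 0) → ‖b‖ ≤ ‖v‖ →
      ∀ ε : ℝ≥0∞, 0 < ε → ∀ᶠ n in atTop, eLpNorm (a n) 2 (vol Ω) ≤ ENNReal.ofReal ‖v‖ + ε := by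
    intro a b ha hab hb ε hε
    filter_upwards [hab.eventually_lt_const hε] with n hn
    have h1 : eLpNorm (a n) 2 (vol Ω) =
        eLpNorm ((b : Euc N → ℝ) + fun x => a n x - b x) 2 (vol Ω) := by
      congr 1
      ext x
      simp
    rw [h1]
    refine (eLpNorm_add_le (Lp.aestronglyMeasurable b) ((ha n).sub (Lp.aestronglyMeasurable b))
      (by norm_num)).trans (add_le_add ?_ hn.le)
    rw [← Lp.enorm_def, ← ofReal_norm]
    exact ENNReal.ofReal_le_ofReal hb
  have hsq := norm_sq_H1 v.1
  have hn0 : ‖fnV v‖ ≤ ‖v‖ := by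
    refine abs_le_of_sq_le_sq' ?_ (norm_nonneg _) |>.2
    change ‖fnH1 v.1‖ ^ 2 ≤ ‖v.1‖ ^ 2
    rw [hsq]
    exact le_add_of_nonneg_right (Finset.sum_nonneg fun i _ => sq_nonneg _)
  have hni : ∀ i, ‖dH1 v.1 i‖ ≤ ‖v‖ := by
    intro i
    refine abs_le_of_sq_le_sq' ?_ (norm_nonneg _) |>.2
    change ‖dH1 v.1 i‖ ^ 2 ≤ ‖v.1‖ ^ 2
    rw [hsq]
    exact le_add_of_nonneg_of_le (sq_nonneg _)
      (Finset.single_le_sum (f := fun i => ‖dH1 v.1 i‖ ^ 2) (fun i _ => sq_nonneg _)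
        (Finset.mem_univ i))
  have hder : ∀ n, eLpNorm (fderiv ℝ (φ n)) 2 (vol Ω) ≤
      ∑ i, eLpNorm (fun x => fderiv ℝ (φ n) x (stdVec i)) 2 (vol Ω) := by
    intro n
    have h1 : eLpNorm (fderiv ℝ (φ n)) 2 (vol Ω) ≤
        eLpNorm (∑ i, fun x => ‖fderiv ℝ (φ n) x (stdVec i)‖) 2 (vol Ω) := by
      refine eLpNorm_mono_real fun x => ?_
      rw [Finset.sum_apply]
      refine abs_le_of_sq_le_sq' ?_ (Finset.sum_nonneg fun i _ => norm_nonneg _) |>.2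
      rw [norm_sq_functional]
      have h2 := Finset.sum_sq_le_sq_sum_of_nonneg (s := Finset.univ)
        (f := fun i => ‖fderiv ℝ (φ n) x (stdVec i)‖) fun i _ => norm_nonneg _
      simpa using h2
    refine h1.trans ((eLpNorm_sum_le (fun i _ => (hmi i n).norm) (by norm_num)).trans
      (Finset.sum_le_sum fun i _ => ?_))
    exact (eLpNorm_norm _).le
  have hε : ∀ ε : ℝ≥0∞, 0 < ε →
      eLpNorm (fnV v) P (vol Ω) ≤ (C' * (C * (1 + N)) : NNReal) * (ENNReal.ofReal ‖v‖ + ε) := by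
    intro ε hε
    refine hlim.trans (liminf_le_of_frequently_le' (Eventually.frequently ?_))
    have h1 := hnorm φ (fnV v) hm hφ0 hn0 ε hε
    have h2 := eventually_all.2 fun i => hnorm (fun n x => fderiv ℝ (φ n) x (stdVec i))
      (dH1 v.1 i) (hmi i) (hφ1 i) (hni i) ε hε
    refine hns.tendsto_atTop.eventually (p := fun n => eLpNorm (φ n) P (vol Ω) ≤
      (C' * (C * (1 + N)) : NNReal) * (ENNReal.ofReal ‖v‖ + ε)) ((h1.and h2).mono fun n hn => ?_)
    refine (hC' _ (hm n)).trans ?_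
    rw [ENNReal.coe_mul, mul_assoc]
    refine mul_le_mul_right ((hC _ ((hφ n).of_le (by simp))).trans ?_) _
    rw [ENNReal.coe_mul, mul_assoc]
    refine mul_le_mul_right ?_ _
    rw [ENNReal.coe_add, ENNReal.coe_one, ENNReal.coe_natCast, add_mul, one_mul]
    refine add_le_add hn.1 ((hder n).trans ?_)
    refine (Finset.sum_le_sum fun i _ => hn.2 i).trans (le_of_eq ?_)
    rw [Finset.sum_const, Finset.card_univ, Fintype.card_fin, nsmul_eq_mul]
  have hcont : Tendsto (fun ε : ℝ≥0∞ => ((C' * (C * (1 + N)) : NNReal) : ℝ≥0∞) *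
      (ENNReal.ofReal ‖v‖ + ε)) (𝓝[>] 0) (𝓝 ((C' * (C * (1 + N)) : NNReal) *
      (ENNReal.ofReal ‖v‖ + 0))) :=
    (ENNReal.Tendsto.const_mul (tendsto_const_nhds.add tendsto_id)
      (Or.inr ENNReal.coe_ne_top)).mono_left nhdsWithin_le_nhds
  rw [add_zero] at hcont
  exact ge_of_tendsto hcont (eventually_mem_nhdsWithin.mono fun ε h => hε ε h)

/-- The Sobolev embedding `V ⊆ L^{2p'}(Ω)`. -/
theorem exists_sobolev (hN : 1 ≤ N) {ΓD ΓN : Set (Euc N)} (hΩ : IsMixedDomain Ω ΓD ΓN)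
    {p : ℝ≥0∞} (hp1 : 1 ≤ p) (hp2 : N = 2 → 1 < p) (hp : N ≠ 2 → p = max 1 ((N : ℝ≥0∞) / 2)) :
    ∃ P P' : ℝ≥0∞, ENNReal.HolderTriple P P P' ∧ ENNReal.HolderTriple p P' 1 ∧
      ∃ C : NNReal, ∀ v : SpaceV Ω ΓD, eLpNorm (fnV v) P (vol Ω) ≤ C * ENNReal.ofReal ‖v‖ := by
  have h1 : ENNReal.HolderTriple p (1 + (p - 1)⁻¹) 1 := ENNReal.HolderConjugate.conjExponent hp1
  -- `P'` is the conjugate exponent of `p`, and `P = 2P'`, so that products of two `L^P` functions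
  -- pair with `σ(t)`.
  refine ⟨2 * (1 + (p - 1)⁻¹), 1 + (p - 1)⁻¹, ⟨?_⟩, h1, ?_⟩
  · rw [ENNReal.mul_inv (by simp) (by simp), ← add_mul, ENNReal.inv_two_add_inv_two, one_mul]
  suffices h : ∃ q : NNReal, 1 < q ∧
      ENNReal.ofReal (2 * (q - 1)) ≤ gnExponent N * ENNReal.ofReal q ∧
      2 * (1 + (p - 1)⁻¹) ≤ gnExponent N * ENNReal.ofReal q by
    obtain ⟨q, h2, h3, h4⟩ := h
    exact exists_eLpNorm_fnV_le hN hΩ h2 h3 h4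
  rcases hN.eq_or_lt with rfl | hN1
  · refine ⟨2, by norm_num, ?_, ?_⟩ <;> simp [gnExponent, ENNReal.top_mul]
  rw [gnExponent_eq_ofReal hN1]
  rcases Nat.lt_or_ge 2 N with hN2 | hN2
  · have hN2' : (2:ℝ) < N := by exact_mod_cast hN2
    have hN3 : (3:ℝ) ≤ N := by exact_mod_cast hN2
    have hpe : p = ENNReal.ofReal (max 1 (N / 2)) := by
      rw [hp (by omega), ENNReal.ofReal_max, ENNReal.ofReal_one,
        ENNReal.ofReal_div_of_pos (by norm_num)]
      simp
    have hm : max 1 ((N:ℝ) / 2) = N / 2 := max_eq_right (by linarith)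
    have hq : (0:ℝ) ≤ 2 * (N - 1) / (N - 2) := div_nonneg (by linarith) (by linarith)
    -- This `q` makes `2(q - 1)`, `qN/(N - 1)` and `2p'` all equal to the critical exponent `2N/(N -
    -- 2)`.
    refine ⟨(⟨2 * (N - 1) / (N - 2), hq⟩ : NNReal), ?_, ?_, ?_⟩
    · refine NNReal.coe_lt_coe.1 ?_
      change (1:ℝ) < 2 * (N - 1) / (N - 2)
      rw [lt_div_iff₀ (by linarith)]
      linarith
    · change ENNReal.ofReal (2 * (2 * (N - 1) / (N - 2) - 1)) ≤
        _ * ENNReal.ofReal (2 * (N - 1) / (N - 2))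
      rw [← ENNReal.ofReal_mul (div_nonneg (by linarith) (by linarith))]
      refine ENNReal.ofReal_le_ofReal (le_of_eq ?_)
      have : (N:ℝ) - 1 ≠ 0 := by linarith
      have : (N:ℝ) - 2 ≠ 0 := by linarith
      field_simp
      ring
    · change _ ≤ _ * ENNReal.ofReal (2 * (N - 1) / (N - 2))
      rw [← ENNReal.ofReal_mul (div_nonneg (by linarith) (by linarith)), hpe, hm,
        ← ENNReal.ofReal_one, ← ENNReal.ofReal_sub _ zero_le_one,
        ← ENNReal.ofReal_inv_of_pos (by linarith), ← ENNReal.ofReal_add zero_le_one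
        (inv_nonneg.2 (by linarith)), ← ENNReal.ofReal_ofNat, ← ENNReal.ofReal_mul (by norm_num)]
      refine ENNReal.ofReal_le_ofReal (le_of_eq ?_)
      have : (N:ℝ) - 1 ≠ 0 := by linarith
      have : (N:ℝ) - 2 ≠ 0 := by linarith
      have : (N:ℝ) / 2 - 1 ≠ 0 := by linarith
      have h5 : (N:ℝ) / 2 - 1 = (N - 2) / 2 := by ring
      rw [h5]
      field_simp
      ring
  · obtain rfl : N = 2 := by omega
    have h7 : ((2:ℕ):ℝ) / (((2:ℕ):ℝ) - 1) = 2 := by norm_num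
    rw [h7]
    have h5 : 1 + (p - 1)⁻¹ ≠ ⊤ := by
      simpa [ENNReal.inv_eq_top, tsub_eq_zero_iff_le] using hp2 rfl
    -- In the plane the exponent reached is `2q`, with `q` arbitrarily large; it must cover `2p'`,
    -- which is finite because `p > 1`.
    refine ⟨max 2 (1 + (p - 1)⁻¹).toNNReal, lt_max_of_lt_left (by norm_num), ?_, ?_⟩
    · rw [← ENNReal.ofReal_mul (by norm_num)]
      exact ENNReal.ofReal_le_ofReal (by linarith)
    · rw [ENNReal.ofReal_ofNat, ENNReal.ofReal_coe_nnreal]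
      refine mul_le_mul_right ?_ _
      rw [ENNReal.coe_max, ENNReal.coe_toNNReal h5]
      exact le_max_right _ _

end sobolev

/-! ### Growth and semiconvexity of the primitive of `γ` -/

section primitive

variable {γ γhat : ℝ → ℝ} (hγhat : ∀ s, HasDerivAt γhat (γ s) s)
include hγhat

lemma abs_primitive_sub_le {C₁ : ℝ} (hγC : ∀ s : ℝ, |γ s| ≤ C₁ * (|s| + 1)) (a b : ℝ) :
    |γhat a - γhat b| ≤ C₁ * ((1 + |a| + |b|) * |a - b|) := by
  have hC : 0 ≤ C₁ := by
    have h1 := (abs_nonneg _).trans (hγC 0)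
    simpa using h1
  have h := (convex_uIcc b a).norm_image_sub_le_of_norm_hasDerivWithin_le
    (f := γhat) (f' := γ) (C := C₁ * (1 + |a| + |b|))
    (fun x _ => (hγhat x).hasDerivWithinAt) (fun x hx => ?_) left_mem_uIcc right_mem_uIcc
  · rw [Real.norm_eq_abs, Real.norm_eq_abs, mul_assoc] at h
    exact h
  · refine (hγC x).trans (mul_le_mul_of_nonneg_left ?_ hC)
    have h1 : |x| ≤ max |b| |a| := by
      rcases mem_uIcc.1 hx with h | h
      · exact abs_le_max_abs_abs h.1 h.2
      · rw [max_comm]; exact abs_le_max_abs_abs h.1 h.2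
    have h2 := max_le_add_of_nonneg (abs_nonneg b) (abs_nonneg a)
    linarith

/-- The derivative of `γhat s + L / 2 * s ^ 2` is monotone, so this function lies above its
tangents. -/
lemma primitive_sub_ge {L : ℝ} (hγL : ∀ t s : ℝ, 0 ≤ (γ t - γ s) * (t - s) + L * |t - s| ^ 2)
    (a b : ℝ) : γ a * (b - a) - L / 2 * (b - a) ^ 2 ≤ γhat b - γhat a := by
  have hg : ∀ s, HasDerivAt (fun s => γhat s + L / 2 * s ^ 2) (γ s + L * s) s := by
    intro s
    refine ((hγhat s).add (((hasDerivAt_id s).pow 2).const_mul (L / 2))).congr_deriv ?_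
    simp; ring
  have hcont : Continuous fun s => γhat s + L / 2 * s ^ 2 :=
    continuous_iff_continuousAt.2 fun s => (hg s).continuousAt
  have hmono : ∀ t s : ℝ, 0 ≤ ((γ t + L * t) - (γ s + L * s)) * (t - s) := by
    intro t s
    have := hγL t s
    rw [sq_abs] at this
    nlinarith
  have key : (γ a + L * a) * (b - a) ≤
      (γhat b + L / 2 * b ^ 2) - (γhat a + L / 2 * a ^ 2) := by
    rcases lt_trichotomy a b with h | h | h
    · obtain ⟨c, hc, hc'⟩ := exists_hasDerivAt_eq_slope _ _ h hcont.continuousOn fun x _ => hg x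
      rw [eq_div_iff (sub_pos.2 h).ne'] at hc'
      have h1 := nonneg_of_mul_nonneg_left (hmono c a) (sub_pos.2 hc.1)
      rw [← hc']
      exact mul_le_mul_of_nonneg_right (by linarith) (sub_pos.2 h).le
    · simp [h]
    · obtain ⟨c, hc, hc'⟩ := exists_hasDerivAt_eq_slope _ _ h hcont.continuousOn fun x _ => hg x
      rw [eq_div_iff (sub_pos.2 h).ne'] at hc'
      have h1 := nonneg_of_mul_nonneg_left (hmono a c) (sub_pos.2 hc.2)
      nlinarith [mul_nonneg h1 (sub_pos.2 h).le]
  nlinarith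

end primitive

/-! ### Superposition with the primitive between Lebesgue spaces -/

section nemytskii

variable {α : Type*} [MeasurableSpace α] {μ : Measure α} [IsFiniteMeasure μ] {P P' : ℝ≥0∞}
  {γ γhat : ℝ → ℝ} (hγhat : ∀ s, HasDerivAt γhat (γ s) s) {C₁ : ℝ}
  (hγC : ∀ s : ℝ, |γ s| ≤ C₁ * (|s| + 1))

include hγhat hγC

/-- The increment is bounded by a linear factor times the difference, so Hölder halves the exponent.
-/
lemma memLp_primitive_sub [ENNReal.HolderTriple P P P'] {a b : α → ℝ} (ha : MemLp a P μ)
    (hb : MemLp b P μ) : MemLp (fun x => γhat (a x) - γhat (b x)) P' μ := by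
  have hc : Continuous γhat := continuous_iff_continuousAt.2 fun s => (hγhat s).continuousAt
  have h1 : MemLp (fun x => C₁ * ((1 + |a x| + |b x|) * |a x - b x|)) P' μ :=
    MemLp.const_mul (MemLp.mul (p := P) (q := P) (r := P') (f := fun x => |a x - b x|)
      (φ := fun x => 1 + |a x| + |b x|) (ha.sub hb).abs
      (((memLp_const (1:ℝ)).add ha.abs).add hb.abs)) C₁
  refine h1.mono' ((hc.comp_aestronglyMeasurable ha.1).sub (hc.comp_aestronglyMeasurable hb.1))
    (Eventually.of_forall fun x => ?_)
  exact abs_primitive_sub_le hγhat hγC _ _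

lemma memLp_primitive [ENNReal.HolderTriple P P P'] {a : α → ℝ} (ha : MemLp a P μ) :
    MemLp (fun x => γhat (a x)) P' μ := by
  have h1 := (memLp_primitive_sub (P' := P') hγhat hγC ha (memLp_const (0:ℝ))).add
    (memLp_const (γhat 0))
  refine h1.congr_norm ?_ ?_
  · have hc : Continuous γhat := continuous_iff_continuousAt.2 fun s => (hγhat s).continuousAt
    exact hc.comp_aestronglyMeasurable ha.1
  · exact Eventually.of_forall fun x => by simp

lemma eLpNorm_primitive_sub_le [ENNReal.HolderTriple P P P'] (hP : 1 ≤ P) {a b : α → ℝ}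
    (ha : MemLp a P μ) (hb : MemLp b P μ) :
    eLpNorm (fun x => γhat (a x) - γhat (b x)) P' μ ≤ ENNReal.ofReal C₁ *
      ((eLpNorm (fun _ => (1:ℝ)) P μ + eLpNorm a P μ + eLpNorm b P μ) *
        eLpNorm (fun x => a x - b x) P μ) := by
  have hC : 0 ≤ C₁ := by
    have h1 := (abs_nonneg _).trans (hγC 0)
    simpa using h1
  have h1 : eLpNorm (fun x => γhat (a x) - γhat (b x)) P' μ ≤
      eLpNorm (C₁ • ((fun x => 1 + |a x| + |b x|) • fun x => a x - b x)) P' μ := by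
    refine eLpNorm_mono fun x => ?_
    have h2 := abs_primitive_sub_le hγhat hγC (a x) (b x)
    simp only [Pi.smul_apply, Pi.mul_apply, smul_eq_mul, Real.norm_eq_abs, abs_mul]
    rwa [abs_of_nonneg hC, abs_of_nonneg (by positivity : 0 ≤ 1 + |a x| + |b x|)]
  refine h1.trans ?_
  rw [eLpNorm_const_smul, Real.enorm_of_nonneg hC]
  refine mul_le_mul_right ?_ _
  have hma := ha.1.norm
  have hmb := hb.1.norm
  refine (eLpNorm_smul_le_mul_eLpNorm (p := P) (q := P) (ha.1.sub hb.1)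
    ((aestronglyMeasurable_const.add hma).add hmb)).trans (mul_le_mul_left ?_ _)
  refine (eLpNorm_add_le (f := fun x => 1 + |a x|) (g := fun x => |b x|)
    (aestronglyMeasurable_const.add hma) hmb hP).trans (add_le_add ?_ (eLpNorm_norm b).le)
  exact (eLpNorm_add_le (f := fun _ => (1:ℝ)) (g := fun x => |a x|)
    aestronglyMeasurable_const hma hP).trans (add_le_add_right (eLpNorm_norm a).le _)

end nemytskii

lemma memLp_comp_of_growth {α : Type*} [MeasurableSpace α] {μ : Measure α} [IsFiniteMeasure μ]
    {P : ℝ≥0∞} {γ : ℝ → ℝ} {C₁ : ℝ} (hγC : ∀ s : ℝ, |γ s| ≤ C₁ * (|s| + 1)) (hγ : Continuous γ) {a : α → ℝ} (ha : MemLp a P μ) :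
    MemLp (fun x => γ (a x)) P μ := by
  have h1 : MemLp (fun x => C₁ * (|a x| + 1)) P μ := (ha.abs.add (memLp_const (1:ℝ))).const_mul C₁
  exact h1.mono' (hγ.comp_aestronglyMeasurable ha.1) (Eventually.of_forall fun x => hγC _)

/-! ### Order in `L^p` and selection of times -/

section order

variable {α : Type*} [MeasurableSpace α] {μ : Measure α} {p : ℝ≥0∞}

lemma isOrderedModule_Lp : IsOrderedModule ℝ (Lp ℝ p μ) where
  smul_le_smul_of_nonneg_left c hc a b hab := by
    rw [← Lp.coeFn_le] at hab ⊢
    filter_upwards [hab, Lp.coeFn_smul c a, Lp.coeFn_smul c b] with x h1 h2 h3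
    rw [h2, h3]
    exact mul_le_mul_of_nonneg_left h1 hc
  smul_le_smul_of_nonneg_right a ha c d hcd := by
    rw [← Lp.coeFn_le]
    have ha' := (Lp.coeFn_nonneg a).2 ha
    filter_upwards [ha', Lp.coeFn_smul c a, Lp.coeFn_smul d a] with x h1 h2 h3
    rw [h2, h3]
    exact mul_le_mul_of_nonneg_right hcd h1

/-- A continuous curve which lies in a closed set at almost every time does so at every time. -/
lemma mem_of_ae_mem {E : Type*} [TopologicalSpace E] {T : ℝ} (hT : 0 < T) {u : ℝ → E}
    (hu : ContinuousOn u (Icc 0 T)) {s : Set E} (hs : IsClosed s)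
    (h : ∀ᵐ t ∂timeMeasure T, u t ∈ s) : ∀ t ∈ Icc 0 T, u t ∈ s := by
  intro t ht
  rw [ae_restrict_iff' measurableSet_Ioo] at h
  have h1 := (Measure.dense_of_ae h).open_subset_closure_inter (isOpen_Ioo (a := 0) (b := T))
  have h2 : t ∈ closure (Ioo 0 T ∩ {t | t ∈ Ioo 0 T → u t ∈ s}) := by
    rw [← closure_Ioo hT.ne] at ht
    exact closure_minimal h1 isClosed_closure ht
  have h3 : MapsTo u (Ioo 0 T ∩ {t | t ∈ Ioo 0 T → u t ∈ s}) s := fun r hr => hr.2 hr.1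
  have h4 := ((hu t ht).mono (inter_subset_left.trans Ioo_subset_Icc_self)).mem_closure h2 h3
  rwa [hs.closure_eq] at h4

lemma IsW12.antitone_of_nonpos [Fact (1 ≤ p)] {T : ℝ} (hT : 0 < T) {z z' : ℝ → Lp ℝ p μ} (hz : IsW12 T z z')
    (hz' : ∀ᵐ t ∂timeMeasure T, z' t ≤ 0) {s t : ℝ} (hs : s ∈ Icc 0 T) (ht : t ∈ Icc 0 T)
    (hst : s ≤ t) : z t ≤ z s := by
  have := isOrderedModule_Lp (μ := μ) (p := p)
  rw [← sub_nonpos, ← hz.integral_eq_sub hT hs ht, ← neg_nonneg, ← intervalIntegral.integral_neg,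
    intervalIntegral.integral_of_le hst, integral_Ioc_eq_integral_Ioo]
  refine integral_nonneg_of_ae ?_
  filter_upwards [ae_mono (Measure.restrict_mono_set _ (Ioo_subset_Ioo hs.1 ht.2)) hz'] with r hr
  exact neg_nonneg.2 hr

/-- Some point of any set of full measure takes a value at most the mean. It supplies the
intermediate time at which a merely integrable quantity is under control. -/
lemma exists_mul_le_integral {s t : ℝ} (hst : s < t) {f : ℝ → ℝ}
    (hf : IntegrableOn f (Ioo s t)) {A : Set ℝ} (hA : ∀ᵐ r ∂volume.restrict (Ioo s t), r ∈ A) :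
    ∃ ρ ∈ Ioo s t, ρ ∈ A ∧ (t - s) * f ρ ≤ ∫ r in s..t, f r := by
  obtain ⟨ρ, hρN, hρ⟩ := exists_notMem_null_le_average (μ := volume.restrict (Ioo s t))
    (f := f) (N := (A ∩ Ioo s t)ᶜ)
    (by rw [Ne, Measure.restrict_eq_zero, Real.volume_Ioo, ENNReal.ofReal_eq_zero]; linarith)
    hf (hA.and (ae_restrict_mem measurableSet_Ioo))
  rw [notMem_compl_iff] at hρN
  refine ⟨ρ, hρN.2, hρN.1, ?_⟩
  rw [setAverage_eq, ← integral_Ioc_eq_integral_Ioo, ← intervalIntegral.integral_of_le hst.le,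
    Real.volume_real_Ioo_of_le hst.le, smul_eq_mul, inv_mul_eq_div,
    le_div_iff₀ (by linarith)] at hρ
  linarith

end order

/-! ### Chain rule for the load term -/

section curves

/-- The argument vanishes at `t`, so continuity of `y` is enough. -/
lemma hasDerivAt_apply_sub {A : Type*} [NormedAddCommGroup A] [NormedSpace ℝ A] {a : ℝ → A} {a' : A}
    {t : ℝ} (ha : HasDerivAt a a' t) {y : ℝ → A →L[ℝ] ℝ} (hy : ContinuousAt y t) :
    HasDerivAt (fun s => y s (a s - a t)) (y t a') t := by
  rw [hasDerivAt_iff_tendsto_slope] at ha ⊢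
  have h1 := ((isBoundedBilinearMap_apply (𝕜 := ℝ)).continuous.tendsto (y t, a')).comp
    ((hy.tendsto.mono_left (nhdsWithin_le_nhds (s := {t}ᶜ))).prodMk_nhds ha)
  refine h1.congr fun s => ?_
  simp only [Function.comp_apply]
  rw [slope_def_module, slope_def_module, map_smul, sub_self, map_zero, sub_zero]

/-- The curve `zV` is only continuous in `V`, so its increments have to be measured in `H` against
`f`. Passing through a time `ρ` at which `‖f ρ‖²` is at most its mean bounds increments by the
integral of an integrable function. -/
theorem absolutelyContinuous_pairing {V H : Type*} [NormedAddCommGroup V] [NormedSpace ℝ V]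
    [NormedAddCommGroup H] [InnerProductSpace ℝ H] [CompleteSpace H] {T : ℝ} (hT : 0 < T)
    (ι : V →L[ℝ] H) {F F' : ℝ → StrongDual ℝ V} (hF : IsW12 T F F') {f : ℝ → H}
    (hf : MemLp f 2 (timeMeasure T))
    (hfF : ∀ᵐ t ∂timeMeasure T, ∀ v, F t v = inner ℝ (f t) (ι v)) {zV : ℝ → V}
    (hzV : ContinuousOn zV (Icc 0 T)) {z z' : ℝ → H} (hz : IsW12 T z z')
    (hι : ∀ t ∈ Icc 0 T, ι (zV t) = z t) :
    AbsolutelyContinuousOnInterval (fun t => F t (zV t)) 0 T ∧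
      ∀ᵐ t ∂timeMeasure T,
        HasDerivAt (fun t => F t (zV t)) (F' t (zV t) + inner ℝ (f t) (z' t)) t := by
  obtain ⟨M, hM⟩ := isCompact_Icc.exists_bound_of_continuousOn hzV
  have hM0 : 0 ≤ M := (norm_nonneg _).trans (hM 0 (left_mem_Icc.2 hT.le))
  have hii : ∀ {F : ℝ → ℝ}, Integrable F (timeMeasure T) → IntervalIntegrable F volume 0 T :=
    fun h => (intervalIntegrable_iff_integrableOn_Ioo_of_le hT.le).2 h
  have hIf := integrable_norm_sq_of_memLp hf
  have hiF := (MemLp.intervalIntegrable_time hT.le hF.memLp_deriv).norm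
  have hif := hii hIf
  have hiz2 := hii (integrable_norm_sq_of_memLp hz.memLp_deriv)
  have hiz := (MemLp.intervalIntegrable_time hT.le hz.memLp_deriv).norm
  constructor
  · refine absolutelyContinuousOnInterval_of_le hT.le
      (m := fun r => M * ‖F' r‖ + (1 / 2 * ‖f r‖ ^ 2 + 1 / 2 * ‖z' r‖ ^ 2))
      ((hiF.const_mul M).add ((hif.const_mul _).add (hiz2.const_mul _))) fun s hs t ht hst => ?_
    rcases hst.eq_or_lt with rfl | hlt
    · simp
    have hmono := Measure.restrict_mono_set (volume : Measure ℝ) (Ioo_subset_Ioo hs.1 ht.2)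
    obtain ⟨ρ, hρI, hρA, hρ⟩ := exists_mul_le_integral hlt (hIf.mono_measure hmono)
      (A := {r | ∀ v, F r v = inner ℝ (f r) (ι v)}) (ae_mono hmono hfF)
    have hρ' : ρ ∈ Icc 0 T := ⟨hs.1.trans hρI.1.le, hρI.2.le.trans ht.2⟩
    have hstep : ∀ a ∈ Icc 0 T, |F a (zV a) - F ρ (zV ρ)| ≤
        M * ‖F a - F ρ‖ + ‖f ρ‖ * ‖z a - z ρ‖ := by
      intro a ha
      have h1 : F a (zV a) - F ρ (zV ρ) = (F a - F ρ) (zV a) + inner ℝ (f ρ) (z a - z ρ) := by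
        rw [← hι a ha, ← hι ρ hρ', ← map_sub, ← hρA, map_sub, sub_apply]
        ring
      rw [h1]
      refine (abs_add_le _ _).trans (add_le_add ?_ (abs_real_inner_le_norm _ _))
      refine ((F a - F ρ).le_opNorm _).trans ?_
      rw [mul_comm]
      exact mul_le_mul_of_nonneg_right (hM a ha) (norm_nonneg _)
    have h1 := hstep t ht
    have h2 := hstep s hs
    rw [norm_sub_rev (F s), norm_sub_rev (z s)] at h2
    have h3 := hF.norm_sub_le hT hρ' ht hρI.2.le
    have h4 := hF.norm_sub_le hT hs hρ' hρI.1.le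
    have h5 := hz.norm_sub_le hT hρ' ht hρI.2.le
    have h6 := hz.norm_sub_le hT hs hρ' hρI.1.le
    have h7 := intervalIntegral.integral_add_adjacent_intervals
      (IntervalIntegrable.mono_Icc hiF hs hρ') (IntervalIntegrable.mono_Icc hiF hρ' ht)
    have h8 := intervalIntegral.integral_add_adjacent_intervals
      (IntervalIntegrable.mono_Icc hiz hs hρ') (IntervalIntegrable.mono_Icc hiz hρ' ht)
    have h9 : ‖f ρ‖ * ∫ r in s..t, ‖z' r‖ ≤
        1 / 2 * ((t - s) * ‖f ρ‖ ^ 2) + 1 / 2 * ∫ r in s..t, ‖z' r‖ ^ 2 := by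
      calc ‖f ρ‖ * ∫ r in s..t, ‖z' r‖ = ∫ r in s..t, ‖f ρ‖ * ‖z' r‖ :=
            (intervalIntegral.integral_const_mul _ _).symm
        _ ≤ ∫ r in s..t, (1 / 2 * ‖f ρ‖ ^ 2 + 1 / 2 * ‖z' r‖ ^ 2) := by
            refine intervalIntegral.integral_mono_on hst
              ((IntervalIntegrable.mono_Icc hiz hs ht).const_mul _)
              (intervalIntegrable_const.add
                ((IntervalIntegrable.mono_Icc hiz2 hs ht).const_mul _)) fun r _ => ?_
            nlinarith [sq_nonneg (‖f ρ‖ - ‖z' r‖)]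
        _ = _ := by
            rw [intervalIntegral.integral_add intervalIntegrable_const
              ((IntervalIntegrable.mono_Icc hiz2 hs ht).const_mul _),
              intervalIntegral.integral_const_mul (1 / 2) (fun r => ‖z' r‖ ^ 2),
              intervalIntegral.integral_const, smul_eq_mul]
            ring
    have h10 : ∫ r in s..t, (M * ‖F' r‖ + (1 / 2 * ‖f r‖ ^ 2 + 1 / 2 * ‖z' r‖ ^ 2)) =
        M * (∫ r in s..t, ‖F' r‖) + (1 / 2 * (∫ r in s..t, ‖f r‖ ^ 2) +
          1 / 2 * ∫ r in s..t, ‖z' r‖ ^ 2) := by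
      rw [intervalIntegral.integral_add ((IntervalIntegrable.mono_Icc hiF hs ht).const_mul _)
        (((IntervalIntegrable.mono_Icc hif hs ht).const_mul _).add
          ((IntervalIntegrable.mono_Icc hiz2 hs ht).const_mul _)),
        intervalIntegral.integral_add ((IntervalIntegrable.mono_Icc hif hs ht).const_mul _)
          ((IntervalIntegrable.mono_Icc hiz2 hs ht).const_mul _)]
      simp only [intervalIntegral.integral_const_mul]
    have h11 : |F t (zV t) - F s (zV s)| ≤
        |F t (zV t) - F ρ (zV ρ)| + |F s (zV s) - F ρ (zV ρ)| := by
      rw [abs_sub_comm (F s (zV s))]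
      exact abs_sub_le _ _ _
    have h12 : M * ‖F t - F ρ‖ + M * ‖F ρ - F s‖ ≤ M * ∫ r in s..t, ‖F' r‖ := by
      rw [← mul_add]
      exact mul_le_mul_of_nonneg_left (by linarith) hM0
    have h13 : ‖f ρ‖ * ‖z t - z ρ‖ + ‖f ρ‖ * ‖z ρ - z s‖ ≤ ‖f ρ‖ * ∫ r in s..t, ‖z' r‖ := by
      rw [← mul_add]
      exact mul_le_mul_of_nonneg_left (by linarith) (norm_nonneg _)
    rw [h10]
    linarith
  · filter_upwards [hF.ae_hasDerivAt hT, hz.ae_hasDerivAt hT, hfF,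
      ae_restrict_mem measurableSet_Ioo] with t h1 h2 h3 h4
    have hnhds : Icc 0 T ∈ 𝓝 t := Icc_mem_nhds h4.1 h4.2
    have hcont : ContinuousAt zV t := (hzV t (Ioo_subset_Icc_self h4)).continuousAt hnhds
    -- Near `t` the pairing splits as `(F s - F t) (zV s) + ⟪f t, z s⟫`. The first term needs only
    -- continuity of `zV`, the second only differentiability of `z` in `H`.
    have h5 : HasDerivAt (fun s => (F s - F t) (zV s)) (F' t (zV t)) t :=
      hasDerivAt_apply_sub h1 (y := fun s => ContinuousLinearMap.apply ℝ ℝ (zV s))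
        ((ContinuousLinearMap.apply ℝ ℝ).continuous.continuousAt.comp hcont)
    have h6 : HasDerivAt (fun s => (inner ℝ (f t) (z s) : ℝ)) (inner ℝ (f t) (z' t)) t :=
      (innerSL ℝ (f t)).hasFDerivAt.comp_hasDerivAt t h2
    refine (h5.add h6).congr_of_eventuallyEq ?_
    filter_upwards [hnhds] with s hs
    rw [Pi.add_apply, ← hι s hs, ← h3, sub_apply]
    ring

end curves

/-! ### Chain rule for the nonlinear term -/

section nonlinear

variable {α : Type*} [MeasurableSpace α] {μ : Measure α} {p : ℝ≥0∞}

lemma memLp_mul_of_le {ρ : Lp ℝ p μ} {S : ℝ} (hρ : ∀ᵐ x ∂μ, 0 ≤ ρ x ∧ ρ x ≤ S) {k : α → ℝ} {P : ℝ≥0∞}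
    (hk : MemLp k P μ) : MemLp (fun x => ρ x * k x) P μ := by
  refine (hk.norm.const_mul S).mono' ((Lp.aestronglyMeasurable ρ).mul hk.1) ?_
  filter_upwards [hρ] with x hx
  rw [norm_mul, Real.norm_of_nonneg hx.1]
  exact mul_le_mul_of_nonneg_right hx.2 (norm_nonneg _)

/-- Convergence in `L^p` alone does not control products with an `L²` function. The uniform bound
supplies a dominating function along subsequences that converge almost everywhere. -/
lemma tendsto_eLpNorm_sub_mul [Fact (1 ≤ p)] [IsFiniteMeasure μ] {u : ℝ → Lp ℝ p μ} {t : ℝ} {S : ℝ}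
    (hu : ContinuousAt u t) (hS : ∀ᶠ s in 𝓝 t, ∀ᵐ x ∂μ, 0 ≤ u s x ∧ u s x ≤ S) {k : α → ℝ}
    (hk : MemLp k 2 μ) :
    Tendsto (fun s => eLpNorm (fun x => u s x * k x - u t x * k x) 2 μ) (𝓝 t) (𝓝 0) := by
  have hSt := hS.self_of_nhds
  refine tendsto_of_subseq_tendsto fun ns hns => ?_
  have h1 : TendstoInMeasure μ (fun n => (u (ns n) : α → ℝ)) atTop (u t) :=
    tendstoInMeasure_of_tendsto_Lp (hu.tendsto.comp hns)
  obtain ⟨ls, hls, hae⟩ := h1.exists_seq_tendsto_ae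
  obtain ⟨n₀, hn₀⟩ := eventually_atTop.1 ((hns.comp hls.tendsto_atTop).eventually hS)
  refine ⟨fun n => ls (n + n₀), ?_⟩
  have hlim : Tendsto (fun n => ∫⁻ x, ‖u (ns (ls (n + n₀))) x * k x - u t x * k x‖ₑ ^ (2:ℝ) ∂μ) atTop
      (𝓝 (∫⁻ _, 0 ∂μ)) := by
    refine tendsto_lintegral_of_dominated_convergence'
      (fun x => (ENNReal.ofReal S * ‖k x‖ₑ) ^ (2:ℝ)) (fun n => ?_) (fun n => ?_) ?_ ?_
    · exact ((((Lp.aestronglyMeasurable _).mul hk.1).sub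
        ((Lp.aestronglyMeasurable _).mul hk.1)).enorm).pow_const _
    · filter_upwards [hn₀ _ (Nat.le_add_left n₀ n), hSt] with x h2 h3
      refine ENNReal.rpow_le_rpow ?_ (by norm_num)
      rw [← sub_mul, enorm_mul]
      refine mul_le_mul_left ?_ _
      rw [← ofReal_norm]
      refine ENNReal.ofReal_le_ofReal ?_
      rw [Real.norm_eq_abs, abs_le]
      simp only [Function.comp_apply] at h2
      constructor <;> linarith [h2.1, h2.2, h3.1, h3.2]
    · simp_rw [ENNReal.mul_rpow_of_nonneg _ _ (by norm_num : (0:ℝ) ≤ 2)]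
      rw [lintegral_const_mul'' _ (hk.1.enorm.pow_const _)]
      refine ENNReal.mul_ne_top (by finiteness) ?_
      have := hk.2
      rw [eLpNorm_eq_lintegral_rpow_enorm_toReal (by norm_num) (by norm_num)] at this
      simp only [ENNReal.toReal_ofNat] at this
      exact ((ENNReal.rpow_lt_top_iff_of_pos (by norm_num)).1 this).ne
    · filter_upwards [hae] with x hx
      have h2 : Tendsto (fun n => u (ns (ls (n + n₀))) x * k x - u t x * k x) atTop (𝓝 0) := by
        have := ((hx.comp (tendsto_add_atTop_nat n₀)).mul_const (k x)).sub_const (u t x * k x)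
        rwa [sub_self] at this
      have h3 := (ENNReal.continuous_rpow_const (y := 2)).continuousAt.tendsto.comp h2.enorm
      simpa [Function.comp_def] using h3
  rw [lintegral_zero] at hlim
  have h4 := (ENNReal.continuous_rpow_const (y := 1 / 2)).continuousAt.tendsto.comp hlim
  rw [ENNReal.zero_rpow_of_pos (by norm_num)] at h4
  refine h4.congr fun n => ?_
  rw [eLpNorm_eq_lintegral_rpow_enorm_toReal (by norm_num) (by norm_num)]
  simp

lemma abs_integral_mul_primitive_sub_le [IsFiniteMeasure μ] {γ γhat : ℝ → ℝ}
    (hγhat : ∀ s, HasDerivAt γhat (γ s) s) {C₁ : ℝ} (hγC : ∀ s : ℝ, |γ s| ≤ C₁ * (|s| + 1))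
    {ρ : Lp ℝ p μ} {S : ℝ} (hρ : ∀ᵐ x ∂μ, 0 ≤ ρ x ∧ ρ x ≤ S) (hS : 0 ≤ S) (a b : Lp ℝ 2 μ) :
    |∫ x, ρ x * (γhat (a x) - γhat (b x)) ∂μ| ≤ S * (C₁ *
      (((eLpNorm (fun _ : α => (1:ℝ)) 2 μ).toReal + ‖a‖ + ‖b‖) * ‖a - b‖)) := by
  have hC : 0 ≤ C₁ := by
    have h1 := (abs_nonneg _).trans (hγC 0)
    simpa using h1
  have h1 := memLp_primitive_sub (P' := 1) hγhat hγC (Lp.memLp a) (Lp.memLp b)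
  have h2 := eLpNorm_primitive_sub_le (P' := 1) hγhat hγC (by norm_num) (Lp.memLp a) (Lp.memLp b)
  have h3 : eLpNorm (fun x => a x - b x) 2 μ = eLpNorm (a - b : Lp ℝ 2 μ) 2 μ :=
    eLpNorm_congr_ae (Lp.coeFn_sub a b).symm
  have hone : eLpNorm (fun _ : α => (1:ℝ)) 2 μ ≠ ⊤ := (memLp_const (1:ℝ)).2.ne
  have hna := Lp.eLpNorm_ne_top a
  have hnb := Lp.eLpNorm_ne_top b
  have hnab := Lp.eLpNorm_ne_top (a - b)
  have h4 : ∫ x, |γhat (a x) - γhat (b x)| ∂μ ≤ C₁ *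
      (((eLpNorm (fun _ : α => (1:ℝ)) 2 μ).toReal + ‖a‖ + ‖b‖) * ‖a - b‖) := by
    have h5 := ENNReal.toReal_mono (by rw [h3]; finiteness) h2
    rw [ENNReal.toReal_mul, ENNReal.toReal_mul, ENNReal.toReal_ofReal hC, ENNReal.toReal_add
      (by finiteness) (by finiteness), ENNReal.toReal_add (by finiteness) (by finiteness), h3,
      ← Lp.norm_def, ← Lp.norm_def, ← Lp.norm_def, eLpNorm_one_eq_lintegral_enorm,
      ← integral_norm_eq_lintegral_enorm h1.1] at h5
    exact h5
  refine (abs_integral_le_integral_abs).trans ?_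
  refine le_trans (integral_mono_ae ?_ ((memLp_one_iff_integrable.1 h1).abs.const_mul S) ?_)
    ((integral_const_mul _ _).trans_le (mul_le_mul_of_nonneg_left h4 hS))
  · exact (memLp_one_iff_integrable.1 (memLp_mul_of_le hρ h1)).abs
  · filter_upwards [hρ] with x hx
    rw [abs_mul, abs_of_nonneg hx.1]
    exact mul_le_mul_of_nonneg_right hx.2 (abs_nonneg _)

end nonlinear

section nonlinear

variable {α : Type*} [MeasurableSpace α] {μ : Measure α} {p : ℝ≥0∞} [IsFiniteMeasure μ]

/-- This integrates the pointwise semiconvexity: nonnegativity of the coefficient preserves the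
inequality, and its upper bound controls the quadratic loss. -/
lemma integral_mul_primitive_sub_ge {γ γhat : ℝ → ℝ}
    (hγ : Continuous γ) (hγhat : ∀ s, HasDerivAt γhat (γ s) s) {C₁ : ℝ}
    (hγC : ∀ s : ℝ, |γ s| ≤ C₁ * (|s| + 1)) {L : ℝ} (hL : 0 ≤ L)
    (hγL : ∀ t s : ℝ, 0 ≤ (γ t - γ s) * (t - s) + L * |t - s| ^ 2)
    {ρ : Lp ℝ p μ} {S : ℝ} (hρ : ∀ᵐ x ∂μ, 0 ≤ ρ x ∧ ρ x ≤ S) (a b : Lp ℝ 2 μ) :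
    (∫ x, ρ x * γ (a x) * (b - a : Lp ℝ 2 μ) x ∂μ) - L * S / 2 * ‖b - a‖ ^ 2 ≤
      ∫ x, ρ x * (γhat (b x) - γhat (a x)) ∂μ := by
  have h1 : Integrable (fun x => ρ x * γ (a x) * (b - a : Lp ℝ 2 μ) x) μ :=
    MemLp.integrable_mul (p := 2) (q := 2)
      (memLp_mul_of_le hρ (memLp_comp_of_growth hγC hγ (Lp.memLp a))) (Lp.memLp (b - a))
  have h2 : Integrable (fun x => (b - a : Lp ℝ 2 μ) x * (b - a : Lp ℝ 2 μ) x) μ :=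
    MemLp.integrable_mul (p := 2) (q := 2) (Lp.memLp (b - a)) (Lp.memLp (b - a))
  have h3 : Integrable (fun x => ρ x * (γhat (b x) - γhat (a x))) μ :=
    memLp_one_iff_integrable.1 (memLp_mul_of_le hρ
      (memLp_primitive_sub (P' := 1) hγhat hγC (Lp.memLp b) (Lp.memLp a)))
  rw [← real_inner_self_eq_norm_sq, inner_L2_eq, ← integral_const_mul,
    ← integral_sub h1 (h2.const_mul _)]
  refine integral_mono_ae (h1.sub (h2.const_mul _)) h3 ?_
  filter_upwards [hρ, Lp.coeFn_sub b a] with x hx hsub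
  have h4 := mul_le_mul_of_nonneg_left (primitive_sub_ge hγhat hγL (a x) (b x)) hx.1
  rw [hsub, Pi.sub_apply]
  have h5 : ρ x * (L / 2 * (b x - a x) ^ 2) ≤ S * (L / 2 * (b x - a x) ^ 2) :=
    mul_le_mul_of_nonneg_right hx.2 (by positivity)
  nlinarith

/-- Absolute continuity already gives a derivative almost everywhere, so only its value has to be
found. Semiconvexity bounds the increment due to `z` from below by a function that is differentiable
at `t` and agrees with it there, hence the derivatives agree. -/
theorem absolutelyContinuous_nonlinear [Fact (1 ≤ p)] {V : Type*} [NormedAddCommGroup V]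
    [NormedSpace ℝ V] {T : ℝ} (hT : 0 < T) (ι : V →L[ℝ] Lp ℝ 2 μ) {γ γhat : ℝ → ℝ}
    (hγ : Continuous γ) (hγhat : ∀ s, HasDerivAt γhat (γ s) s) {C₁ : ℝ}
    (hγC : ∀ s : ℝ, |γ s| ≤ C₁ * (|s| + 1)) {L : ℝ} (hL : 0 ≤ L)
    (hγL : ∀ t s : ℝ, 0 ≤ (γ t - γ s) * (t - s) + L * |t - s| ^ 2)
    {Φ : V → Lp ℝ p μ →L[ℝ] ℝ} (hΦ : Continuous Φ)
    (hΦi : ∀ v (ρ : Lp ℝ p μ), Integrable (fun x => ρ x * γhat (ι v x)) μ ∧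
      Φ v ρ = ∫ x, ρ x * γhat (ι v x) ∂μ)
    {σ σ' : ℝ → Lp ℝ p μ} (hσ : IsW12 T σ σ') {S : ℝ} (hS : 0 ≤ S)
    (hσS : ∀ t ∈ Icc 0 T, ∀ᵐ x ∂μ, 0 ≤ σ t x ∧ σ t x ≤ S) {zV : ℝ → V}
    (hzV : ContinuousOn zV (Icc 0 T)) {z z' : ℝ → Lp ℝ 2 μ} (hz : IsW12 T z z')
    (hι : ∀ t ∈ Icc 0 T, ι (zV t) = z t) :
    AbsolutelyContinuousOnInterval (fun t => Φ (zV t) (σ t)) 0 T ∧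
      ∀ᵐ t ∂timeMeasure T, HasDerivAt (fun t => Φ (zV t) (σ t))
        (Φ (zV t) (σ' t) + ∫ x, σ t x * γ (z t x) * z' t x ∂μ) t := by
  have hdiff : ∀ s ∈ Icc 0 T, ∀ t ∈ Icc 0 T, Φ (zV t) (σ t) - Φ (zV s) (σ t) =
      ∫ x, σ t x * (γhat (z t x) - γhat (z s x)) ∂μ := by
    intro s hs t ht
    have h1 := hΦi (zV t) (σ t)
    have h2 := hΦi (zV s) (σ t)
    rw [h1.2, h2.2, ← integral_sub h1.1 h2.1, hι t ht, hι s hs]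
    simp only [mul_sub]
  have hAC : AbsolutelyContinuousOnInterval (fun t => Φ (zV t) (σ t)) 0 T := by
    obtain ⟨M, hM⟩ := isCompact_Icc.exists_bound_of_continuousOn (hΦ.comp_continuousOn hzV)
    obtain ⟨R, hR⟩ := isCompact_Icc.exists_bound_of_continuousOn hz.continuousOn
    have hM0 : 0 ≤ M := (norm_nonneg _).trans (hM 0 (left_mem_Icc.2 hT.le))
    have hC : 0 ≤ C₁ := by
      have h1 := (abs_nonneg _).trans (hγC 0)
      simpa using h1
    set A := (eLpNorm (fun _ : α => (1:ℝ)) 2 μ).toReal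
    have hA : 0 ≤ A := ENNReal.toReal_nonneg
    have hR0 : 0 ≤ R := (norm_nonneg _).trans (hR 0 (left_mem_Icc.2 hT.le))
    have hiσ := (MemLp.intervalIntegrable_time hT.le hσ.memLp_deriv).norm
    have hiz := (MemLp.intervalIntegrable_time hT.le hz.memLp_deriv).norm
    refine absolutelyContinuousOnInterval_of_le hT.le
      (m := fun r => S * (C₁ * (A + R + R)) * ‖z' r‖ + M * ‖σ' r‖)
      ((hiz.const_mul _).add (hiσ.const_mul _)) fun s hs t ht hst => ?_
    rw [intervalIntegral.integral_add ((IntervalIntegrable.mono_Icc hiz hs ht).const_mul _)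
      ((IntervalIntegrable.mono_Icc hiσ hs ht).const_mul _), intervalIntegral.integral_const_mul,
      intervalIntegral.integral_const_mul]
    have h1 : Φ (zV t) (σ t) - Φ (zV s) (σ s) =
        (Φ (zV t) (σ t) - Φ (zV s) (σ t)) + Φ (zV s) (σ t - σ s) := by
      rw [map_sub]; ring
    rw [h1, hdiff s hs t ht]
    refine (abs_add_le _ _).trans (add_le_add ?_ ?_)
    · refine (abs_integral_mul_primitive_sub_le hγhat hγC (hσS t ht) hS (z t) (z s)).trans ?_
      rw [mul_assoc, mul_assoc]
      refine mul_le_mul_of_nonneg_left (mul_le_mul_of_nonneg_left ?_ hC) hS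
      refine mul_le_mul ?_ (hz.norm_sub_le hT hs ht hst) (norm_nonneg _) (by positivity)
      exact add_le_add (add_le_add le_rfl (hR t ht)) (hR s hs)
    · refine ((Φ (zV s)).le_opNorm _).trans ?_
      exact mul_le_mul (hM s hs) (hσ.norm_sub_le hT hs ht hst) (norm_nonneg _) hM0
  refine ⟨hAC, ?_⟩
  have hd := hAC.ae_differentiableAt
  rw [uIcc_of_le hT.le] at hd
  filter_upwards [hσ.ae_hasDerivAt hT, hz.ae_hasDerivAt hT, ae_restrict_of_ae hd,
      ae_restrict_mem measurableSet_Ioo] with t h1 h2 h3 h4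
  have ht := Ioo_subset_Icc_self h4
  have hN := (h3 ht).hasDerivAt
  have hnhds : Icc 0 T ∈ 𝓝 t := Icc_mem_nhds h4.1 h4.2
  have hk : MemLp (fun x => γ (z t x)) 2 μ := memLp_comp_of_growth hγC hγ (Lp.memLp (z t))
  have hm : ∀ s ∈ Icc 0 T, MemLp (fun x => σ s x * γ (z t x)) 2 μ := fun s hs =>
    memLp_mul_of_le (hσS s hs) hk
  classical
  -- The function `σ(s) γ(z(t))` as an element of `L²`, with `z` frozen at time `t`. The default
  -- value `0` is never taken on `[0,T]`.
  let m : ℝ → Lp ℝ 2 μ := fun s =>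
    if h : MemLp (fun x => σ s x * γ (z t x)) 2 μ then h.toLp else 0
  have hmeq : ∀ s ∈ Icc 0 T, m s =ᵐ[μ] fun x => σ s x * γ (z t x) := by
    intro s hs
    simp only [m, dif_pos (hm s hs)]
    exact MemLp.coeFn_toLp _
  have hmc : ContinuousAt m t := by
    have h5 := tendsto_eLpNorm_sub_mul h1.continuousAt (S := S)
      (by filter_upwards [hnhds] with s hs using hσS s hs) hk
    rw [ContinuousAt, Lp.tendsto_Lp_iff_tendsto_eLpNorm']
    refine h5.congr' ?_
    filter_upwards [hnhds] with s hs
    refine eLpNorm_congr_ae ?_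
    filter_upwards [hmeq s hs, hmeq t ht] with x h6 h7
    rw [Pi.sub_apply, h6, h7]
  have hinner : ∀ s ∈ Icc 0 T, ∀ b : Lp ℝ 2 μ,
      (inner ℝ (m s) b : ℝ) = ∫ x, σ s x * γ (z t x) * b x ∂μ := by
    intro s hs b
    rw [inner_L2_eq]
    refine integral_congr_ae ?_
    filter_upwards [hmeq s hs] with x h6
    rw [h6]
  have hR : HasDerivAt (fun s => (inner ℝ (m s) (z s - z t) : ℝ) - L * S / 2 * ‖z s - z t‖ ^ 2)
      (inner ℝ (m t) (z' t)) t := by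
    have h5 : HasDerivAt (fun s => (inner ℝ (m s) (z s - z t) : ℝ)) (inner ℝ (m t) (z' t)) t :=
      hasDerivAt_apply_sub h2 (y := fun s => innerSL ℝ (m s))
        ((innerSL ℝ).continuous.continuousAt.comp hmc)
    have h6 := ((h2.sub_const (z t)).norm_sq).const_mul (L * S / 2)
    exact (h5.fun_sub h6).congr_deriv (by simp)
  have hQ : HasDerivAt (fun s => Φ (zV s) (σ s) - Φ (zV t) (σ s))
      (deriv (fun s => Φ (zV s) (σ s)) t - Φ (zV t) (σ' t)) t :=
    hN.sub ((Φ (zV t)).hasFDerivAt.comp_hasDerivAt t h1)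
  -- Both expressions vanish at `t`, and semiconvexity gives the inequality nearby; the quadratic
  -- term has derivative zero at `t`.
  have hmin : IsLocalMin (fun s => (Φ (zV s) (σ s) - Φ (zV t) (σ s)) -
      ((inner ℝ (m s) (z s - z t) : ℝ) - L * S / 2 * ‖z s - z t‖ ^ 2)) t := by
    filter_upwards [hnhds] with s hs
    have h5 := integral_mul_primitive_sub_ge hγ hγhat hγC hL hγL (hσS s hs) (z t) (z s)
    rw [← hinner s hs, ← hdiff t ht s hs] at h5
    simp only [sub_self, inner_zero_right, norm_zero]
    linarith
  have h5 := hmin.hasDerivAt_eq_zero (hQ.sub hR)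
  rw [← hinner t ht]
  have h6 : deriv (fun s => Φ (zV s) (σ s)) t = Φ (zV t) (σ' t) + inner ℝ (m t) (z' t) := by
    linarith
  rwa [h6] at hN

end nonlinear

/-! ### The energy on the function spaces -/

section spaces

variable {N : ℕ} {Ω ΓD ΓN : Set (Euc N)}

noncomputable instance instInnerProductSpaceSpaceV : InnerProductSpace ℝ (SpaceV Ω ΓD) where
  inner u v := inner ℝ u.1 v.1
  norm_sq_eq_re_inner u := norm_sq_eq_re_inner (𝕜 := ℝ) u.1
  conj_inner_symm u v := inner_conj_symm u.1 v.1
  add_left u v w := inner_add_left u.1 v.1 w.1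
  smul_left u v r := inner_smul_left u.1 v.1 r

/-- The inclusion `V → L²(Ω)`. -/
noncomputable def fnVL (Ω ΓD : Set (Euc N)) : SpaceV Ω ΓD →L[ℝ] L2 Ω where
  toFun := fnV
  map_add' _ _ := rfl
  map_smul' _ _ := rfl
  cont := (WithLp.continuous_fst 2 _ _).comp (continuous_subtype_val.comp continuous_subtype_val)

/-- The inclusion `X ∩ V → V`. -/
noncomputable def toVL (Ω ΓD ΓN : Set (Euc N)) : SpaceXV Ω ΓD ΓN →L[ℝ] SpaceV Ω ΓD where
  toFun U := ⟨toH1 U.1, U.2.2⟩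
  map_add' _ _ := rfl
  map_smul' _ _ := rfl
  cont := ((WithLp.continuous_fst 2 _ _).comp
    (continuous_subtype_val.comp continuous_subtype_val)).subtype_mk _

/-- The Laplacian `X ∩ V → L²(Ω)`. -/
noncomputable def lapL (Ω ΓD ΓN : Set (Euc N)) : SpaceXV Ω ΓD ΓN →L[ℝ] L2 Ω where
  toFun := lapXV
  map_add' U W := Finset.sum_add_distrib (s := Finset.univ)
    (f := fun i => U.1.1.snd (i, i)) (g := fun i => W.1.1.snd (i, i))
  map_smul' c U := (Finset.smul_sum (r := c) (s := Finset.univ)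
    (f := fun i => U.1.1.snd (i, i))).symm
  cont := continuous_finsetSum (f := fun i (U : SpaceXV Ω ΓD ΓN) => U.1.1.snd (i, i)) Finset.univ
    fun i _ => (PiLp.continuous_apply 2 _ (i, i)).comp
      ((WithLp.continuous_snd 2 _ _).comp (continuous_subtype_val.comp continuous_subtype_val))

lemma norm_sq_SpaceXV (U : SpaceXV Ω ΓD ΓN) :
    ‖U‖ ^ 2 = ‖toVL Ω ΓD ΓN U‖ ^ 2 + ∑ i, ‖U.1.1.snd i‖ ^ 2 := by
  change ‖U.1.1‖ ^ 2 = ‖U.1.1.fst‖ ^ 2 + _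
  rw [WithLp.prod_norm_sq_eq_of_L2, PiLp.norm_sq_eq_of_L2]

lemma norm_toVL_le (U : SpaceXV Ω ΓD ΓN) : ‖toVL Ω ΓD ΓN U‖ ≤ ‖U‖ := by
  refine abs_le_of_sq_le_sq' ?_ (norm_nonneg _) |>.2
  exact (le_add_of_nonneg_right (Finset.sum_nonneg fun i _ => sq_nonneg _)).trans
    (norm_sq_SpaceXV U).ge

lemma norm_lapXV_le (U : SpaceXV Ω ΓD ΓN) : ‖lapXV U‖ ≤ N * ‖U‖ := by
  have h : ∀ i, ‖U.1.1.snd i‖ ≤ ‖U‖ := by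
    intro i
    refine abs_le_of_sq_le_sq' ?_ (norm_nonneg _) |>.2
    exact (le_add_of_nonneg_of_le (sq_nonneg _)
      (Finset.single_le_sum (f := fun i => ‖U.1.1.snd i‖ ^ 2) (fun i _ => sq_nonneg _)
        (Finset.mem_univ i))).trans (norm_sq_SpaceXV U).ge
  refine (norm_sum_le _ _).trans ((Finset.sum_le_sum fun i _ => h (i, i)).trans (le_of_eq ?_))
  rw [Finset.sum_const, Finset.card_univ, Fintype.card_fin, nsmul_eq_mul]

lemma fnV_sub (u v : SpaceV Ω ΓD) : fnV (u - v) = fnV u - fnV v := map_sub (fnVL Ω ΓD) u v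

lemma fnV_injective (ho : IsOpen Ω) {u v : SpaceV Ω ΓD} (h : fnV u = fnV v) : u = v :=
  Subtype.ext (fnH1_injective ho h)

lemma fnV_toVL (U : SpaceXV Ω ΓD ΓN) : fnV (toVL Ω ΓD ΓN U) = fnXV U := rfl

lemma inner_SpaceV (u v : SpaceV Ω ΓD) :
    (inner ℝ u v : ℝ) = inner ℝ (fnV u) (fnV v) + ∑ i, inner ℝ (dH1 u.1 i) (dH1 v.1 i) :=
  inner_H1 u.1 v.1

lemma norm_sq_SpaceV (u : SpaceV Ω ΓD) : ‖u‖ ^ 2 = ‖fnV u‖ ^ 2 + ∑ i, ‖dH1 u.1 i‖ ^ 2 :=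
  norm_sq_H1 u.1

lemma green_XV (hΩ : IsMixedDomain Ω ΓD ΓN) (U : SpaceXV Ω ΓD ΓN) (v : SpaceV Ω ΓD) :
    ∑ i, (inner ℝ (dH1 (toVL Ω ΓD ΓN U).1 i) (dH1 v.1 i) : ℝ) = -inner ℝ (lapXV U) (fnV v) :=
  green hΩ U.2.1 v.2

lemma energy_eq {p : ℝ≥0∞} (lam : ℝ) (γhat : ℝ → ℝ) (σ : ℝ → Lp ℝ p (vol Ω)) (F : ℝ → DualV Ω ΓD)
    (u : SpaceV Ω ΓD) (t : ℝ) : energy lam γhat σ F u t =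
      1 / 2 * ‖u‖ ^ 2 + (lam - 1) / 2 * ‖fnV u‖ ^ 2 + (∫ x in Ω, σ t x * γhat (fnV u x)) - F t u := by
  rw [energy, norm_sq_SpaceV]
  ring

/-- The superposition operator `v ↦ γ̂(v)` is continuous from `V` into the dual of `L^p(Ω)`. -/
theorem exists_nemytskii (hN : 1 ≤ N) (hΩ : IsMixedDomain Ω ΓD ΓN) {p : ℝ≥0∞} [Fact (1 ≤ p)]
    (hp2 : N = 2 → 1 < p) (hp : N ≠ 2 → p = max 1 ((N : ℝ≥0∞) / 2)) {γ γhat : ℝ → ℝ}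
    (hγhat : ∀ s, HasDerivAt γhat (γ s) s) {C₁ : ℝ} (hγC : ∀ s : ℝ, |γ s| ≤ C₁ * (|s| + 1)) :
    ∃ Φ : SpaceV Ω ΓD → Lp ℝ p (vol Ω) →L[ℝ] ℝ, Continuous Φ ∧
      ∀ v (ρ : Lp ℝ p (vol Ω)), Integrable (fun x => ρ x * γhat (fnV v x)) (vol Ω) ∧
        Φ v ρ = ∫ x in Ω, ρ x * γhat (fnV v x) := by
  have hfin : IsFiniteMeasure (vol Ω) := ⟨by simpa using hΩ.isBounded.measure_lt_top⟩
  obtain ⟨P, P', h1, h2, C, hC⟩ := exists_sobolev (ΓD := ΓD) hN hΩ (Fact.out : 1 ≤ p) hp2 hp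
  have hP' : 1 ≤ P' := ENNReal.HolderTriple.le P' p 1
  have hP : 1 ≤ P := hP'.trans (ENNReal.HolderTriple.le P P P')
  have : Fact (1 ≤ P') := ⟨hP'⟩
  have hm : ∀ v : SpaceV Ω ΓD, MemLp (fnV v) P (vol Ω) := fun v =>
    ⟨Lp.aestronglyMeasurable _, (hC v).trans_lt (by finiteness)⟩
  let G : SpaceV Ω ΓD → Lp ℝ P' (vol Ω) := fun v => (memLp_primitive hγhat hγC (hm v)).toLp
  have hG : ∀ v, G v =ᵐ[vol Ω] fun x => γhat (fnV v x) := fun v => MemLp.coeFn_toLp _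
  have hGc : Continuous G := by
    rw [continuous_iff_continuousAt]
    intro v
    rw [ContinuousAt, Lp.tendsto_Lp_iff_tendsto_eLpNorm']
    set A := (eLpNorm (fun _ : Euc N => (1:ℝ)) P (vol Ω)).toReal
    have hA : ENNReal.ofReal A = eLpNorm (fun _ : Euc N => (1:ℝ)) P (vol Ω) :=
      ENNReal.ofReal_toReal (memLp_const (1:ℝ)).2.ne
    have hA0 : 0 ≤ A := ENNReal.toReal_nonneg
    have hbound : Tendsto (fun w : SpaceV Ω ΓD => ENNReal.ofReal (C₁ *
        ((A + C * ‖w‖ + C * ‖v‖) * (C * ‖w - v‖)))) (𝓝 v) (𝓝 0) := by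
      have hc : Continuous fun w : SpaceV Ω ΓD => ENNReal.ofReal (C₁ *
        ((A + C * ‖w‖ + C * ‖v‖) * (C * ‖w - v‖))) :=
        ENNReal.continuous_ofReal.comp (by fun_prop)
      have := hc.tendsto v
      simpa using this
    refine tendsto_of_tendsto_of_tendsto_of_le_of_le tendsto_const_nhds hbound
      (fun _ => zero_le) fun w => ?_
    have hC0 : 0 ≤ C₁ := by
      have h1 := (abs_nonneg _).trans (hγC 0)
      simpa using h1
    have e1 : eLpNorm ((G w : Euc N → ℝ) - (G v : Euc N → ℝ)) P' (vol Ω) =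
        eLpNorm (fun x => γhat (fnV w x) - γhat (fnV v x)) P' (vol Ω) :=
      eLpNorm_congr_ae ((hG w).sub (hG v))
    have e2 : eLpNorm (fun x => fnV w x - fnV v x) P (vol Ω) ≤ C * ENNReal.ofReal ‖w - v‖ := by
      refine le_trans (le_of_eq (eLpNorm_congr_ae ?_)) (hC (w - v))
      rw [fnV_sub]
      exact (Lp.coeFn_sub _ _).symm
    rw [e1]
    refine (eLpNorm_primitive_sub_le hγhat hγC hP (hm w) (hm v)).trans ?_
    rw [ENNReal.ofReal_mul hC0, ENNReal.ofReal_mul (by positivity), ENNReal.ofReal_add (by positivity)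
      (by positivity), ENNReal.ofReal_add hA0 (by positivity), hA,
      ENNReal.ofReal_mul (by positivity), ENNReal.ofReal_mul (by positivity),
      ENNReal.ofReal_mul (by positivity), ENNReal.ofReal_coe_nnreal]
    gcongr
    · exact hC w
    · exact hC v
  refine ⟨fun v => ((ContinuousLinearMap.mul ℝ ℝ).lpPairing (vol Ω) p P').flip (G v),
    ((ContinuousLinearMap.mul ℝ ℝ).lpPairing (vol Ω) p P').flip.continuous.comp hGc,
    fun v ρ => ⟨MemLp.integrable_mul (p := p) (q := P') (Lp.memLp ρ) (memLp_primitive hγhat hγC (hm v)), ?_⟩⟩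
  rw [ContinuousLinearMap.flip_apply, ContinuousLinearMap.lpPairing_eq_integral]
  refine integral_congr_ae ?_
  filter_upwards [hG v] with x hx
  rw [hx, ContinuousLinearMap.mul_apply']

lemma memLp_equation (hΩ : IsMixedDomain Ω ΓD ΓN) {p : ℝ≥0∞} {γ : ℝ → ℝ}
    (hγ : Continuous γ) {C₁ : ℝ} (hγC : ∀ s : ℝ, |γ s| ≤ C₁ * (|s| + 1)) {ρ : Lp ℝ p (vol Ω)} {S : ℝ}
    (hρ : ∀ᵐ x ∂vol Ω, 0 ≤ ρ x ∧ ρ x ≤ S) (lam : ℝ) (l u : L2 Ω) :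
    MemLp (fun x => -l x + lam * u x + ρ x * γ (u x)) 2 (vol Ω) := by
  have hfin : IsFiniteMeasure (vol Ω) := ⟨by simpa using hΩ.isBounded.measure_lt_top⟩
  exact ((Lp.memLp l).neg.add ((Lp.memLp u).const_mul lam)).add
    (memLp_mul_of_le hρ (memLp_comp_of_growth hγC hγ (Lp.memLp u)))

/-- Semiconvexity of the energy: lower bound for the increment from a function in `X ∩ V`. -/
theorem energy_sub_ge (hΩ : IsMixedDomain Ω ΓD ΓN) {p : ℝ≥0∞} {lam : ℝ} {γ γhat : ℝ → ℝ}
    (hγ : Continuous γ) (hγhat : ∀ s, HasDerivAt γhat (γ s) s) {C₁ : ℝ}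
    (hγC : ∀ s : ℝ, |γ s| ≤ C₁ * (|s| + 1)) {L : ℝ} (hL : 0 ≤ L)
    (hγL : ∀ t s : ℝ, 0 ≤ (γ t - γ s) * (t - s) + L * |t - s| ^ 2)
    {σ : ℝ → Lp ℝ p (vol Ω)} (F : ℝ → DualV Ω ΓD) {t S : ℝ}
    (hσ : ∀ᵐ x ∂vol Ω, 0 ≤ σ t x ∧ σ t x ≤ S) (U : SpaceXV Ω ΓD ΓN) (v : SpaceV Ω ΓD) :
    (∫ x in Ω, (-lapXV U x + lam * fnXV U x + σ t x * γ (fnXV U x)) *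
        fnV (v - toVL Ω ΓD ΓN U) x) - F t (v - toVL Ω ΓD ΓN U) +
      (lam - L * S) / 2 * ‖fnV (v - toVL Ω ΓD ΓN U)‖ ^ 2 ≤
      energy lam γhat σ F v t - energy lam γhat σ F (toVL Ω ΓD ΓN U) t := by
  have hfin : IsFiniteMeasure (vol Ω) := ⟨by simpa using hΩ.isBounded.measure_lt_top⟩
  set u := toVL Ω ΓD ΓN U with hu
  set d := v - u with hd
  have hfu : fnXV U = fnV u := rfl
  have hvd : v = u + d := by rw [hd]; abel
  have hfd : fnV d = fnV v - fnV u := fnV_sub v u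
  have hint : ∀ w : SpaceV Ω ΓD, Integrable (fun x => σ t x * γhat (fnV w x)) (vol Ω) := fun w =>
    memLp_one_iff_integrable.1 (memLp_mul_of_le hσ
      (memLp_primitive (P' := 1) hγhat hγC (Lp.memLp (fnV w))))
  have h1 := integral_mul_primitive_sub_ge hγ hγhat hγC hL hγL hσ (fnV u) (fnV v)
  have h2 : ∫ x in Ω, σ t x * (γhat (fnV v x) - γhat (fnV u x)) =
      (∫ x in Ω, σ t x * γhat (fnV v x)) - ∫ x in Ω, σ t x * γhat (fnV u x) := by
    rw [← integral_sub (hint v) (hint u)]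
    simp only [mul_sub]
  rw [h2, ← hfd] at h1
  have hnorm : ∀ a b c : L2 Ω, c = a + b →
      ‖c‖ ^ 2 = ‖a‖ ^ 2 + 2 * inner ℝ a b + ‖b‖ ^ 2 := fun a b c h => by
    rw [h, norm_add_sq_real]
  -- The quadratic terms expand exactly around `u`. Green's formula converts the mixed gradient term
  -- into the Laplacian, and the square of the gradient of `d` is discarded at the end.
  have h3 : ∑ i, ‖dH1 v.1 i‖ ^ 2 = ∑ i, ‖dH1 u.1 i‖ ^ 2 +
      2 * (∑ i, (inner ℝ (dH1 u.1 i) (dH1 d.1 i) : ℝ)) + ∑ i, ‖dH1 d.1 i‖ ^ 2 := by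
    rw [Finset.mul_sum, ← Finset.sum_add_distrib, ← Finset.sum_add_distrib]
    refine Finset.sum_congr rfl fun i _ => hnorm _ _ _ ?_
    rw [← dH1_add]
    congr 1
    rw [hvd]
    rfl
  have h4 : ‖fnV v‖ ^ 2 = ‖fnV u‖ ^ 2 + 2 * inner ℝ (fnV u) (fnV d) + ‖fnV d‖ ^ 2 :=
    hnorm _ _ _ (by rw [hfd]; abel)
  have h5 : F t d = F t v - F t u := map_sub _ _ _
  have h6 : ∫ x in Ω, (-lapXV U x + lam * fnXV U x + σ t x * γ (fnXV U x)) * fnV d x =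
      -inner ℝ (lapXV U) (fnV d) + lam * inner ℝ (fnV u) (fnV d) +
        ∫ x in Ω, σ t x * γ (fnV u x) * fnV d x := by
    have i1 : Integrable (fun x => lapXV U x * fnV d x) (vol Ω) :=
      MemLp.integrable_mul (p := 2) (q := 2) (Lp.memLp _) (Lp.memLp _)
    have i2 : Integrable (fun x => fnV u x * fnV d x) (vol Ω) :=
      MemLp.integrable_mul (p := 2) (q := 2) (Lp.memLp _) (Lp.memLp _)
    have i1' : Integrable (fun x => -(lapXV U x * fnV d x)) (vol Ω) := i1.neg
    have i2' : Integrable (fun x => lam * (fnV u x * fnV d x)) (vol Ω) := i2.const_mul lam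
    have i12 : Integrable (fun x => -(lapXV U x * fnV d x) + lam * (fnV u x * fnV d x)) (vol Ω) :=
      i1'.add i2'
    have i3 : Integrable (fun x => σ t x * γ (fnV u x) * fnV d x) (vol Ω) :=
      MemLp.integrable_mul (p := 2) (q := 2)
        (memLp_mul_of_le hσ (memLp_comp_of_growth hγC hγ (Lp.memLp (fnV u)))) (Lp.memLp (fnV d))
    rw [inner_L2_eq, inner_L2_eq, ← integral_neg, ← integral_const_mul,
      ← integral_add i1' i2', ← integral_add i12 i3]
    refine integral_congr_ae (Eventually.of_forall fun x => ?_)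
    simp only [hfu]
    ring
  have h7 := green_XV hΩ U d
  rw [← hu] at h7
  have h8 : 0 ≤ ∑ i, ‖dH1 d.1 i‖ ^ 2 := Finset.sum_nonneg fun i _ => sq_nonneg _
  rw [h6, energy, energy, h3, h4, h5, h7]
  nlinarith

end spaces

/-! ### Absolutely continuous curves and integrability in time -/

section curves

lemma IsW12.ae_eq_deriv {E : Type*} [NormedAddCommGroup E] [NormedSpace ℝ E] [CompleteSpace E]
    {T : ℝ} (hT : 0 < T) {u u' v' : ℝ → E} (h : IsW12 T u u') (h' : IsW12 T u v') :
    ∀ᵐ t ∂timeMeasure T, u' t = v' t := by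
  filter_upwards [h.ae_hasDerivAt hT, h'.ae_hasDerivAt hT] with t h1 h2 using h1.unique h2

lemma ae_of_mem_uIoc {T : ℝ} {P : ℝ → Prop} (h : ∀ᵐ r ∂timeMeasure T, P r) {s t : ℝ}
    (hs : s ∈ Icc 0 T) (ht : t ∈ Icc 0 T) : ∀ᵐ r : ℝ, r ∈ uIoc s t → P r := by
  rw [ae_restrict_iff' measurableSet_Ioo] at h
  filter_upwards [h, Measure.ae_ne volume (0 : ℝ), Measure.ae_ne volume T] with r h1 h2 h3 h4
  have h5 : r ∈ Icc 0 T := uIcc_subset_Icc hs ht (uIoc_subset_uIcc h4)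
  exact h1 ⟨lt_of_le_of_ne h5.1 (Ne.symm h2), lt_of_le_of_ne h5.2 h3⟩

lemma IsW12.eq_of_deriv_eq_zero {E : Type*} [NormedAddCommGroup E] [NormedSpace ℝ E]
    [CompleteSpace E] {T : ℝ} (hT : 0 < T) {u u' : ℝ → E} (h : IsW12 T u u')
    (h0 : ∀ᵐ t ∂timeMeasure T, u' t = 0) {s t : ℝ} (hs : s ∈ Icc 0 T) (ht : t ∈ Icc 0 T) :
    u t = u s := by
  rw [← sub_eq_zero, ← h.integral_eq_sub hT hs ht]
  exact intervalIntegral.integral_zero_ae (ae_of_mem_uIoc h0 hs ht)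

lemma absolutelyContinuous_of_sub_eq_integral {T : ℝ} (hT : 0 < T) {e g : ℝ → ℝ}
    (hg : IntervalIntegrable g volume 0 T)
    (h : ∀ s ∈ Icc 0 T, ∀ t ∈ Icc 0 T, e t - e s = ∫ r in s..t, g r) :
    AbsolutelyContinuousOnInterval e 0 T ∧ ∀ᵐ t ∂timeMeasure T, HasDerivAt e (g t) t := by
  constructor
  · refine absolutelyContinuousOnInterval_of_le hT.le hg.abs fun s hs t ht hst => ?_
    rw [h s hs t ht]
    exact intervalIntegral.abs_integral_le_integral_abs hst
  · rw [ae_restrict_iff' measurableSet_Ioo]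
    filter_upwards [hg.ae_hasDerivAt_integral] with t ht htm
    have h1 := ht (by rw [uIcc_of_le hT.le]; exact Ioo_subset_Icc_self htm) 0 (by simp)
    refine (h1.const_add (e 0)).congr_of_eventuallyEq ?_
    filter_upwards [Ioo_mem_nhds htm.1 htm.2] with x hx
    rw [← h 0 ⟨le_rfl, hT.le⟩ x (Ioo_subset_Icc_self hx)]
    ring

lemma IsW12.absolutelyContinuous_norm_sq {H : Type*} [NormedAddCommGroup H] [InnerProductSpace ℝ H]
    [CompleteSpace H] {T : ℝ} (hT : 0 < T) {z z' : ℝ → H} (hz : IsW12 T z z') :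
    AbsolutelyContinuousOnInterval (fun t => ‖z t‖ ^ 2) 0 T ∧
      ∀ᵐ t ∂timeMeasure T, HasDerivAt (fun t => ‖z t‖ ^ 2) (2 * inner ℝ (z t) (z' t)) t := by
  constructor
  · obtain ⟨R, hR⟩ := isCompact_Icc.exists_bound_of_continuousOn hz.continuousOn
    have hiz := (MemLp.intervalIntegrable_time hT.le hz.memLp_deriv).norm
    refine absolutelyContinuousOnInterval_of_le hT.le (hiz.const_mul (R + R)) fun s hs t ht hst => ?_
    rw [intervalIntegral.integral_const_mul, sq_sub_sq, abs_mul, abs_of_nonneg (by positivity)]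
    exact mul_le_mul (add_le_add (hR t ht) (hR s hs))
      ((abs_norm_sub_norm_le _ _).trans (hz.norm_sub_le hT hs ht hst)) (abs_nonneg _)
      (by linarith [(norm_nonneg _).trans (hR t ht)])
  · filter_upwards [hz.ae_hasDerivAt hT] with t h using h.norm_sq

lemma intervalIntegrable_apply {A : Type*} [NormedAddCommGroup A] [NormedSpace ℝ A] {T : ℝ}
    (hT : 0 < T) {y : ℝ → A →L[ℝ] ℝ} (hy : ContinuousOn y (Icc 0 T)) {a : ℝ → A}
    (ha : MemLp a 2 (timeMeasure T)) : IntervalIntegrable (fun r => y r (a r)) volume 0 T := by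
  rw [intervalIntegrable_iff_integrableOn_Ioo_of_le hT.le]
  obtain ⟨M, hM⟩ := isCompact_Icc.exists_bound_of_continuousOn hy
  have hi : Integrable (fun r => ‖a r‖) (timeMeasure T) :=
    (intervalIntegrable_iff_integrableOn_Ioo_of_le hT.le).1
      (MemLp.intervalIntegrable_time hT.le ha).norm
  have hym : AEStronglyMeasurable y (timeMeasure T) :=
    ((hy.mono Ioo_subset_Icc_self).aestronglyMeasurable measurableSet_Ioo)
  refine Integrable.mono' (hi.const_mul M)
    ((ContinuousLinearMap.id ℝ (A →L[ℝ] ℝ)).aestronglyMeasurable_comp₂ hym ha.1) ?_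
  filter_upwards [ae_restrict_mem measurableSet_Ioo] with r hr
  exact ((y r).le_opNorm _).trans
    (mul_le_mul_of_nonneg_right (hM r (Ioo_subset_Icc_self hr)) (norm_nonneg _))

lemma intervalIntegrable_apply_curve {V : Type*} [NormedAddCommGroup V] [NormedSpace ℝ V] {T : ℝ}
    (hT : 0 < T) {a : ℝ → StrongDual ℝ V} (ha : MemLp a 2 (timeMeasure T)) {v : ℝ → V}
    (hv : ContinuousOn v (Icc 0 T)) : IntervalIntegrable (fun r => a r (v r)) volume 0 T :=
  intervalIntegrable_apply hT (y := fun r => ContinuousLinearMap.apply ℝ ℝ (v r))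
    ((ContinuousLinearMap.apply ℝ ℝ).continuous.comp_continuousOn hv) ha

lemma MemLp.comp_of_norm_le {α A B : Type*} [MeasurableSpace α] {μ : Measure α}
    [NormedAddCommGroup A] [NormedAddCommGroup B] {p : ℝ≥0∞} {a : α → A} (ha : MemLp a p μ)
    {g : A → B} (hg : Continuous g) {C : ℝ} (hC : ∀ x, ‖g x‖ ≤ C * ‖x‖) :
    MemLp (fun x => g (a x)) p μ :=
  ha.of_le_mul (hg.comp_aestronglyMeasurable ha.1) (Eventually.of_forall fun x => hC (a x))

end curves

/-! ### Bounds on the coefficient at every time -/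

section bounds

variable {N : ℕ} {Ω : Set (Euc N)}

/-- Order half-spaces are closed in `L^p` and `σ` is continuous, so bounds valid at almost every
time hold at every time. The initial time, where `z₀` is tested, is included. -/
lemma coefficient_bounds [IsFiniteMeasure (vol Ω)] {p : ℝ≥0∞} [Fact (1 ≤ p)] {T : ℝ} (hT : 0 < T)
    {σ : ℝ → Lp ℝ p (vol Ω)} (hσ : ContinuousOn σ (Icc 0 T)) (hσtop : spaceTimeSup T σ < ⊤)
    (hσpos : ∀ᵐ t ∂timeMeasure T, ∀ᵐ x ∂vol Ω, 0 ≤ σ t x) :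
    ∀ t ∈ Icc 0 T, ∀ᵐ x ∂vol Ω, 0 ≤ σ t x ∧ σ t x ≤ (spaceTimeSup T σ).toReal := by
  set S := (spaceTimeSup T σ).toReal
  have hle : ∀ᵐ t ∂timeMeasure T, ∀ᵐ x ∂vol Ω, σ t x ≤ S := by
    filter_upwards [ae_le_essSup (f := fun t => eLpNorm (σ t) ⊤ (vol Ω))
      (μ := timeMeasure T)] with t ht
    rw [eLpNorm_exponent_top] at ht
    filter_upwards [ae_le_eLpNormEssSup (f := σ t) (μ := vol Ω)] with x hx
    have h1 : ‖σ t x‖ₑ ≤ spaceTimeSup T σ := hx.trans ht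
    have h2 := ENNReal.toReal_mono hσtop.ne h1
    rw [toReal_enorm] at h2
    exact (Real.le_norm_self _).trans h2
  have h0 := mem_of_ae_mem hT hσ (isClosed_Ici (a := (0 : Lp ℝ p (vol Ω)))) (by
    filter_upwards [hσpos] with t ht
    exact (Lp.coeFn_nonneg _).1 ht)
  have h1 := mem_of_ae_mem hT hσ (isClosed_Iic (a := Lp.const p (vol Ω) S)) (by
    filter_upwards [hle] with t ht
    refine (Lp.coeFn_le _ _).1 ?_
    filter_upwards [ht, Lp.coeFn_const (p := p) (μ := vol Ω) S] with x h2 h3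
    rw [h3]
    exact h2)
  intro t ht
  filter_upwards [(Lp.coeFn_nonneg _).2 (h0 t ht), (Lp.coeFn_le _ _).2 (h1 t ht),
    Lp.coeFn_const (p := p) (μ := vol Ω) S] with x h2 h3 h4
  rw [h4] at h3
  exact ⟨h2, h3⟩

end bounds

/-! ### Strong solutions as continuous curves in `V` -/

section solution

variable {N : ℕ} {Ω ΓD ΓN : Set (Euc N)}

/-- The `V`-valued continuous representative of a strong solution, with the chain rule for
`½‖z‖_V²`. -/
theorem exists_continuousOn_representative (hΩ : IsMixedDomain Ω ΓD ΓN) {T : ℝ} (hT : 0 < T)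
    {z z' : ℝ → L2 Ω} (hz : IsW12 T z z') {Z : ℝ → SpaceXV Ω ΓD ΓN}
    (hZ : MemLp Z 2 (timeMeasure T)) (hZz : ∀ᵐ t ∂timeMeasure T, fnXV (Z t) = z t) :
    ∃ zV : ℝ → SpaceV Ω ΓD, ContinuousOn zV (Icc 0 T) ∧
      (∀ᵐ t ∂timeMeasure T, zV t = toVL Ω ΓD ΓN (Z t)) ∧ (∀ t ∈ Icc 0 T, fnV (zV t) = z t) ∧
      AbsolutelyContinuousOnInterval (fun t => 1 / 2 * ‖zV t‖ ^ 2) 0 T ∧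
      ∀ᵐ t ∂timeMeasure T, HasDerivAt (fun t => 1 / 2 * ‖zV t‖ ^ 2)
        (inner ℝ (-lapXV (Z t) + z t) (z' t)) t := by
  have := completeSpace_SpaceV hΩ
  -- By Green's formula, `-Δz + z` in `L²(Ω)` represents the `V` inner product with `z`. This is the
  -- curve `w` of the abstract theorem.
  obtain ⟨zV, h1, h2, h3, h4, h5⟩ := @exists_continuousOn_and_norm_sq_sub (L2 Ω) _ _ _
    (SpaceV Ω ΓD) _ instInnerProductSpaceSpaceV this T hT (fnVL Ω ΓD)
    (fun t => toVL Ω ΓD ΓN (Z t)) (fun t => -lapXV (Z t) + z t) z z'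
    (MemLp.comp_of_norm_le hZ (toVL Ω ΓD ΓN).cont (C := 1)
      fun U => (norm_toVL_le U).trans_eq (one_mul _).symm)
    ((MemLp.comp_of_norm_le hZ (lapL Ω ΓD ΓN).cont norm_lapXV_le).neg.add hz.memLp) hz hZz (by
      filter_upwards [hZz] with t ht v
      refine (inner_SpaceV _ v).trans ?_
      rw [green_XV hΩ, fnV_toVL, ht, inner_add_left, inner_neg_left, add_comm]
      rfl)
  obtain ⟨h6, h7⟩ := absolutelyContinuous_of_sub_eq_integral hT h4 h5
  exact ⟨zV, h1, h2, h3, h6, h7⟩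

end solution

/-! ### Energy balance and unilateral equilibrium -/

section energy

variable {N : ℕ} {Ω ΓD ΓN : Set (Euc N)} {p : ℝ≥0∞}

lemma dual_sub_comm (F : DualV Ω ΓD) (u v : SpaceV Ω ΓD) : F (u - v) = -F (v - u) := by
  have h1 : F (u - v) = F u - F v := map_sub F u v
  have h2 : F (v - u) = F v - F u := map_sub F v u
  rw [h1, h2, neg_sub]

set_option maxHeartbeats 1000000 in
/-- A subsolution of the equation minimises the energy among the functions below it. -/
lemma energy_sub_ge_of_le (hΩ : IsMixedDomain Ω ΓD ΓN) {lam : ℝ} {γ γhat : ℝ → ℝ}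
    (hγ : Continuous γ) (hγhat : ∀ s, HasDerivAt γhat (γ s) s) {C₁ : ℝ}
    (hγC : ∀ s : ℝ, |γ s| ≤ C₁ * (|s| + 1)) {L : ℝ} (hL : 0 ≤ L)
    (hγL : ∀ t s : ℝ, 0 ≤ (γ t - γ s) * (t - s) + L * |t - s| ^ 2)
    {σ : ℝ → Lp ℝ p (vol Ω)} (F : ℝ → DualV Ω ΓD) {t S : ℝ}
    (hσ : ∀ᵐ x ∂vol Ω, 0 ≤ σ t x ∧ σ t x ≤ S) (U : SpaceXV Ω ΓD ΓN)
    (hU : ∀ w : SpaceV Ω ΓD, (∀ᵐ x ∂vol Ω, 0 ≤ fnV w x) →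
      ∫ x in Ω, (-lapXV U x + lam * fnXV U x + σ t x * γ (fnXV U x)) * fnV w x ≤ F t w)
    (v : SpaceV Ω ΓD) (hv : ∀ᵐ x ∂vol Ω, fnV v x ≤ fnXV U x) :
    (lam - L * S) / 2 * ‖fnV v - fnXV U‖ ^ 2 ≤
      energy lam γhat σ F v t - energy lam γhat σ F (toVL Ω ΓD ΓN U) t := by
  have h1 := energy_sub_ge hΩ (lam := lam) hγ hγhat hγC hL hγL F hσ U v
  have h2 := hU (toVL Ω ΓD ΓN U - v) (by
    rw [fnV_sub, fnV_toVL]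
    filter_upwards [hv, Lp.coeFn_sub (fnXV U) (fnV v)] with x h3 h4
    rw [h4, Pi.sub_apply]
    exact sub_nonneg.2 h3)
  have h5 : ∫ x in Ω, (-lapXV U x + lam * fnXV U x + σ t x * γ (fnXV U x)) *
        fnV (toVL Ω ΓD ΓN U - v) x =
      -∫ x in Ω, (-lapXV U x + lam * fnXV U x + σ t x * γ (fnXV U x)) *
        fnV (v - toVL Ω ΓD ΓN U) x := by
    have h6 : fnV (toVL Ω ΓD ΓN U - v) = -fnV (v - toVL Ω ΓD ΓN U) := by
      rw [fnV_sub, fnV_sub, neg_sub]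
    rw [← integral_neg, h6]
    generalize fnV (v - toVL Ω ΓD ΓN U) = d
    refine integral_congr_ae ?_
    filter_upwards [Lp.coeFn_neg d] with x h3
    rw [h3, Pi.neg_apply, mul_neg]
  have h6 : F t (toVL Ω ΓD ΓN U - v) = -F t (v - toVL Ω ΓD ΓN U) :=
    dual_sub_comm _ _ _
  rw [h5, h6] at h2
  rw [show fnXV U = fnV (toVL Ω ΓD ΓN U) from (fnV_toVL U).symm, ← fnV_sub v]
  exact (le_add_of_nonneg_left (sub_nonneg.2 (neg_le_neg_iff.1 h2))).trans h1

/-- The test function `∂ₜz` in the equation. -/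
lemma inner_equation_eq_zero (hΩ : IsMixedDomain Ω ΓD ΓN) {γ : ℝ → ℝ} (hγ : Continuous γ) {C₁ : ℝ}
    (hγC : ∀ s : ℝ, |γ s| ≤ C₁ * (|s| + 1)) {ρ : Lp ℝ p (vol Ω)} {S : ℝ}
    (hρ : ∀ᵐ x ∂vol Ω, 0 ≤ ρ x ∧ ρ x ≤ S) {lam : ℝ} {l u f w : L2 Ω}
    (h : ∀ᵐ x ∂vol Ω, w x * (-l x + lam * u x + ρ x * γ (u x) - f x) = 0) :
    (inner ℝ (-l + u) w : ℝ) + (lam - 1) * inner ℝ u w + (∫ x in Ω, ρ x * γ (u x) * w x)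
      - inner ℝ f w = 0 := by
  have : IsFiniteMeasure (vol Ω) := ⟨by simpa using hΩ.isBounded.measure_lt_top⟩
  have hm : MemLp (fun x => ρ x * γ (u x)) 2 (vol Ω) :=
    memLp_mul_of_le hρ (memLp_comp_of_growth hγC hγ (Lp.memLp u))
  have h1 : ∫ x in Ω, ρ x * γ (u x) * w x = inner ℝ hm.toLp w := by
    rw [inner_L2_eq]
    refine integral_congr_ae ?_
    filter_upwards [hm.coeFn_toLp] with x hx
    rw [hx]
  have h2 : (inner ℝ (-l + u) w : ℝ) + (lam - 1) * inner ℝ u w + inner ℝ hm.toLp w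
      - inner ℝ f w = inner ℝ (-l + lam • u + hm.toLp - f) w := by
    simp only [inner_add_left, inner_sub_left, real_inner_smul_left]
    ring
  rw [h1, h2, inner_L2_eq]
  refine integral_eq_zero_of_ae ?_
  filter_upwards [h, hm.coeFn_toLp, Lp.coeFn_sub (-l + lam • u + hm.toLp) f,
    Lp.coeFn_add (-l + lam • u) hm.toLp, Lp.coeFn_add (-l) (lam • u), Lp.coeFn_neg l,
    Lp.coeFn_smul lam u] with x h3 h4 h5 h6 h7 h8 h9
  rw [h5, Pi.sub_apply, h6, Pi.add_apply, h7, Pi.add_apply, h8, h9, h4, Pi.neg_apply, Pi.smul_apply,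
    smul_eq_mul, mul_comm]
  exact h3

/-- An inequality that holds almost everywhere can be tested with nonnegative functions. -/
lemma integral_equation_mul_le (hΩ : IsMixedDomain Ω ΓD ΓN) {γ : ℝ → ℝ} (hγ : Continuous γ)
    {C₁ : ℝ} (hγC : ∀ s : ℝ, |γ s| ≤ C₁ * (|s| + 1)) {ρ : Lp ℝ p (vol Ω)} {S : ℝ}
    (hρ : ∀ᵐ x ∂vol Ω, 0 ≤ ρ x ∧ ρ x ≤ S) {lam : ℝ} {l u f w : L2 Ω}
    (h : ∀ᵐ x ∂vol Ω, -l x + lam * u x + ρ x * γ (u x) ≤ f x) (hw : ∀ᵐ x ∂vol Ω, 0 ≤ w x) :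
    ∫ x in Ω, (-l x + lam * u x + ρ x * γ (u x)) * w x ≤ ∫ x in Ω, f x * w x := by
  refine integral_mono_ae
    ((memLp_equation hΩ hγ hγC hρ lam l u).integrable_mul (Lp.memLp w))
    ((Lp.memLp f).integrable_mul (Lp.memLp w)) ?_
  filter_upwards [h, hw] with x h1 h2 using mul_le_mul_of_nonneg_right h1 h2

/-- The energy balance, with the integral of the nonlinearity written as a pairing. -/
theorem energy_sub_eq_integral (hΩ : IsMixedDomain Ω ΓD ΓN) [Fact (1 ≤ p)] {T : ℝ} (hT : 0 < T)
    {lam : ℝ} {γ γhat : ℝ → ℝ}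
    (hγ : Continuous γ) (hγhat : ∀ s, HasDerivAt γhat (γ s) s) {C₁ : ℝ}
    (hγC : ∀ s : ℝ, |γ s| ≤ C₁ * (|s| + 1)) {L : ℝ} (hL : 0 ≤ L)
    (hγL : ∀ t s : ℝ, 0 ≤ (γ t - γ s) * (t - s) + L * |t - s| ^ 2)
    {Φ : SpaceV Ω ΓD → Lp ℝ p (vol Ω) →L[ℝ] ℝ} (hΦ : Continuous Φ)
    (hΦi : ∀ v ρ, Integrable (fun x => ρ x * γhat (fnV v x)) (vol Ω) ∧
      Φ v ρ = ∫ x in Ω, ρ x * γhat (fnV v x))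
    {f : ℝ → L2 Ω} (hf : MemLp f 2 (timeMeasure T)) {F F' : ℝ → DualV Ω ΓD} (hF : IsW12 T F F')
    (hfF : ∀ᵐ t ∂timeMeasure T, ∀ v : SpaceV Ω ΓD, F t v = ∫ x in Ω, f t x * fnV v x)
    {σ σ' : ℝ → Lp ℝ p (vol Ω)} (hσ : IsW12 T σ σ') {S : ℝ} (hS : 0 ≤ S)
    (hσS : ∀ t ∈ Icc 0 T, ∀ᵐ x ∂vol Ω, 0 ≤ σ t x ∧ σ t x ≤ S)
    {z z' : ℝ → L2 Ω} (hz : IsW12 T z z') {Z : ℝ → SpaceXV Ω ΓD ΓN}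
    (heq : ∀ᵐ t ∂timeMeasure T, ∀ᵐ x ∂vol Ω,
      z' t x * (-lapXV (Z t) x + lam * z t x + σ t x * γ (z t x) - f t x) = 0)
    {zV : ℝ → SpaceV Ω ΓD} (hzV : ContinuousOn zV (Icc 0 T)) (hzz : ∀ t ∈ Icc 0 T, fnV (zV t) = z t)
    (hAC : AbsolutelyContinuousOnInterval (fun t => 1 / 2 * ‖zV t‖ ^ 2) 0 T)
    (hd : ∀ᵐ t ∂timeMeasure T, HasDerivAt (fun t => 1 / 2 * ‖zV t‖ ^ 2)
      (inner ℝ (-lapXV (Z t) + z t) (z' t)) t) :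
    IntervalIntegrable (fun r => Φ (zV r) (σ' r)) volume 0 T ∧
    IntervalIntegrable (fun r => F' r (zV r)) volume 0 T ∧
    ∀ t ∈ Icc 0 T, ∀ s ∈ Icc 0 T,
      energy lam γhat σ F (zV t) t - energy lam γhat σ F (zV s) s =
        (∫ r in s..t, Φ (zV r) (σ' r)) - ∫ r in s..t, F' r (zV r) := by
  have : IsFiniteMeasure (vol Ω) := ⟨by simpa using hΩ.isBounded.measure_lt_top⟩
  have hi1 : IntervalIntegrable (fun r => Φ (zV r) (σ' r)) volume 0 T :=
    intervalIntegrable_apply hT (hΦ.comp_continuousOn hzV) hσ.memLp_deriv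
  have hi2 : IntervalIntegrable (fun r => F' r (zV r)) volume 0 T :=
    @intervalIntegrable_apply_curve (SpaceV Ω ΓD) _ (SpaceV Ω ΓD).normedSpace T hT F' hF.memLp_deriv
      zV hzV
  refine ⟨hi1, hi2, fun t ht s hs => ?_⟩
  obtain ⟨a1, d1⟩ := hz.absolutelyContinuous_norm_sq hT
  obtain ⟨a2, d2⟩ := @absolutelyContinuous_nonlinear (Euc N) _ (vol Ω) p _ _ (SpaceV Ω ΓD) _
    (SpaceV Ω ΓD).normedSpace T hT (fnVL Ω ΓD) γ γhat hγ hγhat C₁ hγC L hL hγL Φ hΦ hΦi σ σ' hσ S hS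
    hσS zV hzV z z' hz hzz
  obtain ⟨a3, d3⟩ := @absolutelyContinuous_pairing (SpaceV Ω ΓD) (L2 Ω) _ (SpaceV Ω ΓD).normedSpace _ _ _
    T hT (fnVL Ω ΓD) F F' hF f hf (by filter_upwards [hfF] with t ht v; rw [ht, inner_L2_eq]; rfl)
    zV hzV z z' hz hzz
  -- The full `V` norm replaces the gradient norm, because the chain rule is available for it; the
  -- surplus is corrected by `λ - 1` in place of `λ`.
  let e : ℝ → ℝ := fun t => 1 / 2 * ‖zV t‖ ^ 2 + (lam - 1) / 2 * ‖z t‖ ^ 2 + Φ (zV t) (σ t)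
    - F t (zV t)
  have he : ∀ t ∈ Icc 0 T, energy lam γhat σ F (zV t) t = e t := by
    intro t ht
    rw [energy_eq, ← (hΦi _ _).2, hzz t ht]
  have hea : AbsolutelyContinuousOnInterval e 0 T :=
    ((hAC.fun_add (a1.const_mul ((lam - 1) / 2))).fun_add a2).fun_sub a3
  -- All terms containing `z'` add up to the equation tested with `∂ₜz`, which is zero by
  -- complementarity.
  have hed : ∀ᵐ t ∂timeMeasure T, HasDerivAt e (Φ (zV t) (σ' t) - F' t (zV t)) t := by
    filter_upwards [hd, d1, d2, d3, heq, ae_restrict_mem measurableSet_Ioo] with t h1 h2 h3 h4 h5 h6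
    have h7 := inner_equation_eq_zero hΩ hγ hγC (hσS t (Ioo_subset_Icc_self h6)) h5
    refine (((h1.fun_add (h2.const_mul ((lam - 1) / 2))).fun_add h3).fun_sub h4).congr_deriv ?_
    linarith
  rw [he t ht, he s hs, ← intervalIntegral.integral_sub (IntervalIntegrable.mono_Icc hi1 hs ht)
    (IntervalIntegrable.mono_Icc hi2 hs ht),
    ← (hea.mono (by
      rw [uIcc_of_le hT.le]; exact uIcc_subset_Icc hs ht)).integral_deriv_eq_sub]
  refine intervalIntegral.integral_congr_ae ?_
  filter_upwards [ae_of_mem_uIoc hed hs ht] with r h1 h2 using (h1 h2).deriv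

/-- Unilateral equilibrium of a decreasing curve of subsolutions. -/
theorem energy_le_of_le (hΩ : IsMixedDomain Ω ΓD ΓN) [Fact (1 ≤ p)] {T : ℝ}
    {lam : ℝ} {γ γhat : ℝ → ℝ}
    (hγ : Continuous γ) (hγhat : ∀ s, HasDerivAt γhat (γ s) s) {C₁ : ℝ}
    (hγC : ∀ s : ℝ, |γ s| ≤ C₁ * (|s| + 1)) {L : ℝ} (hL : 0 ≤ L)
    (hγL : ∀ t s : ℝ, 0 ≤ (γ t - γ s) * (t - s) + L * |t - s| ^ 2)
    {Φ : SpaceV Ω ΓD → Lp ℝ p (vol Ω) →L[ℝ] ℝ}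
    (hΦi : ∀ v ρ, Integrable (fun x => ρ x * γhat (fnV v x)) (vol Ω) ∧
      Φ v ρ = ∫ x in Ω, ρ x * γhat (fnV v x))
    {f : ℝ → L2 Ω} {F : ℝ → DualV Ω ΓD} (hF : ContinuousOn F (Icc 0 T))
    (hfF : ∀ᵐ t ∂timeMeasure T, ∀ v : SpaceV Ω ΓD, F t v = ∫ x in Ω, f t x * fnV v x)
    {σ : ℝ → Lp ℝ p (vol Ω)} (hσ : ContinuousOn σ (Icc 0 T)) {S : ℝ} (hLS : 0 ≤ lam - L * S)
    (hσS : ∀ t ∈ Icc 0 T, ∀ᵐ x ∂vol Ω, 0 ≤ σ t x ∧ σ t x ≤ S)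
    {z : ℝ → L2 Ω} (hanti : ∀ s ∈ Icc 0 T, ∀ t ∈ Icc 0 T, s ≤ t → z t ≤ z s)
    {Z : ℝ → SpaceXV Ω ΓD ΓN} (hZz : ∀ᵐ t ∂timeMeasure T, fnXV (Z t) = z t)
    (hle : ∀ᵐ t ∂timeMeasure T, ∀ᵐ x ∂vol Ω,
      -lapXV (Z t) x + lam * z t x + σ t x * γ (z t x) ≤ f t x)
    {zV : ℝ → SpaceV Ω ΓD} (hzV : ContinuousOn (fun t => energy lam γhat σ F (zV t) t) (Icc 0 T))
    (hZV : ∀ᵐ t ∂timeMeasure T, zV t = toVL Ω ΓD ΓN (Z t)) {t : ℝ} (ht : t ∈ Ioc 0 T)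
    {v : SpaceV Ω ΓD} (hv : ∀ᵐ x ∂vol Ω, fnV v x ≤ z t x) :
    energy lam γhat σ F (zV t) t ≤ energy lam γhat σ F v t := by
  have hsub : Icc 0 t ⊆ Icc 0 T := Icc_subset_Icc_right ht.2
  have hc : ContinuousOn (fun r => energy lam γhat σ F v r) (Icc 0 t) := by
    simp only [energy, ← (hΦi _ _).2]
    exact (continuousOn_const.add ((Φ v).continuous.comp_continuousOn (hσ.mono hsub))).sub
      ((ContinuousLinearMap.apply ℝ ℝ v).continuous.comp_continuousOn (hF.mono hsub))
  -- For almost every `r < t` the competitor satisfies `v ≤ z t ≤ z r`, so it is admissible at time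
  -- `r`. Working on `[0,t]` makes `t` an endpoint, which is reached by continuity of both energies.
  have key := mem_of_ae_mem ht.1 ((hzV.mono hsub).sub hc) (isClosed_Iic (a := (0 : ℝ))) (by
    have hsub' : Ioo 0 t ⊆ Ioo 0 T := Ioo_subset_Ioo_right ht.2
    filter_upwards [ae_restrict_of_ae_restrict_of_subset hsub' hfF,
      ae_restrict_of_ae_restrict_of_subset hsub' hZz, ae_restrict_of_ae_restrict_of_subset hsub' hle,
      ae_restrict_of_ae_restrict_of_subset hsub' hZV, ae_restrict_mem measurableSet_Ioo]
      with r h1 h2 h3 h4 h5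
    have hr : r ∈ Icc 0 T := hsub (Ioo_subset_Icc_self h5)
    have h6 := energy_sub_ge_of_le hΩ (lam := lam) hγ hγhat hγC hL hγL F (hσS r hr) (Z r) (by
      intro w hw
      rw [h1 w, h2]
      exact integral_equation_mul_le hΩ hγ hγC (hσS r hr) h3 hw) v (by
      rw [h2]
      filter_upwards [hv, (Lp.coeFn_le _ _).2 (hanti r hr t ⟨ht.1.le, ht.2⟩ h5.2.le)]
        with x h7 h8 using h7.trans h8)
    rw [← h4] at h6
    have h9 : 0 ≤ (lam - L * S) / 2 * ‖fnV v - fnXV (Z r)‖ ^ 2 := by positivity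
    exact sub_nonpos.2 (sub_nonneg.1 (h9.trans h6))) t ⟨ht.1.le, le_rfl⟩
  exact sub_nonpos.1 key

end energy

end UnidirectionalEvolution

/-! ### Assembly of the theorem -/

theorem theorem1p2 {N : ℕ} (hN : 1 ≤ N) (Ω ΓD ΓN : Set (Euc N))
    (hΩ : IsMixedDomain Ω ΓD ΓN) (hreg : EllipticRegularity Ω ΓD)
    (T : ℝ) (hT : 0 < T) (lam : ℝ) (hlam : 0 ≤ lam)
    -- the exponent of the space in which `σ` is weakly differentiable in time
    (p : ℝ≥0∞) [Fact (1 ≤ p)]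
    (hp2 : N = 2 → 1 < p) (hp : N ≠ 2 → p = max 1 ((N : ℝ≥0∞) / 2))
    -- the nonlinearity and a primitive of it
    (γ : ℝ → ℝ) (hγ : Continuous γ) (γhat : ℝ → ℝ) (hγhat : ∀ s, HasDerivAt γhat (γ s) s)
    -- the initial datum
    (z₀ : SpaceXV Ω ΓD ΓN)
    -- the forcing term; `F` is `f` as a continuous curve in `V*`
    (f : ℝ → L2 Ω) (hf : MemLp f 2 (timeMeasure T))
    (F F' : ℝ → DualV Ω ΓD) (hF : IsW12 T F F')
    (hfF : ∀ᵐ t ∂timeMeasure T, ∀ v : SpaceV Ω ΓD, F t v = ∫ x in Ω, f t x * fnV v x)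
    -- the coefficient
    (σ σ' : ℝ → Lp ℝ p (vol Ω)) (hσ : IsW12 T σ σ') (hσtop : spaceTimeSup T σ < ⊤)
    -- structure of the nonlinearity
    (L : ℝ) (hL : 0 < L) (hγL : ∀ t s : ℝ, 0 ≤ (γ t - γ s) * (t - s) + L * |t - s| ^ 2)
    (hlam₀ : 0 < lam - L * (spaceTimeSup T σ).toReal)
    (C₁ : ℝ) (hC₁ : 0 < C₁) (hγC : ∀ s : ℝ, |γ s| ≤ C₁ * (|s| + 1))
    -- admissibility of the initial datum, in `V*`
    (hz₀ : ∀ v : SpaceV Ω ΓD, (∀ᵐ x ∂vol Ω, 0 ≤ fnV v x) →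
      ∫ x in Ω, (-lapXV z₀ x + lam * fnXV z₀ x + σ 0 x * γ (fnXV z₀ x)) * fnV v x ≤ F 0 v)
    -- lower bound of the forcing term, sign of the coefficient
    (hflow : ∃ ftil : L2 Ω, ∀ᵐ t ∂timeMeasure T, ∀ᵐ x ∂vol Ω, ftil x ≤ f t x)
    (hσpos : ∀ᵐ t ∂timeMeasure T, ∀ᵐ x ∂vol Ω, 0 ≤ σ t x)
    -- the strong solution
    (z : ℝ → L2 Ω) (hz : IsStrongSolution ΓD ΓN T lam γ σ f (fnXV z₀) z) :
    -- (i) complete irreversibility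
    (∀ z' : ℝ → L2 Ω, IsW12 T z z' → ∀ᵐ t ∂timeMeasure T, ∀ᵐ x ∂vol Ω, z' t x ≤ 0) ∧
    -- the energy is well defined on `V × [0,T]`
    (∀ t ∈ Icc 0 T, ∀ v : SpaceV Ω ΓD, Integrable (fun x => σ t x * γhat (fnV v x)) (vol Ω)) ∧
    -- `z(t) ∈ V` for every `t`
    ∃ zV : ℝ → SpaceV Ω ΓD, (∀ t ∈ Icc 0 T, fnV (zV t) = z t) ∧
    -- (ii) unilateral equilibrium
    (∀ t ∈ Icc 0 T, ∀ v : SpaceV Ω ΓD, (∀ᵐ x ∂vol Ω, fnV v x ≤ z t x) →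
      energy lam γhat σ F (zV t) t ≤ energy lam γhat σ F v t) ∧
    -- (iii) absolute continuity of the energy
    AbsolutelyContinuousOnInterval (fun t => energy lam γhat σ F (zV t) t) 0 T ∧
    -- the integrals in the energy balance exist
    (∀ᵐ r ∂timeMeasure T, Integrable (fun x => σ' r x * γhat (z r x)) (vol Ω)) ∧
    IntervalIntegrable (fun r => ∫ x in Ω, σ' r x * γhat (z r x)) volume 0 T ∧
    IntervalIntegrable (fun r => F' r (zV r)) volume 0 T ∧
    -- energy balance
    (∀ t ∈ Icc 0 T, ∀ s ∈ Icc 0 T,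
      energy lam γhat σ F (zV t) t - energy lam γhat σ F (zV s) s =
        (∫ r in s..t, ∫ x in Ω, σ' r x * γhat (z r x)) - ∫ r in s..t, F' r (zV r)) ∧
    -- no evolution for stationary data
    ((∀ᵐ r ∂timeMeasure T, F' r = 0) → (∀ᵐ r ∂timeMeasure T, σ' r = 0) →
      ∀ t ∈ Icc 0 T, z t = fnXV z₀) := by
  have : IsFiniteMeasure (vol Ω) := ⟨by simpa using hΩ.isBounded.measure_lt_top⟩
  obtain ⟨z', Z, hz1, hZ, hZz, hle, heq, hz0⟩ := hz
  have hσS := coefficient_bounds hT hσ.continuousOn hσtop hσpos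
  obtain ⟨Φ, hΦ, hΦi⟩ := exists_nemytskii (ΓD := ΓD) hN hΩ hp2 hp hγhat hγC
  obtain ⟨zV, hzV, hZV, hzz, hAC, hd⟩ := exists_continuousOn_representative hΩ hT hz1 hZ hZz
  obtain ⟨hi1, hi2, hbal⟩ := energy_sub_eq_integral hΩ hT (lam := lam) hγ hγhat hγC hL.le hγL hΦ hΦi
    hf hF hfF hσ ENNReal.toReal_nonneg hσS hz1 heq hzV hzz hAC hd
  have hEAC : AbsolutelyContinuousOnInterval (fun t => energy lam γhat σ F (zV t) t) 0 T := by
    refine (absolutelyContinuous_of_sub_eq_integral hT (hi1.sub hi2) fun s hs t ht => ?_).1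
    rw [hbal t ht s hs]
    exact (intervalIntegral.integral_sub (IntervalIntegrable.mono_Icc hi1 hs ht)
      (IntervalIntegrable.mono_Icc hi2 hs ht)).symm
  have hEc : ContinuousOn (fun t => energy lam γhat σ F (zV t) t) (Icc 0 T) := by
    simpa only [uIcc_of_le hT.le] using hEAC.continuousOn
  have hanti : ∀ s ∈ Icc 0 T, ∀ t ∈ Icc 0 T, s ≤ t → z t ≤ z s := fun s hs t ht =>
    hz1.antitone_of_nonpos hT (by
      filter_upwards [hle] with t ht
      refine (Lp.coeFn_le _ _).1 ?_
      filter_upwards [ht, Lp.coeFn_zero ℝ 2 (vol Ω)] with x h1 h2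
      rw [h2]
      exact h1.1) hs ht
  have h0 : (0 : ℝ) ∈ Icc 0 T := ⟨le_rfl, hT.le⟩
  have hzV0 : zV 0 = toVL Ω ΓD ΓN z₀ := fnV_injective hΩ.isOpen (by rw [hzz 0 h0, hz0, fnV_toVL])
  have hinit := fun v => energy_sub_ge_of_le hΩ (lam := lam) hγ hγhat hγC hL.le hγL F (hσS 0 h0) z₀
    hz₀ v
  have hgoal : ∀ r ∈ Icc 0 T, ∫ x in Ω, σ' r x * γhat (z r x) = Φ (zV r) (σ' r) := fun r hr => by
    rw [(hΦi _ _).2, hzz r hr]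
  have hgoal' : ∀ s ∈ Icc 0 T, ∀ t ∈ Icc 0 T, ∫ r in s..t, ∫ x in Ω, σ' r x * γhat (z r x) =
      ∫ r in s..t, Φ (zV r) (σ' r) := fun s hs t ht =>
    intervalIntegral.integral_congr fun r hr => hgoal r (uIcc_subset_Icc hs ht hr)
  refine ⟨?_, fun t _ v => (hΦi v _).1, zV, hzz, ?_, hEAC, ?_, ?_, hi2, ?_, ?_⟩
  · intro w hw
    filter_upwards [hz1.ae_eq_deriv hT hw, hle] with t h1 h2
    rw [← h1]
    filter_upwards [h2] with x h3 using h3.1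
  · intro t ht v hv
    -- No earlier times are available at `t = 0`; there the admissibility of `z₀` provides the
    -- inequality.
    rcases ht.1.eq_or_lt with h | h
    · subst h
      have h1 := hinit v (by rwa [hz0] at hv)
      rw [← hzV0] at h1
      have h2 : 0 ≤ (lam - L * (spaceTimeSup T σ).toReal) / 2 * ‖fnV v - fnXV z₀‖ ^ 2 := by
        positivity
      linarith
    · refine energy_le_of_le hΩ hγ hγhat hγC hL.le hγL hΦi hF.continuousOn hfF hσ.continuousOn
        hlam₀.le hσS hanti hZz ?_ hEc hZV ⟨h, ht.2⟩ hv
      filter_upwards [hle] with r h1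
      filter_upwards [h1] with x h2 using h2.2
  · filter_upwards [ae_restrict_mem measurableSet_Ioo] with r hr
    rw [← hzz r (Ioo_subset_Icc_self hr)]
    exact (hΦi _ _).1
  · refine hi1.congr fun r hr => (hgoal r ?_).symm
    exact uIoc_subset_uIcc.trans (uIcc_of_le hT.le).subset hr
  · intro t ht s hs
    rw [hgoal' s hs t ht]
    exact hbal t ht s hs
  · intro hF' hσ' t ht
    have hE : energy lam γhat σ F (zV t) t = energy lam γhat σ F (zV 0) 0 := by
      rw [← sub_eq_zero, hbal t ht 0 h0, intervalIntegral.integral_zero_ae,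
        intervalIntegral.integral_zero_ae, sub_zero]
      · filter_upwards [ae_of_mem_uIoc hF' h0 ht] with r h1 h2
        rw [h1 h2, zero_apply]
      · filter_upwards [ae_of_mem_uIoc hσ' h0 ht] with r h1 h2
        rw [h1 h2, map_zero]
    -- Constant data make the energy functional itself independent of time. Thus `z t`, which lies
    -- below `z₀`, has the same energy as `z₀` at time zero, and the strict sign of `λ - L‖σ‖`
    -- leaves no distance between them.
    have hE' : energy lam γhat σ F (zV t) 0 = energy lam γhat σ F (zV t) t := by
      simp only [energy, hF.eq_of_deriv_eq_zero hT hF' h0 ht, hσ.eq_of_deriv_eq_zero hT hσ' h0 ht]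
    have h1 := hinit (zV t) (by
      rw [hzz t ht, ← hz0]
      exact (Lp.coeFn_le _ _).2 (hanti 0 h0 t ht ht.1))
    rw [← hzV0, hE', hE, sub_self, hzz t ht] at h1
    have h2 : ‖z t - fnXV z₀‖ ^ 2 ≤ 0 := by
      by_contra h
      exact absurd h1 (not_le.2 (mul_pos (by linarith) (not_le.1 h)))
    exact sub_eq_zero.1 (norm_eq_zero.1 (pow_eq_zero_iff two_ne_zero |>.1
      (le_antisymm h2 (sq_nonneg _))))
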